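/- Let $0<c<b<a$ and consider the billiard inside the triaxial ellipsoid $x^2/a+y^2/b+z^2/c=1$. Put $E=(0,c)$, $H_1=(c,b)$, $H_2=(b,a)$, $H_1\otimes H_1=\{(\lambda_1,\lambda_2)\in H_1\times H_1:\lambda_1<\lambda_2\}$, and let $$\Lambda=(E\times H_1)\cup(H_1\otimes H_1)\cup(E\times H_2)\cup(H_1\times H_2)$$ be the nonsingular caustic space. For $\lambda=(\lambda_1,\lambda_2)\in\Lambda$ write $\{a,b,c,\lambda_1,\lambda_2\}=\{c_1<c_2<c_3<c_4<c_5\}$, $c_0=0$, $T(s)=\prod_{i=1}^5(c_i-s)$, and $K_j=(K_{0j},K_{1j})\in\mathbb R^2$ with $K_{ij}=\int_{c_{2j}}^{c_{2j+1}}\frac{s^i\,ds}{\sqrt{T(s)}}$ for $i=0,1$ and $j=0,1,2$. The frequency map $\omega=(\omega_1,\omega_2):\Lambda\to\mathbb R^2$ is the unique solution of $K_0-2\omega_1K_1+2\omega_2K_2=0$. Let $\Omega=\{(\omega_1,\omega_2)\in\mathbb R^2:0<\omega_2<\omega_1<1/2\}$ and $$\varrho_*=\rho(c;b,a)=\frac{\int_0^{c}\frac{ds}{\sqrt{(c-s)(b-s)(a-s)}}}{2\int_{b}^{a}\frac{ds}{\sqrt{(c-s)(b-s)(a-s)}}},\qquad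 A=(\tfrac12,\tfrac12),\quad B_1=(\tfrac12,\varrho_*),\quad C_1=(\varrho_*,\varrho_*),$$ and let $\triangle[AB_1C_1]$ be the interior of the triangle with vertices $A,B_1,C_1$. **Proposition 5.3.** Assume that the frequency map is a local diffeomorphism, that is, $\det(\partial\omega_j/\partial\lambda_i)(\lambda)\neq0$ for all $\lambda\in\Lambda$. Then: 1. $\omega(H_1\otimes H_1)=\triangle[AB_1C_1]\subsetneq\omega(E\times H_1)$; 2. $\omega:H_1\otimes H_1\to\triangle[AB_1C_1]$ is a global (smooth) diffeomorphism; 3. for every $\omega^0=(\omega^0_1,\omega^0_2)\in\Omega$, $\omega^0\in\omega(H_1\otimes H_1)$ if and only if $\omega^0_2>\rho(c;b,a)$. Finally, for fixed $0<b<a$ (and without the assumption), $\lim_{c\to0^+}\triangle[AB_1C_1]=\Omega$ and $\lim_{c\to b^-}\triangle[AB_1C_1]=\emptyset$, as limits of sets: in each case the set of points that eventually belong to the triangle and the set of points that belong to it for $c$ arbitrarily close to the limit value both equal the stated limit. -/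

import Mathlib

open Set Filter Topology

noncomputable section

namespace TriaxialBilliard

/-! The billiard inside the triaxial ellipsoid `x²/a + y²/b + z²/c = 1`, `0 < c < b < a`.
A caustic parameter is a point `p = (lam₁, lam₂)` of the plane. -/

/-- Ellipsoidal caustics: `E = (0, c)`. -/
def E (c : ℝ) : Set ℝ := Ioo 0 c

/-- One-sheet hyperboloids: `H₁ = (c, b)`. -/
def H1 (b c : ℝ) : Set ℝ := Ioo c b

/-- Two-sheet hyperboloids: `H₂ = (b, a)`. -/
def H2 (a b : ℝ) : Set ℝ := Ioo b a

/-- The component of type H1H1: `H₁ ⊗ H₁ = {lam ∈ H₁ × H₁ : lam₁ < lam₂}`. -/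
def H1H1 (b c : ℝ) : Set (ℝ × ℝ) := {p | p ∈ H1 b c ×ˢ H1 b c ∧ p.1 < p.2}

/-- The nonsingular caustic space, with its four components EH1, H1H1, EH2, H1H2. -/
def causticSpace (a b c : ℝ) : Set (ℝ × ℝ) :=
  (E c ×ˢ H1 b c) ∪ H1H1 b c ∪ (E c ×ˢ H2 a b) ∪ (H1 b c ×ˢ H2 a b)

/-- The sequence `c₀ = 0 < c₁ < ⋯ < c₅` with
`{c₁, …, c₅} = {a, b, c} ∪ {lam₁, lam₂}`; see `endpt_lt_succ` and `endpt_range`. -/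
def endpt (a b c : ℝ) (p : ℝ × ℝ) : Fin 6 → ℝ :=
  ![0, min p.1 c, max p.1 c, min p.2 b, max p.2 b, a]

/-- `T(s) = ∏_{i=1}^{5} (cᵢ - s)`. -/
def T (a b c : ℝ) (p : ℝ × ℝ) (s : ℝ) : ℝ :=
  (a - s) * (b - s) * (c - s) * (p.1 - s) * (p.2 - s)

/-- `∫ sⁱ / √T(s) ds` over the interval from `u` to `v`. -/
def hyperInt (a b c : ℝ) (p : ℝ × ℝ) (i : ℕ) (u v : ℝ) : ℝ :=
  ∫ s in u..v, s ^ i / √(T a b c p s)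

/-- `K_{i0}`, the integral over `(c₀, c₁)`. -/
def K0 (a b c : ℝ) (p : ℝ × ℝ) (i : ℕ) : ℝ :=
  hyperInt a b c p i (endpt a b c p 0) (endpt a b c p 1)

/-- `K_{i1}`, the integral over `(c₂, c₃)`. -/
def K1 (a b c : ℝ) (p : ℝ × ℝ) (i : ℕ) : ℝ :=
  hyperInt a b c p i (endpt a b c p 2) (endpt a b c p 3)

/-- `K_{i2}`, the integral over `(c₄, c₅)`. -/
def K2 (a b c : ℝ) (p : ℝ × ℝ) (i : ℕ) : ℝ :=
  hyperInt a b c p i (endpt a b c p 4) (endpt a b c p 5)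

/-- The determinant of the pair of vectors `K₁, K₂`. -/
def freqDet (a b c : ℝ) (p : ℝ × ℝ) : ℝ :=
  K1 a b c p 0 * K2 a b c p 1 - K2 a b c p 0 * K1 a b c p 1

/-- The frequency map `ω`: the unique solution of the linear system
`K₀ - 2 ω₁ K₁ + 2 ω₂ K₂ = 0` in `ℝ²`, written out by Cramer's rule;
see `freq_unique_solution`. -/
def freq (a b c : ℝ) (p : ℝ × ℝ) : ℝ × ℝ :=
  ((K0 a b c p 0 * K2 a b c p 1 - K2 a b c p 0 * K0 a b c p 1) / (2 * freqDet a b c p),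
   (K0 a b c p 0 * K1 a b c p 1 - K1 a b c p 0 * K0 a b c p 1) / (2 * freqDet a b c p))

/-- The frequency map is nondegenerate (a local diffeomorphism): its Jacobian determinant
vanishes nowhere on the nonsingular caustic space. -/
def FreqNondegenerate (a b c : ℝ) : Prop :=
  ∀ p ∈ causticSpace a b c, (fderiv ℝ (freq a b c) p).det ≠ 0

/-- The rotation number `ρ(lam; b, a)` of the billiard inside the ellipse `x²/a + y²/b = 1`
with caustic parameter `lam`. -/
def rotationNumber (lam b a : ℝ) : ℝ :=
  (∫ s in (0 : ℝ)..(min b lam), 1 / √((lam - s) * (b - s) * (a - s))) /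
    (2 * ∫ s in (max b lam)..a, 1 / √((lam - s) * (b - s) * (a - s)))

/-- `ϱ_* = ρ(c; b, a)`. -/
def rhoStar (a b c : ℝ) : ℝ := rotationNumber c b a

/-- The frequency space `Ω`. -/
def freqSpace : Set (ℝ × ℝ) := {w | 0 < w.2 ∧ w.2 < w.1 ∧ w.1 < 1 / 2}

/-- The interior of the triangle with vertices `P`, `Q`, `R`. -/
def openTriangle (P Q R : ℝ × ℝ) : Set (ℝ × ℝ) := interior (convexHull ℝ {P, Q, R})

/-- The vertex `A = (1/2, 1/2)`. -/
def ptA : ℝ × ℝ := (1 / 2, 1 / 2)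

/-- The vertex `B₁ = (1/2, ϱ_*)`. -/
def ptB1 (a b c : ℝ) : ℝ × ℝ := (1 / 2, rhoStar a b c)

/-- The vertex `C₁ = (ϱ_*, ϱ_*)`. -/
def ptC1 (a b c : ℝ) : ℝ × ℝ := (rhoStar a b c, rhoStar a b c)

/-- `△[A B₁ C₁]`. -/
def triangleAB1C1 (a b c : ℝ) : Set (ℝ × ℝ) :=
  openTriangle ptA (ptB1 a b c) (ptC1 a b c)

/-- `f` restricts to a (smooth) diffeomorphism from the open set `U` onto the open set `V`. -/
def IsDiffeoOnto (f : ℝ × ℝ → ℝ × ℝ) (U V : Set (ℝ × ℝ)) : Prop :=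
  IsOpen U ∧ IsOpen V ∧ BijOn f U V ∧ ContDiffOn ℝ (⊤ : ℕ∞) f U ∧
    ∃ g : ℝ × ℝ → ℝ × ℝ, InvOn g f U V ∧ ContDiffOn ℝ (⊤ : ℕ∞) g V

/-- The family of sets `F` converges to `S` along the filter `l`: lower limit (points that are
eventually in `F`) and upper limit (points that are frequently in `F`) both equal `S`. -/
def SetTendsto (F : ℝ → Set (ℝ × ℝ)) (l : Filter ℝ) (S : Set (ℝ × ℝ)) : Prop :=
  liminf F l = S ∧ limsup F l = S

/-! ### The definitions are consistent on the nonsingular caustic space -/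

theorem endpt_lt_succ {a b c : ℝ} (hc : 0 < c) (hcb : c < b) (hba : b < a) {p : ℝ × ℝ}
    (hp : p ∈ causticSpace a b c) (i : Fin 5) :
    endpt a b c p i.castSucc < endpt a b c p i.succ := by
  obtain ⟨x, y⟩ := p
  simp only [causticSpace, H1H1, E, H1, H2, mem_union, mem_prod, mem_Ioo, mem_ofPred_eq] at hp
  fin_cases i <;> simp [endpt] <;> grind

theorem endpt_range {a b c : ℝ} {p : ℝ × ℝ} :
    endpt a b c p '' {0}ᶜ = {a, b, c} ∪ {p.1, p.2} := by
  obtain ⟨x, y⟩ := p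
  ext t
  simp only [mem_image, mem_compl_iff, mem_singleton_iff]
  constructor
  · rintro ⟨i, hi, rfl⟩
    fin_cases i <;> simp [endpt] at hi ⊢ <;> grind
  · intro h
    simp only [mem_union, mem_insert_iff, mem_singleton_iff] at h
    rcases h with (rfl | rfl | rfl) | (rfl | rfl)
    · exact ⟨5, by decide, by simp [endpt]⟩
    · rcases le_total y t with h | h
      · exact ⟨4, by decide, by simp [endpt, h]⟩
      · exact ⟨3, by decide, by simp [endpt, h]⟩
    · rcases le_total x t with h | h
      · exact ⟨2, by decide, by simp [endpt, h]⟩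
      · exact ⟨1, by decide, by simp [endpt, h]⟩
    · rcases le_total t c with h | h
      · exact ⟨1, by decide, by simp [endpt, h]⟩
      · exact ⟨2, by decide, by simp [endpt, h]⟩
    · rcases le_total t b with h | h
      · exact ⟨3, by decide, by simp [endpt, h]⟩
      · exact ⟨4, by decide, by simp [endpt, h]⟩

theorem intervalIntegrable_div_sqrt {u v : ℝ} (huv : u < v) {h : ℝ → ℝ}
    (hh : ContinuousOn h (Icc u v)) :
    IntervalIntegrable (fun s => h s / √((s - u) * (v - s))) MeasureTheory.volume u v := by
  have key : IntervalIntegrable (fun s => 1 / √((s - u) * (v - s)))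
      MeasureTheory.volume u v := by
    refine intervalIntegral.intervalIntegrable_deriv_of_nonneg
      (g := fun s => Real.arcsin ((2 * s - u - v) / (v - u))) ?_ ?_ ?_
    · exact (Real.continuous_arcsin.comp (by fun_prop)).continuousOn
    · intro s hs
      rw [min_eq_left huv.le, max_eq_right huv.le] at hs
      obtain ⟨h1, h2⟩ := hs
      have hd : 0 < v - u := by linarith
      have e1 : (2 * s - u - v) / (v - u) ≠ -1 := by
        intro h; rw [div_eq_iff hd.ne'] at h; linarith
      have e2 : (2 * s - u - v) / (v - u) ≠ 1 := by
        intro h; rw [div_eq_iff hd.ne'] at h; linarith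
      have hl : HasDerivAt (fun s : ℝ => (2 * s - u - v) / (v - u)) (2 / (v - u)) s := by
        have := ((((hasDerivAt_id s).const_mul 2).sub_const u).sub_const v).div_const (v - u)
        simpa using this
      have := (Real.hasDerivAt_arcsin e1 e2).comp s hl
      refine this.congr_deriv ?_
      have hq : 1 - ((2 * s - u - v) / (v - u)) ^ 2
          = ((2 / (v - u)) ^ 2) * ((s - u) * (v - s)) := by
        field_simp; ring
      rw [hq, Real.sqrt_mul (by positivity), Real.sqrt_sq (by positivity)]
      have : 0 < √((s - u) * (v - s)) :=
        Real.sqrt_pos.2 (mul_pos (by linarith) (by linarith))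
      field_simp
    · intro s _; positivity
  have := key.continuousOn_mul (g := h) (by rwa [uIcc_of_le huv.le])
  simpa [div_eq_mul_inv] using this

theorem endpt_prod (a b c : ℝ) (p : ℝ × ℝ) (s : ℝ) :
    T a b c p s = (endpt a b c p 1 - s) * (endpt a b c p 2 - s) * (endpt a b c p 3 - s) *
      (endpt a b c p 4 - s) * (endpt a b c p 5 - s) := by
  obtain ⟨x, y⟩ := p
  simp only [T, endpt, Matrix.cons_val]
  rcases le_total x c with h | h <;> rcases le_total y b with h' | h' <;> simp [h, h'] <;> ring

theorem freqDet_pos {a b c : ℝ} (hc : 0 < c) (hcb : c < b) (hba : b < a) {p : ℝ × ℝ}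
    (hp : p ∈ causticSpace a b c) : 0 < freqDet a b c p := by
  have m0 := endpt_lt_succ hc hcb hba hp 0
  have m1 := endpt_lt_succ hc hcb hba hp 1
  have m2 := endpt_lt_succ hc hcb hba hp 2
  have m3 := endpt_lt_succ hc hcb hba hp 3
  have m4 := endpt_lt_succ hc hcb hba hp 4
  have hT := endpt_prod a b c p
  simp only [freqDet, K1, K2, hyperInt]
  generalize T a b c p = F at *
  change endpt a b c p 0 < endpt a b c p 1 at m0
  change endpt a b c p 1 < endpt a b c p 2 at m1
  change endpt a b c p 2 < endpt a b c p 3 at m2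
  change endpt a b c p 3 < endpt a b c p 4 at m3
  change endpt a b c p 4 < endpt a b c p 5 at m4
  generalize endpt a b c p 0 = e0 at *
  generalize endpt a b c p 1 = e1 at *
  generalize endpt a b c p 2 = e2 at *
  generalize endpt a b c p 3 = e3 at *
  generalize endpt a b c p 4 = e4 at *
  generalize endpt a b c p 5 = e5 at *
  have gen : ∀ (u v : ℝ) (G : ℝ → ℝ), u < v → Continuous G → (∀ s ∈ Icc u v, 0 < G s) →
      (∀ s, F s = (s - u) * (v - s) * G s) →
      (∀ i : ℕ, IntervalIntegrable (fun s => s ^ i / √(F s)) MeasureTheory.volume u v) ∧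
      0 < ∫ s in u..v, s ^ 0 / √(F s) := by
    intro u v G huv hG hpos hF
    have hi : ∀ i : ℕ,
        IntervalIntegrable (fun s => s ^ i / √(F s)) MeasureTheory.volume u v := by
      intro i
      have := intervalIntegrable_div_sqrt huv (h := fun s => s ^ i / √(G s)) (by
        refine ContinuousOn.div (by fun_prop) (by fun_prop) fun s hs => ?_
        exact (Real.sqrt_pos.2 (hpos s hs)).ne')
      refine this.congr_uIoo ?_
      intro s hs
      rw [uIoo_of_le huv.le] at hs
      simp only [hF, div_div]
      rw [Real.sqrt_mul (mul_nonneg (by linarith [hs.1]) (by linarith [hs.2])), mul_comm]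
    refine ⟨hi, intervalIntegral.intervalIntegral_pos_of_pos_on (hi 0) (fun s hs => ?_) huv⟩
    have : 0 < F s := by
      rw [hF]
      exact mul_pos (mul_pos (by linarith [hs.1]) (by linarith [hs.2]))
        (hpos s ⟨hs.1.le, hs.2.le⟩)
    positivity
  obtain ⟨i1, p1⟩ := gen e2 e3 (fun s => (s - e1) * (e4 - s) * (e5 - s)) m2 (by fun_prop)
    (fun s hs => mul_pos (mul_pos (by linarith [hs.1]) (by linarith [hs.2]))
      (by linarith [hs.2])) (fun s => by rw [hT]; ring)
  obtain ⟨i2, p2⟩ := gen e4 e5 (fun s => (s - e1) * (s - e2) * (s - e3)) m4 (by fun_prop)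
    (fun s hs => mul_pos (mul_pos (by linarith [hs.1]) (by linarith [hs.1]))
      (by linarith [hs.1])) (fun s => by rw [hT]; ring)
  have b1 : (∫ s in e2..e3, s ^ 1 / √(F s)) ≤ e3 * ∫ s in e2..e3, s ^ 0 / √(F s) := by
    rw [← intervalIntegral.integral_const_mul]
    refine intervalIntegral.integral_mono_on m2.le (i1 1) ((i1 0).const_mul _) fun s hs => ?_
    rw [pow_one, pow_zero, mul_one_div]
    exact div_le_div_of_nonneg_right hs.2 (Real.sqrt_nonneg _)
  have b2 : e4 * (∫ s in e4..e5, s ^ 0 / √(F s)) ≤ ∫ s in e4..e5, s ^ 1 / √(F s) := by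
    rw [← intervalIntegral.integral_const_mul]
    refine intervalIntegral.integral_mono_on m4.le ((i2 0).const_mul _) (i2 1) fun s hs => ?_
    rw [pow_one, pow_zero, mul_one_div]
    exact div_le_div_of_nonneg_right hs.1 (Real.sqrt_nonneg _)
  nlinarith [mul_pos p1 p2, mul_le_mul_of_nonneg_left b2 p1.le,
    mul_le_mul_of_nonneg_left b1 p2.le, mul_pos (mul_pos p1 p2) (sub_pos.2 m3)]

/-- On the nonsingular caustic space, `freq` is the unique solution of
`K₀ - 2 ω₁ K₁ + 2 ω₂ K₂ = 0`. -/
theorem freq_unique_solution {a b c : ℝ} (hc : 0 < c) (hcb : c < b) (hba : b < a) {p : ℝ × ℝ}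
    (hp : p ∈ causticSpace a b c) (w : ℝ × ℝ) :
    (∀ i ∈ ({0, 1} : Set ℕ),
      K0 a b c p i - 2 * w.1 * K1 a b c p i + 2 * w.2 * K2 a b c p i = 0) ↔
      w = freq a b c p := by
  have hD := (freqDet_pos hc hcb hba hp).ne'
  obtain ⟨x, y⟩ := w
  simp only [freq, Prod.mk.injEq, eq_div_iff (mul_ne_zero two_ne_zero hD), mem_insert_iff,
    mem_singleton_iff, forall_eq_or_imp, forall_eq]
  unfold freqDet at *
  constructor
  · rintro ⟨h0, h1⟩
    constructor
    · linear_combination (-K2 a b c p 1) * h0 + K2 a b c p 0 * h1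
    · linear_combination (-K1 a b c p 1) * h0 + K1 a b c p 0 * h1
  · rintro ⟨hx, hy⟩
    constructor
    · refine (mul_eq_zero.1 ?_).resolve_left hD
      linear_combination (-K1 a b c p 0) * hx + K2 a b c p 0 * hy
    · refine (mul_eq_zero.1 ?_).resolve_left hD
      linear_combination (-K1 a b c p 1) * hx + K2 a b c p 1 * hy

end TriaxialBilliard

end

/-! Write `A`, `B`, `C` for the period vectors over `(0, e₀)`, `(e₁, e₂)`, `(e₃, e₄)`, where `e₀ < ⋯
< e₄` are the positive branch points. By Cramer, `2ω₁ = det(A,C)/det(B,C)` and `2ω₂ =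
det(A,B)/det(B,C)`.

The differentials `sᵏ ds/√T`, `k = 0, 1`, are holomorphic in the upper half plane and decay fast
enough for Cauchy's theorem along the real axis. Its real part is the relation `M = B - C - A`, with
`M` the period over `(-∞, 0)` (`tendsto_rootInt_five`). Hence `1/2 - ω₁` and `ω₁ - ω₂` are
`det(M,C)` and `det(M,A)` divided by `2 det(B,C)`. Such determinants are integrals of a linear form
of constant sign, so they are positive, which puts all frequencies in `Ω`, and they have explicit
bounds.

The bounds give the behaviour at the boundary of a component. If `e₀`, `e₁` collide, `A` diverges
logarithmically and `ω₁ → 1/2`. If `e₂`, `e₃` collide, `C` diverges and `ω₁ - ω₂ → 0`. If `e₀ → 0`,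
then `ω₁ → 0`. If `e₁`, `e₂` collide, the two factors cancel against the linear form and `ω₂`
approaches the genus one quantity `ρ(e₀; e₃, e₄)` (`freqOf_snd_bounds`).

On `H₁ ⊗ H₁` every boundary cluster value therefore lies on one of the lines `w₁ = 1/2`, `w₁ = w₂`,
`w₂ = ϱ_*`. Over a connected set missing these lines the map is proper and open, so that set is
covered entirely or not at all (`subset_image_or_disjoint`). The region below `w₂ = ϱ_*` contains
points outside `Ω` and is not covered, so the open image lies in the triangle and fills it. A proper
local homeomorphism from a connected space onto a simply connected one is injective, which yields
the diffeomorphism. On `E × H₁` the same alternative shows that the triangle is covered, since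
monotonicity of `ρ` keeps the values near `λ₂ = c` below it; the inclusion is strict because `ω₁`
becomes arbitrarily small near `λ₁ = 0`.

The limits in `c` follow from `ϱ_* → 0` and `ϱ_* → 1/2`, proved with the genus one version of the
relation. -/

noncomputable section

namespace TriaxialBilliard

/-! ### A contour integral for products of inverse square roots -/

/-- The branch of `(c - z)^(-1/2)`, up to a constant phase, that is holomorphic on the upper half
plane and continuous up to the real axis away from `c`. -/
def upperRoot (w : ℂ) : ℂ := (Complex.I * w) ^ (((-(1 / 2) : ℝ)) : ℂ)

theorem norm_upperRoot (w : ℂ) : ‖upperRoot w‖ = ‖w‖ ^ (-(1 / 2) : ℝ) := by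
  rw [upperRoot, Complex.norm_cpow_real]; simp

/-- Multiplication by `I` carries the closed lower half plane to the closed right half plane, which
meets the cut of the principal power only at `0`. For `z` in the closed upper half plane, `cᵢ - z`
is in the closed lower one. -/
theorem mem_slitPlane_I_mul {w : ℂ} (h : w.im ≤ 0) (h0 : w ≠ 0) :
    Complex.I * w ∈ Complex.slitPlane := by
  rw [Complex.mem_slitPlane_iff]
  rcases h.lt_or_eq with h | h
  · left; simp; exact h
  · right
    simp
    intro h'
    exact h0 (Complex.ext h' h)

theorem continuousAt_upperRoot {w : ℂ} (h : w.im ≤ 0) (h0 : w ≠ 0) : ContinuousAt upperRoot w := by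
  have h1 := continuousAt_cpow_const (b := (((-(1 / 2) : ℝ)) : ℂ)) (mem_slitPlane_I_mul h h0)
  exact ContinuousAt.comp (f := fun w => Complex.I * w) h1 (by fun_prop)

theorem differentiableAt_upperRoot {w : ℂ} (h : w.im < 0) : DifferentiableAt ℂ upperRoot w := by
  have h0 : w ≠ 0 := by rintro rfl; simp at h
  unfold upperRoot
  exact (by fun_prop : DifferentiableAt ℂ (fun w => Complex.I * w) w).cpow_const
    (mem_slitPlane_I_mul h.le h0)

/-- The value of `upperRoot` at `1`. -/
def phase : ℂ := Complex.exp (-(Real.pi / 4 : ℝ) * Complex.I)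

theorem phase_ne_zero : phase ≠ 0 := Complex.exp_ne_zero _

theorem upperRoot_of_pos {x : ℝ} (hx : 0 < x) : upperRoot x = phase * ((√x)⁻¹ : ℝ) := by
  have hx' : (x : ℂ) ≠ 0 := by exact_mod_cast hx.ne'
  rw [upperRoot, mul_comm, Complex.cpow_def_of_ne_zero (mul_ne_zero hx' Complex.I_ne_zero),
    Complex.log_ofReal_mul hx Complex.I_ne_zero, Complex.log_I, add_mul, Complex.exp_add, mul_comm,
    phase]
  congr 1
  · congr 1; push_cast; ring
  · rw [Real.sqrt_eq_rpow, ← Real.rpow_neg hx.le, Real.rpow_def_of_pos hx]; push_cast; rfl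

/-- From positive to negative `x` the argument of `I * x` drops from `π/2` to `-π/2`, so the power
`-1/2` gains the factor `I`. This is the phase picked up when a branch point is passed. -/
theorem upperRoot_of_neg {x : ℝ} (hx : x < 0) :
    upperRoot x = phase * (Complex.I * ((√(-x))⁻¹ : ℝ)) := by
  have hx1 : 0 < -x := by linarith
  have hx' : ((-x : ℝ) : ℂ) ≠ 0 := by exact_mod_cast hx1.ne'
  have hI : (-Complex.I) ≠ 0 := neg_ne_zero.2 Complex.I_ne_zero
  have e : Complex.I * (x : ℂ) = ((-x : ℝ) : ℂ) * (-Complex.I) := by push_cast; ring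
  rw [upperRoot, e, Complex.cpow_def_of_ne_zero (mul_ne_zero hx' hI),
    Complex.log_ofReal_mul hx1 hI, Complex.log_neg_I, add_mul, Complex.exp_add, mul_comm, ← mul_assoc,
    phase]
  congr 1
  · trans Complex.exp (-(Real.pi / 4 : ℝ) * Complex.I) * Complex.exp (Real.pi / 2 * Complex.I)
    · rw [← Complex.exp_add]
      congr 1; push_cast; ring
    · rw [Complex.exp_pi_div_two_mul_I]
  · rw [Real.sqrt_eq_rpow, ← Real.rpow_neg hx1.le, Real.rpow_def_of_pos hx1]; push_cast; rfl

/-- `zᵏ` divided by the product of the square roots of `cᵢ - z`, up to a constant phase. -/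
def rootProd {n : ℕ} (c : Fin n → ℝ) (k : ℕ) (z : ℂ) : ℂ := z ^ k * ∏ i, upperRoot (c i - z)

theorem norm_rootProd {n : ℕ} (c : Fin n → ℝ) (k : ℕ) (z : ℂ) :
    ‖rootProd c k z‖ = ‖z‖ ^ k * ∏ i, ‖(c i : ℂ) - z‖ ^ (-(1 / 2) : ℝ) := by
  simp [rootProd, norm_upperRoot]

theorem continuousAt_rootProd {n : ℕ} (c : Fin n → ℝ) (k : ℕ) {z : ℂ} (h : 0 ≤ z.im)
    (h0 : ∀ i, (c i : ℂ) ≠ z) : ContinuousAt (rootProd c k) z := by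
  unfold rootProd
  refine ContinuousAt.mul (by fun_prop) ?_
  refine tendsto_finsetProd _ fun i _ => ?_
  refine ContinuousAt.comp (g := upperRoot) (f := fun z => (c i : ℂ) - z)
    (continuousAt_upperRoot (by simpa using h) (sub_ne_zero.2 (h0 i))) (by fun_prop)

theorem differentiableAt_rootProd {n : ℕ} (c : Fin n → ℝ) (k : ℕ) {z : ℂ} (h : 0 < z.im) :
    DifferentiableAt ℂ (rootProd c k) z := by
  unfold rootProd
  refine DifferentiableAt.mul (by fun_prop) ?_
  refine DifferentiableAt.fun_finsetProd fun i _ => ?_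
  exact DifferentiableAt.comp (g := upperRoot) (f := fun z => (c i : ℂ) - z) z
    (differentiableAt_upperRoot (by simpa using h)) (by fun_prop)

/-- Since `c` is injective, at most one factor is singular at a given point. It is an integrable
inverse square root, and the remaining factors are bounded nearby. -/
theorem locallyIntegrable_prod_abs_rpow {n : ℕ} {c : Fin n → ℝ} (hc : Function.Injective c) :
    MeasureTheory.LocallyIntegrable (fun s : ℝ => ∏ i, |c i - s| ^ (-(1 / 2) : ℝ)) := by
  have hsing : MeasureTheory.LocallyIntegrable (fun s : ℝ => |s| ^ (-(1 / 2) : ℝ)) := by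
    refine MeasureTheory.locallyIntegrable_of_norm_le_rpow (C := 1) (α := 1 / 2) (by simp)
      (by simp; norm_num) ?_ ?_
    · refine Eventually.of_forall fun x => ?_
      rw [one_mul, Real.norm_eq_abs, Real.norm_eq_abs, abs_of_nonneg (by positivity)]
    · exact Measurable.aestronglyMeasurable (by fun_prop)
  have hmeas : ∀ S : Finset (Fin n), Measurable (fun s : ℝ => ∏ i ∈ S, |c i - s| ^ (-(1 / 2) : ℝ)) :=
    fun S => Finset.measurable_fun_prod _ fun i _ => by fun_prop
  have hcont : ∀ (S : Finset (Fin n)) (x : ℝ), (∀ i ∈ S, c i ≠ x) →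
      ContinuousAt (fun s : ℝ => ∏ i ∈ S, |c i - s| ^ (-(1 / 2) : ℝ)) x := by
    intro S x h
    refine tendsto_finsetProd _ fun i hi => ?_
    refine ContinuousAt.rpow_const (by fun_prop) (Or.inl ?_)
    simpa [sub_eq_zero] using h i hi
  have main : ∀ (S : Finset (Fin n)) (x : ℝ) (g : ℝ → ℝ), (∀ i ∈ S, c i ≠ x) →
      MeasureTheory.IntegrableAtFilter g (𝓝 x) →
      MeasureTheory.IntegrableAtFilter
        (fun s => (∏ i ∈ S, |c i - s| ^ (-(1 / 2) : ℝ)) * g s) (𝓝 x) := by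
    rintro S x g hS ⟨u, hu, hgu⟩
    have hb := (hcont S x hS).norm.eventually_lt_const (lt_add_one _)
    obtain ⟨v, hv, hvo, hxv⟩ := mem_nhds_iff.1 (inter_mem hb hu)
    refine ⟨v, hvo.mem_nhds hxv, ?_⟩
    refine MeasureTheory.Integrable.bdd_mul (c := ‖∏ i ∈ S, |c i - x| ^ (-(1 / 2) : ℝ)‖ + 1)
      (hgu.mono_set fun y hy => (hv hy).2) (hmeas S).aestronglyMeasurable ?_
    refine (MeasureTheory.ae_restrict_iff' hvo.measurableSet).2 (Eventually.of_forall fun y hy => ?_)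
    exact (hv hy).1.le
  intro x
  by_cases hx : ∃ j, c j = x
  · obtain ⟨j, rfl⟩ := hx
    have h1 : MeasureTheory.LocallyIntegrable (fun s : ℝ => |c j - s| ^ (-(1 / 2) : ℝ)) := by
      intro y
      obtain ⟨u, hu, hi⟩ := hsing (c j - y)
      refine ⟨(fun s => c j - s) ⁻¹' u, (by fun_prop : Continuous fun s => c j - s).continuousAt hu, ?_⟩
      exact ((MeasureTheory.Measure.measurePreserving_sub_left MeasureTheory.volume (c j)).integrableOn_comp_preimage
        (MeasurableEquiv.subLeft (c j)).measurableEmbedding).2 hi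
    have := main (Finset.univ.erase j) (c j) _ (fun i hi h => (Finset.ne_of_mem_erase hi) (hc h)) (h1 (c j))
    refine this.congr (Eventually.of_forall fun s => ?_)
    exact Finset.prod_erase_mul _ _ (Finset.mem_univ j)
  · push Not at hx
    have := main Finset.univ x (fun _ => 1) (fun i _ => hx i)
      ((continuous_const (y := (1:ℝ))).locallyIntegrable x)
    simpa using this

theorem norm_rootProd_le_of_le_norm {n : ℕ} {c : Fin n → ℝ} {k : ℕ} {B R : ℝ} (hB : ∀ i, |c i| ≤ B)
    (hR : 2 * B ≤ R) (hR0 : 0 < R) {z : ℂ} (h1 : R ≤ ‖z‖) (h2 : ‖z‖ ≤ 2 * R) :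
    ‖rootProd c k z‖ ≤ (2 * R) ^ k * (R / 2) ^ (-(n / 2 : ℝ)) := by
  rw [norm_rootProd]
  have h3 : ∏ i, ‖(c i : ℂ) - z‖ ^ (-(1 / 2) : ℝ) ≤ ∏ _i : Fin n, (R / 2) ^ (-(1 / 2) : ℝ) := by
    refine Finset.prod_le_prod (fun i _ => by positivity) fun i _ => ?_
    refine Real.rpow_le_rpow_of_nonpos (by positivity) ?_ (by norm_num)
    have := norm_sub_norm_le z (c i)
    rw [norm_sub_rev, Complex.norm_real, Real.norm_eq_abs] at this
    linarith [hB i]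
  have h4 : ∏ _i : Fin n, (R / 2) ^ (-(1 / 2) : ℝ) = (R / 2) ^ (-(n / 2 : ℝ)) := by
    rw [Finset.prod_const, Finset.card_univ, Fintype.card_fin, ← Real.rpow_natCast,
      ← Real.rpow_mul (by positivity)]
    congr 1; ring
  rw [h4] at h3
  gcongr

/-- Cauchy's theorem on the rectangle `[-R, R] × [ε, R]`. The other three sides lie in `R ≤ ‖z‖ ≤
2R` and have total length at most `4R`. -/
theorem norm_integral_rootProd_le {n : ℕ} {c : Fin n → ℝ} {k : ℕ} {B R : ℝ} (hB : ∀ i, |c i| ≤ B)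
    (hR : 2 * B ≤ R) (hR0 : 0 < R) {ε : ℝ} (hε : 0 < ε) (hεR : ε < R) :
    ‖∫ s in (-R)..R, rootProd c k (s + ε * Complex.I)‖ ≤
      4 * R * ((2 * R) ^ k * (R / 2) ^ (-(n / 2 : ℝ))) := by
  set M := (2 * R) ^ k * (R / 2) ^ (-(n / 2 : ℝ)) with hM
  have hM0 : 0 ≤ M := by positivity
  have hd : DifferentiableOn ℂ (rootProd c k) (uIcc (-R) R ×ℂ uIcc ε R) := by
    rintro z ⟨-, hz⟩
    rw [mem_preimage, uIcc_of_le hεR.le] at hz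
    exact (differentiableAt_rootProd c k (hε.trans_le hz.1)).differentiableWithinAt
  have key := Complex.integral_boundary_rect_eq_zero_of_differentiableOn (rootProd c k)
    ⟨-R, ε⟩ ⟨R, R⟩ hd
  simp only [smul_eq_mul] at key
  have b1 : ‖∫ x in (-R)..R, rootProd c k (x + R * Complex.I)‖ ≤ M * |R - (-R)| := by
    refine intervalIntegral.norm_integral_le_of_norm_le_const fun x hx => ?_
    rw [uIoc_of_le (by linarith)] at hx
    refine norm_rootProd_le_of_le_norm hB hR hR0 ?_ ?_
    · have := Complex.abs_im_le_norm (x + R * Complex.I)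
      simpa [abs_of_pos hR0] using this
    · refine (norm_add_le _ _).trans ?_
      have : |x| ≤ R := abs_le.2 ⟨hx.1.le, hx.2⟩
      simp [abs_of_pos hR0]; linarith
  have b2 : ∀ S : ℝ, |S| = R →
      ‖∫ y in ε..R, rootProd c k (S + y * Complex.I)‖ ≤ M * |R - ε| := by
    intro S hS
    refine intervalIntegral.norm_integral_le_of_norm_le_const fun x hx => ?_
    rw [uIoc_of_le hεR.le] at hx
    refine norm_rootProd_le_of_le_norm hB hR hR0 ?_ ?_
    · have := Complex.abs_re_le_norm (S + x * Complex.I)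
      simpa [hS] using this
    · refine (norm_add_le _ _).trans ?_
      have : |x| ≤ R := abs_le.2 ⟨by linarith [hx.1], hx.2⟩
      simp [hS]; linarith
  have c2 := b2 R (abs_of_pos hR0)
  have c3 := b2 (-R) (by rw [abs_neg, abs_of_pos hR0])
  rw [abs_of_pos (by linarith)] at b1 c2 c3
  have e : (∫ s in (-R)..R, rootProd c k (s + ε * Complex.I)) =
      (∫ x in (-R)..R, rootProd c k (x + R * Complex.I)) -
      Complex.I * (∫ y in ε..R, rootProd c k (R + y * Complex.I)) +
      Complex.I * (∫ y in ε..R, rootProd c k ((-R : ℝ) + y * Complex.I)) := by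
    linear_combination key
  rw [e]
  refine (norm_add_le _ _).trans ?_
  refine (add_le_add_left (norm_sub_le _ _) _).trans ?_
  rw [norm_mul, norm_mul, Complex.norm_I, one_mul, one_mul]
  nlinarith

theorem intervalIntegrable_prod_abs_rpow {n : ℕ} {c : Fin n → ℝ} (hc : Function.Injective c)
    (u v : ℝ) : IntervalIntegrable (fun s : ℝ => ∏ i, |c i - s| ^ (-(1 / 2) : ℝ))
      MeasureTheory.volume u v :=
  (intervalIntegrable_iff').2
    ((locallyIntegrable_prod_abs_rpow hc).integrableOn_isCompact isCompact_uIcc)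

theorem intervalIntegrable_rootProd {n : ℕ} {c : Fin n → ℝ} (hc : Function.Injective c) (k : ℕ)
    (u v : ℝ) : IntervalIntegrable (fun s : ℝ => rootProd c k s) MeasureTheory.volume u v := by
  have h := (intervalIntegrable_prod_abs_rpow hc u v).continuousOn_mul
    (g := fun s => |s| ^ k) (by fun_prop)
  refine h.mono_fun ?_ (Eventually.of_forall fun s => ?_)
  · refine Measurable.aestronglyMeasurable ?_
    unfold rootProd upperRoot
    fun_prop
  · beta_reduce
    rw [norm_rootProd, norm_mul, norm_pow, norm_prod]
    refine mul_le_mul ?_ ?_ (by positivity) (by positivity)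
    · simp
    · refine Finset.prod_le_prod (fun i _ => by positivity) fun i _ => ?_
      rw [← Complex.ofReal_sub, Complex.norm_real, Real.norm_eq_abs, Real.norm_eq_abs]
      exact le_abs_self _

/-- Dominated convergence: moving `s` off the real axis increases its distance to every `cᵢ`, so the
real boundary values furnish the integrable majorant. -/
theorem tendsto_integral_rootProd_add_I {n : ℕ} {c : Fin n → ℝ} (hc : Function.Injective c) (k : ℕ)
    {R : ℝ} (hR0 : 0 < R) :
    Tendsto (fun ε : ℝ => ∫ s in (-R)..R, rootProd c k (s + ε * Complex.I)) (𝓝[>] 0)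
      (𝓝 (∫ s in (-R)..R, rootProd c k s)) := by
  have hne : ∀ᵐ s : ℝ, ∀ i, c i ≠ s := by
    have : (range c).Countable := countable_range c
    filter_upwards [this.ae_notMem MeasureTheory.volume] with s hs i hi
    exact hs ⟨i, hi⟩
  refine intervalIntegral.tendsto_integral_filter_of_dominated_convergence
    (fun s => (2 * R) ^ k * ∏ i, |c i - s| ^ (-(1 / 2) : ℝ)) ?_ ?_ ?_ ?_
  · filter_upwards [self_mem_nhdsWithin] with ε hε
    refine Continuous.aestronglyMeasurable ?_
    rw [continuous_iff_continuousAt]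
    intro s
    have h : 0 < ((s : ℂ) + ε * Complex.I).im := by simpa using hε
    refine ContinuousAt.comp (g := rootProd c k) (f := fun s : ℝ => (s : ℂ) + ε * Complex.I)
      (differentiableAt_rootProd c k h).continuousAt (by fun_prop)
  · filter_upwards [Ioc_mem_nhdsGT hR0] with ε hε
    filter_upwards [hne] with s hs hsR
    rw [uIoc_of_le (by linarith)] at hsR
    rw [norm_rootProd]
    refine mul_le_mul ?_ ?_ (by positivity) (by positivity)
    · refine pow_le_pow_left₀ (norm_nonneg _) ((norm_add_le _ _).trans ?_) _
      have : |s| ≤ R := abs_le.2 ⟨hsR.1.le, hsR.2⟩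
      simp [abs_of_pos hε.1]; linarith [hε.2]
    · refine Finset.prod_le_prod (fun i _ => by positivity) fun i _ => ?_
      refine Real.rpow_le_rpow_of_nonpos (abs_pos.2 (sub_ne_zero.2 (hs i))) ?_ (by norm_num)
      have := Complex.abs_re_le_norm ((c i : ℂ) - (s + ε * Complex.I))
      simpa using this
  · exact (intervalIntegrable_prod_abs_rpow hc _ _).const_mul _
  · filter_upwards [hne] with s hs _
    have h1 := continuousAt_rootProd c k (z := (s : ℂ)) (by simp)
      (fun i => by exact_mod_cast hs i)
    have h2 : Tendsto (fun ε : ℝ => (s : ℂ) + ε * Complex.I) (𝓝[>] 0) (𝓝 (s : ℂ)) := by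
      have : Continuous (fun ε : ℝ => (s : ℂ) + ε * Complex.I) := by fun_prop
      have := this.tendsto 0
      simp only [Complex.ofReal_zero, zero_mul, add_zero] at this
      exact this.mono_left nhdsWithin_le_nhds
    exact h1.tendsto.comp h2

theorem tendsto_integral_rootProd {n : ℕ} {c : Fin n → ℝ} (hc : Function.Injective c) {k : ℕ}
    (hk : 2 * k + 2 < n) :
    Tendsto (fun R : ℝ => ∫ s in (-R)..R, rootProd c k s) atTop (𝓝 0) := by
  obtain ⟨B, hB⟩ : ∃ B, ∀ i, |c i| ≤ B :=
    ⟨∑ i, |c i|, fun i => Finset.single_le_sum (f := fun i => |c i|) (fun _ _ => abs_nonneg _)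
      (Finset.mem_univ i)⟩
  have hbd : ∀ᶠ R : ℝ in atTop, ‖∫ s in (-R)..R, rootProd c k s‖ ≤
      4 * 2 ^ k * 2 ^ (n / 2 : ℝ) * R ^ (-(n / 2 - (k + 1) : ℝ)) := by
    filter_upwards [eventually_ge_atTop (2 * B), eventually_gt_atTop 0] with R hR hR0
    have e : 4 * 2 ^ k * 2 ^ (n / 2 : ℝ) * R ^ (-(n / 2 - (k + 1) : ℝ)) =
        4 * R * ((2 * R) ^ k * (R / 2) ^ (-(n / 2 : ℝ))) := by
      rw [Real.div_rpow hR0.le (by norm_num), Real.rpow_neg (by norm_num : (0:ℝ) ≤ 2),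
        neg_sub, show ((k : ℝ) + 1 - n / 2) = ((k + 1 : ℕ) : ℝ) + -(n / 2 : ℝ) by push_cast; ring,
        Real.rpow_add hR0, Real.rpow_natCast, mul_pow]
      have : (0 : ℝ) < 2 ^ (n / 2 : ℝ) := by positivity
      field_simp
      ring
    rw [e]
    -- The rectangle bound does not depend on `ε`, so it survives `ε → 0` at fixed `R`. It is of
    -- order `R ^ (k + 1 - n / 2)`.
    refine le_of_tendsto (tendsto_integral_rootProd_add_I hc k hR0).norm ?_
    filter_upwards [Ioo_mem_nhdsGT hR0] with ε hε
    exact norm_integral_rootProd_le hB hR hR0 hε.1 hε.2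
  refine squeeze_zero_norm' hbd ?_
  have h : (0 : ℝ) < n / 2 - (k + 1) := by
    have : ((2 * k + 2 : ℕ) : ℝ) < n := by exact_mod_cast hk
    push_cast at this
    linarith
  simpa using (tendsto_rpow_neg_atTop h).const_mul (4 * 2 ^ k * 2 ^ (n / 2 : ℝ))

/-! ### Real hyperelliptic integrals and the linear relation between periods -/

/-- The polynomial `∏ (eᵢ - s)`. -/
def rootPoly {n : ℕ} (e : Fin n → ℝ) (s : ℝ) : ℝ := ∏ i, (e i - s)

theorem continuous_rootPoly {n : ℕ} (e : Fin n → ℝ) : Continuous (rootPoly e) := by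
  unfold rootPoly; fun_prop

/-- The hyperelliptic integral `∫ sᵏ / √(∏ (eᵢ - s)) ds` from `u` to `v`. -/
def rootInt {n : ℕ} (e : Fin n → ℝ) (k : ℕ) (u v : ℝ) : ℝ := ∫ s in u..v, s ^ k / √(rootPoly e s)

theorem prod_abs_rpow_eq {n : ℕ} (e : Fin n → ℝ) (s : ℝ) :
    ∏ i, |e i - s| ^ (-(1 / 2) : ℝ) = (√|rootPoly e s|)⁻¹ := by
  rw [Real.finsetProd_rpow _ _ (fun i _ => abs_nonneg _), ← Finset.abs_prod,
    Real.rpow_neg (abs_nonneg _), Real.sqrt_eq_rpow]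
  rfl

theorem intervalIntegrable_rootInt {n : ℕ} {e : Fin n → ℝ} (he : StrictMono e) (k : ℕ) (u v : ℝ) :
    IntervalIntegrable (fun s => s ^ k / √(rootPoly e s)) MeasureTheory.volume u v := by
  have h := (intervalIntegrable_prod_abs_rpow he.injective u v).continuousOn_mul
    (g := fun s => s ^ k) (by fun_prop)
  refine h.mono_fun ?_ (Eventually.of_forall fun s => ?_)
  · have := (continuous_rootPoly e).measurable
    exact Measurable.aestronglyMeasurable (by fun_prop)
  · beta_reduce
    rw [prod_abs_rpow_eq, div_eq_mul_inv, norm_mul, norm_mul]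
    gcongr
    rw [Real.norm_eq_abs, Real.norm_eq_abs, abs_of_nonneg (by positivity),
      abs_of_nonneg (by positivity)]
    rcases le_or_gt 0 (rootPoly e s) with h | h
    · rw [abs_of_nonneg h]
    -- Where the polynomial is negative, the real square root and hence the quotient are `0` by
    -- convention; integrability therefore holds on every interval.
    · rw [Real.sqrt_eq_zero_of_nonpos h.le]; simp

theorem intervalIntegrable_linear_rootInt {n : ℕ} {e : Fin n → ℝ} (he : StrictMono e) (α β u v : ℝ) :
    IntervalIntegrable (fun s => (α + β * s) / √(rootPoly e s)) MeasureTheory.volume u v := by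
  have := ((intervalIntegrable_rootInt he 0 u v).const_mul α).add
    ((intervalIntegrable_rootInt he 1 u v).const_mul β)
  refine this.congr fun s _ => ?_
  ring

theorem integral_linear_rootInt {n : ℕ} {e : Fin n → ℝ} (he : StrictMono e) (α β u v : ℝ) :
    ∫ s in u..v, (α + β * s) / √(rootPoly e s) = α * rootInt e 0 u v + β * rootInt e 1 u v := by
  rw [rootInt, rootInt, ← intervalIntegral.integral_const_mul, ← intervalIntegral.integral_const_mul,
    ← intervalIntegral.integral_add ((intervalIntegrable_rootInt he 0 u v).const_mul α)
    ((intervalIntegrable_rootInt he 1 u v).const_mul β)]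
  congr 1; ext s; ring

/-- The boundary values of `rootProd`, with the phase normalized, have this real part. -/
def rootRe {n : ℕ} (e : Fin n → ℝ) (k : ℕ) (s : ℝ) : ℝ := (phase⁻¹ ^ n * rootProd e k s).re

/-- Each end point to the left of `s` contributes one factor `I`. The real part thus keeps only the
intervals with an even number of end points on their left, with alternating signs. -/
theorem rootRe_eq {n : ℕ} {e : Fin n → ℝ} (k : ℕ) {s : ℝ} (h : ∀ i, e i ≠ s) :
    rootRe e k s = (∏ i, if e i < s then Complex.I else 1).re * (s ^ k / √|rootPoly e s|) := by
  have h1 : ∀ i, upperRoot ((e i : ℂ) - s) =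
      phase * ((if e i < s then Complex.I else 1) * ((|e i - s| ^ (-(1 / 2) : ℝ) : ℝ) : ℂ)) := by
    intro i
    rw [← Complex.ofReal_sub]
    split_ifs with hi
    · rw [upperRoot_of_neg (sub_neg.2 hi), abs_of_neg (sub_neg.2 hi), Real.rpow_neg (by linarith),
        Real.sqrt_eq_rpow]
    · have hi' : 0 < e i - s := sub_pos.2 (lt_of_le_of_ne (not_lt.1 hi) (h i).symm)
      rw [upperRoot_of_pos hi', abs_of_pos hi', Real.rpow_neg (by linarith),
        Real.sqrt_eq_rpow, one_mul]
  have h2 : rootProd e k s =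
      phase ^ n * ((∏ i, if e i < s then Complex.I else 1) * ((s ^ k / √|rootPoly e s| : ℝ) : ℂ)) := by
    rw [rootProd, Finset.prod_congr rfl fun i _ => h1 i, Finset.prod_mul_distrib,
      Finset.prod_mul_distrib, ← Complex.ofReal_prod, prod_abs_rpow_eq, Finset.prod_const]
    simp only [Finset.card_univ, Fintype.card_fin]
    push_cast
    ring
  rw [rootRe, h2, ← mul_assoc, ← mul_pow, inv_mul_cancel₀ phase_ne_zero, one_pow, one_mul,
    Complex.re_mul_ofReal]

theorem intervalIntegrable_rootRe {n : ℕ} {e : Fin n → ℝ} (he : StrictMono e) (k : ℕ) (u v : ℝ) :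
    IntervalIntegrable (rootRe e k) MeasureTheory.volume u v :=
  have h := (intervalIntegrable_rootProd he.injective k u v).const_mul (phase⁻¹ ^ n)
  ⟨h.1.re, h.2.re⟩

theorem tendsto_integral_rootRe {n : ℕ} {e : Fin n → ℝ} (he : StrictMono e) {k : ℕ}
    (hk : 2 * k + 2 < n) :
    Tendsto (fun R : ℝ => ∫ s in (-R)..R, rootRe e k s) atTop (𝓝 0) := by
  have h := (tendsto_integral_rootProd he.injective hk).const_mul (phase⁻¹ ^ n)
  rw [mul_zero] at h
  have h2 := (Complex.continuous_re.tendsto _).comp h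
  refine h2.congr fun R => ?_
  rw [Function.comp_apply, ← intervalIntegral.integral_const_mul]
  exact (Complex.reCLM.intervalIntegral_comp_comm
    ((intervalIntegrable_rootProd he.injective k _ _).const_mul _)).symm

theorem rootPoly_pos_of_lt {n : ℕ} {e : Fin n → ℝ} {s : ℝ} (h : ∀ i, s < e i) :
    0 < rootPoly e s := Finset.prod_pos fun i _ => sub_pos.2 (h i)

theorem integral_rootRe_left {n : ℕ} {e : Fin n → ℝ} (k : ℕ) {u v : ℝ} (huv : u ≤ v)
    (hv : ∀ i, v ≤ e i) : ∫ s in u..v, rootRe e k s = rootInt e k u v := by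
  refine intervalIntegral.integral_congr_Ioo_of_le huv fun s hs => ?_
  have hs' : ∀ i, s < e i := fun i => hs.2.trans_le (hv i)
  rw [rootRe_eq k fun i => (hs' i).ne', abs_of_pos (rootPoly_pos_of_lt hs'),
    Finset.prod_congr rfl fun i _ => if_neg (hs' i).not_gt]
  simp

/-- The phases on the successive intervals are `1, I, -1, -I, 1, I`. Taking real parts in the
vanishing integral over the line leaves `(-∞, 0)`, `(0, e 0)`, `(e 1, e 2)` and `(e 3, e 4)` with
signs `+, +, -, +`. The condition `k < 2` is what the decay at infinity requires. -/
theorem tendsto_rootInt_five {e : Fin 5 → ℝ} (he : StrictMono e) (h0 : 0 < e 0) {k : ℕ}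
    (hk : k < 2) :
    Tendsto (fun R : ℝ => rootInt e k (-R) 0) atTop
      (𝓝 (rootInt e k (e 1) (e 2) - rootInt e k (e 3) (e 4) - rootInt e k 0 (e 0))) := by
  have m0 : e 0 < e 1 := he (by decide)
  have m1 : e 1 < e 2 := he (by decide)
  have m2 : e 2 < e 3 := he (by decide)
  have m3 : e 3 < e 4 := he (by decide)
  have hI := intervalIntegrable_rootRe he k
  have i0 : ∫ s in (0 : ℝ)..(e 0), rootRe e k s = rootInt e k 0 (e 0) :=
    integral_rootRe_left k h0.le fun i => he.monotone (Fin.zero_le i)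
  have odd : ∀ u v : ℝ, u ≤ v → (∀ s ∈ Ioo u v, (∀ i, e i ≠ s) ∧
      (∏ i, if e i < s then Complex.I else (1 : ℂ)).re = 0) → ∫ s in u..v, rootRe e k s = 0 := by
    intro u v huv h
    rw [intervalIntegral.integral_congr_Ioo_of_le huv (g := fun _ => 0) fun s hs => ?_]
    · simp
    · rw [rootRe_eq k (h s hs).1, (h s hs).2, zero_mul]
  have even : ∀ u v σ : ℝ, u ≤ v → (∀ s ∈ Ioo u v, (∀ i, e i ≠ s) ∧ 0 < rootPoly e s ∧
      (∏ i, if e i < s then Complex.I else (1 : ℂ)).re = σ) →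
      ∫ s in u..v, rootRe e k s = σ * rootInt e k u v := by
    intro u v σ huv h
    rw [rootInt, ← intervalIntegral.integral_const_mul]
    refine intervalIntegral.integral_congr_Ioo_of_le huv fun s hs => ?_
    rw [rootRe_eq k (h s hs).1, (h s hs).2.2, abs_of_pos (h s hs).2.1]
  have i1 : ∫ s in (e 0)..(e 1), rootRe e k s = 0 := by
    refine odd _ _ m0.le fun s hs => ⟨fun i => ?_, ?_⟩
    · have := hs.1; have := hs.2; fin_cases i <;> simp <;> grind
    · have c0 : e 0 < s := hs.1
      have c1 : ¬ e 1 < s := by linarith [hs.2]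
      have c2 : ¬ e 2 < s := by linarith [hs.2]
      have c3 : ¬ e 3 < s := by linarith [hs.2]
      have c4 : ¬ e 4 < s := by linarith [hs.2]
      simp [Fin.prod_univ_five, c0, c1, c2, c3, c4]
  have i2 : ∫ s in (e 1)..(e 2), rootRe e k s = (-1) * rootInt e k (e 1) (e 2) := by
    refine even _ _ _ m1.le fun s hs => ⟨fun i => ?_, ?_, ?_⟩
    · have := hs.1; have := hs.2; fin_cases i <;> simp <;> grind
    · rw [rootPoly, Fin.prod_univ_five]
      exact mul_pos (mul_pos (mul_pos (mul_pos_of_neg_of_neg (by linarith [hs.1])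
        (by linarith [hs.1])) (by linarith [hs.2])) (by linarith [hs.2])) (by linarith [hs.2])
    · have c0 : e 0 < s := by linarith [hs.1]
      have c1 : e 1 < s := hs.1
      have c2 : ¬ e 2 < s := by linarith [hs.2]
      have c3 : ¬ e 3 < s := by linarith [hs.2]
      have c4 : ¬ e 4 < s := by linarith [hs.2]
      simp [Fin.prod_univ_five, c0, c1, c2, c3, c4]
  have i3 : ∫ s in (e 2)..(e 3), rootRe e k s = 0 := by
    refine odd _ _ m2.le fun s hs => ⟨fun i => ?_, ?_⟩
    · have := hs.1; have := hs.2; fin_cases i <;> simp <;> grind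
    · have c0 : e 0 < s := by linarith [hs.1]
      have c1 : e 1 < s := by linarith [hs.1]
      have c2 : e 2 < s := hs.1
      have c3 : ¬ e 3 < s := by linarith [hs.2]
      have c4 : ¬ e 4 < s := by linarith [hs.2]
      simp [Fin.prod_univ_five, c0, c1, c2, c3, c4]
  have i4 : ∫ s in (e 3)..(e 4), rootRe e k s = 1 * rootInt e k (e 3) (e 4) := by
    refine even _ _ _ m3.le fun s hs => ⟨fun i => ?_, ?_, ?_⟩
    · have := hs.1; have := hs.2; fin_cases i <;> simp <;> grind
    · rw [rootPoly, Fin.prod_univ_five]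
      have h1 : 0 < (e 0 - s) * (e 1 - s) :=
        mul_pos_of_neg_of_neg (by linarith [hs.1]) (by linarith [hs.1])
      have h2 : 0 < (e 2 - s) * (e 3 - s) :=
        mul_pos_of_neg_of_neg (by linarith [hs.1]) (by linarith [hs.1])
      have h3 : 0 < e 4 - s := by linarith [hs.2]
      have := mul_pos (mul_pos h1 h2) h3
      linarith
    · have c0 : e 0 < s := by linarith [hs.1]
      have c1 : e 1 < s := by linarith [hs.1]
      have c2 : e 2 < s := by linarith [hs.1]
      have c3 : e 3 < s := hs.1
      have c4 : ¬ e 4 < s := by linarith [hs.2]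
      simp [Fin.prod_univ_five, c0, c1, c2, c3, c4]
  have h := tendsto_integral_rootRe he (k := k) (by omega)
  have h' := h.add_const (rootInt e k (e 1) (e 2) - rootInt e k (e 3) (e 4) - rootInt e k 0 (e 0))
  rw [zero_add] at h'
  refine h'.congr' ?_
  filter_upwards [eventually_ge_atTop (e 4)] with R hR
  have i5 : ∫ s in (e 4)..R, rootRe e k s = 0 := by
    refine odd _ _ hR fun s hs => ⟨fun i => ?_, ?_⟩
    · have := hs.1; have := hs.2; fin_cases i <;> simp <;> grind
    · have c0 : e 0 < s := by linarith [hs.1]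
      have c1 : e 1 < s := by linarith [hs.1]
      have c2 : e 2 < s := by linarith [hs.1]
      have c3 : e 3 < s := by linarith [hs.1]
      have c4 : e 4 < s := hs.1
      simp [Fin.prod_univ_five, c0, c1, c2, c3, c4]
  have il : ∫ s in (-R)..0, rootRe e k s = rootInt e k (-R) 0 :=
    integral_rootRe_left k (by linarith) fun i => h0.le.trans (he.monotone (Fin.zero_le i))
  rw [← intervalIntegral.integral_add_adjacent_intervals (hI (-R) 0) (hI 0 R),
    ← intervalIntegral.integral_add_adjacent_intervals (hI 0 (e 0)) (hI _ R),
    ← intervalIntegral.integral_add_adjacent_intervals (hI (e 0) (e 1)) (hI _ R),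
    ← intervalIntegral.integral_add_adjacent_intervals (hI (e 1) (e 2)) (hI _ R),
    ← intervalIntegral.integral_add_adjacent_intervals (hI (e 2) (e 3)) (hI _ R),
    ← intervalIntegral.integral_add_adjacent_intervals (hI (e 3) (e 4)) (hI _ R),
    il, i0, i1, i2, i3, i4, i5]
  ring

/-- The genus one relation, with phases `1, I, -1, -I`. It controls the difference between
denominator and numerator of the rotation number. -/
theorem tendsto_rootInt_three {e : Fin 3 → ℝ} (he : StrictMono e) (h0 : 0 < e 0) :
    Tendsto (fun R : ℝ => rootInt e 0 (-R) 0) atTop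
      (𝓝 (rootInt e 0 (e 1) (e 2) - rootInt e 0 0 (e 0))) := by
  have m0 : e 0 < e 1 := he (by decide)
  have m1 : e 1 < e 2 := he (by decide)
  have hI := intervalIntegrable_rootRe he 0
  have i0 : ∫ s in (0 : ℝ)..(e 0), rootRe e 0 s = rootInt e 0 0 (e 0) :=
    integral_rootRe_left 0 h0.le fun i => he.monotone (Fin.zero_le i)
  have odd : ∀ u v : ℝ, u ≤ v → (∀ s ∈ Ioo u v, (∀ i, e i ≠ s) ∧
      (∏ i, if e i < s then Complex.I else (1 : ℂ)).re = 0) → ∫ s in u..v, rootRe e 0 s = 0 := by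
    intro u v huv h
    rw [intervalIntegral.integral_congr_Ioo_of_le huv (g := fun _ => 0) fun s hs => ?_]
    · simp
    · rw [rootRe_eq 0 (h s hs).1, (h s hs).2, zero_mul]
  have i1 : ∫ s in (e 0)..(e 1), rootRe e 0 s = 0 := by
    refine odd _ _ m0.le fun s hs => ⟨fun i => ?_, ?_⟩
    · have := hs.1; have := hs.2; fin_cases i <;> simp <;> grind
    · have c0 : e 0 < s := hs.1
      have c1 : ¬ e 1 < s := by linarith [hs.2]
      have c2 : ¬ e 2 < s := by linarith [hs.2]
      simp [Fin.prod_univ_three, c0, c1, c2]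
  have i2 : ∫ s in (e 1)..(e 2), rootRe e 0 s = -rootInt e 0 (e 1) (e 2) := by
    rw [rootInt, ← intervalIntegral.integral_neg]
    refine intervalIntegral.integral_congr_Ioo_of_le m1.le fun s hs => ?_
    have c0 : e 0 < s := by linarith [hs.1]
    have c1 : e 1 < s := hs.1
    have c2 : ¬ e 2 < s := by linarith [hs.2]
    have hp : 0 < rootPoly e s := by
      rw [rootPoly, Fin.prod_univ_three]
      exact mul_pos (mul_pos_of_neg_of_neg (by linarith) (by linarith)) (by linarith [hs.2])
    rw [rootRe_eq 0, abs_of_pos hp]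
    · simp [Fin.prod_univ_three, c0, c1, c2]
    · intro i; have := hs.1; have := hs.2; fin_cases i <;> simp <;> grind
  have h := tendsto_integral_rootRe he (k := 0) (by omega)
  have h' := h.add_const (rootInt e 0 (e 1) (e 2) - rootInt e 0 0 (e 0))
  rw [zero_add] at h'
  refine h'.congr' ?_
  filter_upwards [eventually_ge_atTop (e 2)] with R hR
  have i3 : ∫ s in (e 2)..R, rootRe e 0 s = 0 := by
    refine odd _ _ hR fun s hs => ⟨fun i => ?_, ?_⟩
    · have := hs.1; have := hs.2; fin_cases i <;> simp <;> grind
    · have c0 : e 0 < s := by linarith [hs.1]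
      have c1 : e 1 < s := by linarith [hs.1]
      have c2 : e 2 < s := hs.1
      simp [Fin.prod_univ_three, c0, c1, c2]
  have il : ∫ s in (-R)..0, rootRe e 0 s = rootInt e 0 (-R) 0 :=
    integral_rootRe_left 0 (by linarith) fun i => h0.le.trans (he.monotone (Fin.zero_le i))
  rw [← intervalIntegral.integral_add_adjacent_intervals (hI (-R) 0) (hI 0 R),
    ← intervalIntegral.integral_add_adjacent_intervals (hI 0 (e 0)) (hI _ R),
    ← intervalIntegral.integral_add_adjacent_intervals (hI (e 0) (e 1)) (hI _ R),
    ← intervalIntegral.integral_add_adjacent_intervals (hI (e 1) (e 2)) (hI _ R),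
    il, i0, i1, i2, i3]
  ring

/-! ### Elementary estimates for the periods -/

/-- Combinations of the periods for `k = 0, 1` are integrals of a linear form over the root, so
pointwise inequalities between linear forms can be integrated. -/
theorem linear_rootInt_mono {n : ℕ} {e : Fin n → ℝ} (he : StrictMono e) {α β α' β' u v : ℝ}
    (huv : u ≤ v) (h : ∀ s ∈ Icc u v, α + β * s ≤ α' + β' * s) :
    α * rootInt e 0 u v + β * rootInt e 1 u v ≤ α' * rootInt e 0 u v + β' * rootInt e 1 u v := by
  rw [← integral_linear_rootInt he, ← integral_linear_rootInt he]
  exact intervalIntegral.integral_mono_on huv (intervalIntegrable_linear_rootInt he _ _ _ _)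
    (intervalIntegrable_linear_rootInt he _ _ _ _)
    fun s hs => div_le_div_of_nonneg_right (h s hs) (Real.sqrt_nonneg _)

theorem mul_rootInt_zero_le {n : ℕ} {e : Fin n → ℝ} (he : StrictMono e) {u v : ℝ} (huv : u ≤ v) :
    u * rootInt e 0 u v ≤ rootInt e 1 u v := by
  have := linear_rootInt_mono he (α := u) (β := 0) (α' := 0) (β' := 1) huv
    fun s hs => by linarith [hs.1]
  linarith

theorem rootInt_one_le {n : ℕ} {e : Fin n → ℝ} (he : StrictMono e) {u v : ℝ} (huv : u ≤ v) :
    rootInt e 1 u v ≤ v * rootInt e 0 u v := by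
  have := linear_rootInt_mono he (α := 0) (β := 1) (α' := v) (β' := 0) huv
    fun s hs => by linarith [hs.2]
  linarith

theorem rootInt_pos {n : ℕ} {e : Fin n → ℝ} (he : StrictMono e) (k : ℕ) {u v : ℝ} (hu : 0 ≤ u)
    (huv : u < v) (h : ∀ s ∈ Ioo u v, 0 < rootPoly e s) : 0 < rootInt e k u v :=
  intervalIntegral.intervalIntegral_pos_of_pos_on (intervalIntegrable_rootInt he k u v)
    (fun s hs => div_pos (pow_pos (hu.trans_lt hs.1) k) (Real.sqrt_pos.2 (h s hs))) huv

theorem intervalIntegrable_inv_mul_sqrt {x R : ℝ} (hx : 0 < x) (hR : 0 ≤ R) :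
    IntervalIntegrable (fun s => 1 / ((x - s) * √(x - s))) MeasureTheory.volume (-R) 0 := by
  refine ContinuousOn.intervalIntegrable ?_
  rw [uIcc_of_le (by linarith)]
  refine ContinuousOn.div (by fun_prop) (by fun_prop) fun s hs => ?_
  have : 0 < x - s := by linarith [hs.2]
  positivity

theorem integral_inv_mul_sqrt_le {x R : ℝ} (hx : 0 < x) (hR : 0 ≤ R) :
    ∫ s in (-R)..0, 1 / ((x - s) * √(x - s)) ≤ 2 / √x := by
  have h : ∀ s ∈ uIcc (-R) 0, HasDerivAt (fun s => 2 / √(x - s)) (1 / ((x - s) * √(x - s))) s := by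
    intro s hs
    rw [uIcc_of_le (by linarith)] at hs
    have h0 : 0 < x - s := by linarith [hs.2]
    have h1 : HasDerivAt (fun s => √(x - s)) (-1 / (2 * √(x - s))) s :=
      ((hasDerivAt_id s).const_sub x).sqrt h0.ne'
    have h2 := (h1.fun_inv (Real.sqrt_pos.2 h0).ne').const_mul 2
    refine (h2.congr_deriv ?_)
    have h3 : 0 < √(x - s) := Real.sqrt_pos.2 h0
    rw [Real.sq_sqrt h0.le]
    field_simp
  rw [intervalIntegral.integral_eq_sub_of_hasDerivAt h (intervalIntegrable_inv_mul_sqrt hx hR)]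
  have : 0 ≤ 2 / √(x - -R) := by positivity
  simp only [sub_zero]
  linarith

theorem intervalIntegrable_inv_sqrt_sub (x : ℝ) :
    IntervalIntegrable (fun s => 1 / √(x - s)) MeasureTheory.volume 0 x := by
  have h := (intervalIntegral.intervalIntegrable_rpow' (a := x) (b := 0) (r := -(1 / 2))
    (by norm_num)).comp_sub_left x
  simp only [sub_self, sub_zero] at h
  rcases le_total 0 x with hx | hx
  · refine h.congr_uIoo fun s hs => ?_
    rw [uIoo_of_le hx] at hs
    simp only
    rw [Real.rpow_neg (by linarith [hs.2]), ← Real.sqrt_eq_rpow, one_div]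
  -- For `x ≤ 0` the radicand is negative between `x` and `0`, and the integrand is `1 / 0 = 0`.
  · refine IntervalIntegrable.congr_uIoo (f := fun _ => 0) (by simp) fun s hs => ?_
    rw [uIoo_of_ge hx] at hs
    simp only
    rw [Real.sqrt_eq_zero_of_nonpos (by linarith [hs.1])]
    simp

theorem integral_inv_sqrt_sub {x : ℝ} (hx : 0 ≤ x) : ∫ s in (0 : ℝ)..x, 1 / √(x - s) = 2 * √x := by
  have h := intervalIntegral.integral_eq_sub_of_hasDerivAt_of_le (a := 0) (b := x)
    (f := fun s => -2 * √(x - s)) (f' := fun s => 1 / √(x - s)) hx (by fun_prop) (fun s hs => ?_)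
    (intervalIntegrable_inv_sqrt_sub x)
  · rw [h]; simp
  · have h0 : 0 < x - s := by linarith [hs.2]
    have h1 : HasDerivAt (fun s => √(x - s)) (-1 / (2 * √(x - s))) s :=
      ((hasDerivAt_id s).const_sub x).sqrt h0.ne'
    refine (h1.const_mul (-2)).congr_deriv ?_
    have h3 : 0 < √(x - s) := Real.sqrt_pos.2 h0
    field_simp

theorem integral_inv_const_sub {x y : ℝ} (hx : 0 ≤ x) (hxy : x < y) :
    ∫ s in (0 : ℝ)..x, 1 / (y - s) = Real.log (y / (y - x)) := by
  rw [intervalIntegral.integral_comp_sub_left (fun s => 1 / s), sub_zero,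
    integral_one_div_of_pos (by linarith) (by linarith)]

theorem integral_inv_sub_const {x y z : ℝ} (hx : x < y) (hxy : y ≤ z) :
    ∫ s in y..z, 1 / (s - x) = Real.log ((z - x) / (y - x)) := by
  rw [intervalIntegral.integral_comp_sub_right (fun s => 1 / s),
    integral_one_div_of_pos (by linarith) (by linarith)]

theorem intervalIntegrable_inv_const_sub {x y : ℝ} (hx : 0 ≤ x) (hxy : x < y) :
    IntervalIntegrable (fun s => 1 / (y - s)) MeasureTheory.volume 0 x := by
  refine ContinuousOn.intervalIntegrable ?_
  rw [uIcc_of_le hx]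
  exact ContinuousOn.div (by fun_prop) (by fun_prop) fun s hs => by linarith [hs.2]

theorem intervalIntegrable_inv_sub_const {x y z : ℝ} (hx : x < y) (hxy : y ≤ z) :
    IntervalIntegrable (fun s => 1 / (s - x)) MeasureTheory.volume y z := by
  refine ContinuousOn.intervalIntegrable ?_
  rw [uIcc_of_le hxy]
  exact ContinuousOn.div (by fun_prop) (by fun_prop) fun s hs => by linarith [hs.1]

theorem rootInt_zero_le_of {n : ℕ} {e : Fin n → ℝ} (he : StrictMono e) {u v : ℝ} (huv : u ≤ v)
    {g : ℝ → ℝ} (hg : IntervalIntegrable g MeasureTheory.volume u v)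
    (h : ∀ s ∈ Ioo u v, 1 / √(rootPoly e s) ≤ g s) : rootInt e 0 u v ≤ ∫ s in u..v, g s :=
  intervalIntegral.integral_mono_on_of_le_Ioo huv (intervalIntegrable_rootInt he 0 u v) hg
    fun s hs => by simpa using h s hs

theorem le_rootInt_zero_of {n : ℕ} {e : Fin n → ℝ} (he : StrictMono e) {u v : ℝ} (huv : u ≤ v)
    {g : ℝ → ℝ} (hg : IntervalIntegrable g MeasureTheory.volume u v)
    (h : ∀ s ∈ Ioo u v, g s ≤ 1 / √(rootPoly e s)) : ∫ s in u..v, g s ≤ rootInt e 0 u v :=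
  intervalIntegral.integral_mono_on_of_le_Ioo huv hg (intervalIntegrable_rootInt he 0 u v)
    fun s hs => by simpa using h s hs

theorem one_div_sqrt_le_of {x y : ℝ} (hx : 0 < x) (h : x ^ 2 ≤ y) : 1 / √y ≤ 1 / x :=
  one_div_le_one_div_of_le hx (Real.le_sqrt_of_sq_le h)

theorem le_one_div_sqrt_of {x y : ℝ} (hx : 0 ≤ x) (hy : 0 < y) (h : y ≤ x ^ 2) :
    1 / x ≤ 1 / √y :=
  one_div_le_one_div_of_le (Real.sqrt_pos.2 hy) (Real.sqrt_le_left hx |>.2 h)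

/-! ### The periods of a hyperelliptic curve of genus two -/

section Periods

/-- The period over `(0, e₀)`. -/
def perA {n : ℕ} [NeZero n] (e : Fin n → ℝ) (k : ℕ) : ℝ := rootInt e k 0 (e 0)

/-- The period over `(e₁, e₂)`. -/
def perB (e : Fin 5 → ℝ) (k : ℕ) : ℝ := rootInt e k (e 1) (e 2)

/-- The period over `(e₃, e₄)`. -/
def perC (e : Fin 5 → ℝ) (k : ℕ) : ℝ := rootInt e k (e 3) (e 4)

/-- The period over `(-∞, 0)`; see `tendsto_perM`. -/
def perM (e : Fin 5 → ℝ) (k : ℕ) : ℝ := perB e k - perC e k - perA e k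

theorem rootPoly_five (e : Fin 5 → ℝ) (s : ℝ) :
    rootPoly e s = (e 0 - s) * (e 1 - s) * (e 2 - s) * (e 3 - s) * (e 4 - s) := by
  rw [rootPoly, Fin.prod_univ_five]

theorem tendsto_perM {e : Fin 5 → ℝ} (he : StrictMono e) (h0 : 0 < e 0) (α β : ℝ) :
    Tendsto (fun R : ℝ => ∫ s in (-R)..0, (α + β * s) / √(rootPoly e s)) atTop
      (𝓝 (α * perM e 0 + β * perM e 1)) := by
  have h := ((tendsto_rootInt_five he h0 (k := 0) (by norm_num)).const_mul α).add
    ((tendsto_rootInt_five he h0 (k := 1) (by norm_num)).const_mul β)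
  refine h.congr fun R => ?_
  rw [integral_linear_rootInt he]

theorem rootPoly_pos_of_neg {n : ℕ} {e : Fin n → ℝ} (h0 : ∀ i, 0 < e i) {s : ℝ} (hs : s ≤ 0) :
    0 < rootPoly e s := rootPoly_pos_of_lt fun i => hs.trans_lt (h0 i)

theorem chain_five {e : Fin 5 → ℝ} (he : StrictMono e) :
    e 0 < e 1 ∧ e 1 < e 2 ∧ e 2 < e 3 ∧ e 3 < e 4 :=
  ⟨he (by decide), he (by decide), he (by decide), he (by decide)⟩

/-- For `s ≤ 0` all factors are at least `e 0 - s`, and `e 4 - s ≤ (e 4 / e 0) * (e 0 - s)`, so `(e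
0 - s) ^ (-3/2)` is an integrable majorant up to a constant. The bound is insensitive to collisions
of end points. -/
theorem perM_le {e : Fin 5 → ℝ} (he : StrictMono e) (h0 : 0 < e 0) {α β B : ℝ} (hB : 0 ≤ B)
    (h : ∀ s ≤ 0, α + β * s ≤ B * (e 4 - s)) :
    α * perM e 0 + β * perM e 1 ≤ B * (e 4 / e 0 * (2 / √(e 0))) := by
  obtain ⟨m0, m1, m2, m3⟩ := chain_five he
  refine le_of_tendsto (tendsto_perM he h0 α β) ?_
  filter_upwards [eventually_ge_atTop 0] with R hR
  refine le_trans ?_ (mul_le_mul_of_nonneg_left (mul_le_mul_of_nonneg_left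
    (integral_inv_mul_sqrt_le h0 hR) (div_pos (h0.trans (by linarith)) h0).le) hB)
  rw [← intervalIntegral.integral_const_mul, ← intervalIntegral.integral_const_mul]
  refine intervalIntegral.integral_mono_on (by linarith) (intervalIntegrable_linear_rootInt he _ _ _ _)
    (((intervalIntegrable_inv_mul_sqrt h0 hR).const_mul _).const_mul _) fun s hs => ?_
  have hx : 0 < e 0 - s := by linarith [hs.2]
  have hT : ((e 0 - s) * ((e 0 - s) * √(e 0 - s))) ^ 2 ≤ rootPoly e s := by
    have e1 : ((e 0 - s) * ((e 0 - s) * √(e 0 - s))) ^ 2 =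
        (e 0 - s) * (e 0 - s) * (e 0 - s) * (e 0 - s) * (e 0 - s) := by
      rw [mul_pow, mul_pow, Real.sq_sqrt hx.le]; ring
    have hx1 : 0 < e 1 - s := by linarith
    have hx2 : 0 < e 2 - s := by linarith
    have hx3 : 0 < e 3 - s := by linarith
    rw [e1, rootPoly_five]
    gcongr <;> linarith
  have hsq : 0 < √(e 0 - s) := Real.sqrt_pos.2 hx
  have h1 := one_div_sqrt_le_of (by positivity) hT
  have h2 : e 4 - s ≤ e 4 / e 0 * (e 0 - s) := by
    rw [div_mul_eq_mul_div, le_div_iff₀ h0]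
    nlinarith [hs.2]
  calc (α + β * s) / √(rootPoly e s) ≤ B * (e 4 - s) / √(rootPoly e s) := by
        gcongr; exact h s hs.2
    _ = B * ((e 4 - s) * (1 / √(rootPoly e s))) := by ring
    _ ≤ B * ((e 4 / e 0 * (e 0 - s)) * (1 / ((e 0 - s) * ((e 0 - s) * √(e 0 - s))))) := by
        gcongr
        exact mul_nonneg (div_nonneg (by linarith) h0.le) hx.le
    _ = B * (e 4 / e 0 * (1 / ((e 0 - s) * √(e 0 - s)))) := by field_simp

/-- Only the part over `(-1, 0)` is kept, where every factor is at most `e 4 + 1`. -/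
theorem le_perM {e : Fin 5 → ℝ} (he : StrictMono e) (h0 : 0 < e 0) {α β A : ℝ} (hA : 0 ≤ A)
    (h : ∀ s ≤ 0, A ≤ α + β * s) :
    A / √((e 4 + 1) ^ 5) ≤ α * perM e 0 + β * perM e 1 := by
  obtain ⟨m0, m1, m2, m3⟩ := chain_five he
  have hpos : ∀ i, 0 < e i := fun i => h0.trans_le (he.monotone (Fin.zero_le i))
  refine ge_of_tendsto (tendsto_perM he h0 α β) ?_
  filter_upwards [eventually_ge_atTop 1] with R hR
  have hI := intervalIntegrable_linear_rootInt he α β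
  rw [← intervalIntegral.integral_add_adjacent_intervals (hI (-R) (-1)) (hI (-1) 0)]
  have p1 : 0 ≤ ∫ s in (-R)..(-1), (α + β * s) / √(rootPoly e s) :=
    intervalIntegral.integral_nonneg (by linarith) fun s hs =>
      div_nonneg (hA.trans (h s (by linarith [hs.2]))) (Real.sqrt_nonneg _)
  have p2 : A / √((e 4 + 1) ^ 5) ≤ ∫ s in (-1 : ℝ)..0, (α + β * s) / √(rootPoly e s) := by
    have : A / √((e 4 + 1) ^ 5) = ∫ s in (-1 : ℝ)..0, A / √((e 4 + 1) ^ 5) := by simp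
    rw [this]
    refine intervalIntegral.integral_mono_on (by norm_num) (by simp) (hI _ _) fun s hs => ?_
    have hT : rootPoly e s ≤ (e 4 + 1) ^ 5 := by
      rw [rootPoly_five]
      have e1 : (e 4 + 1) ^ 5 = (e 4 + 1) * (e 4 + 1) * (e 4 + 1) * (e 4 + 1) * (e 4 + 1) := by ring
      rw [e1]
      have := hs.1; have := hs.2; have := hpos 4
      gcongr <;> linarith
    have := rootPoly_pos_of_neg hpos hs.2
    exact div_le_div₀ (hA.trans (h s hs.2)) (h s hs.2) (Real.sqrt_pos.2 this) (Real.sqrt_le_sqrt hT)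
  linarith

theorem perA_pos {n : ℕ} [NeZero n] {e : Fin n → ℝ} (he : StrictMono e) (h0 : 0 < e 0) (k : ℕ) :
    0 < perA e k :=
  rootInt_pos he k le_rfl h0 fun _ hs =>
    rootPoly_pos_of_lt fun i => hs.2.trans_le (he.monotone (Fin.zero_le i))

theorem perB_pos {e : Fin 5 → ℝ} (he : StrictMono e) (h0 : 0 < e 0) (k : ℕ) : 0 < perB e k := by
  obtain ⟨m0, m1, m2, m3⟩ := chain_five he
  refine rootInt_pos he k (by linarith) m1 fun s hs => ?_
  rw [rootPoly_five]
  exact mul_pos (mul_pos (mul_pos (mul_pos_of_neg_of_neg (by linarith [hs.1])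
    (by linarith [hs.1])) (by linarith [hs.2])) (by linarith [hs.2])) (by linarith [hs.2])

theorem rootPoly_five_pos {e : Fin 5 → ℝ} (he : StrictMono e) {s : ℝ} (hs : s ∈ Ioo (e 3) (e 4)) :
    0 < rootPoly e s := by
  obtain ⟨m0, m1, m2, m3⟩ := chain_five he
  have h1 : 0 < (e 0 - s) * (e 1 - s) :=
    mul_pos_of_neg_of_neg (by linarith [hs.1]) (by linarith [hs.1])
  have h2 : 0 < (e 2 - s) * (e 3 - s) :=
    mul_pos_of_neg_of_neg (by linarith [hs.1]) (by linarith [hs.1])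
  have h3 : 0 < e 4 - s := by linarith [hs.2]
  have := mul_pos (mul_pos h1 h2) h3
  rw [rootPoly_five]
  linarith

theorem perC_pos {e : Fin 5 → ℝ} (he : StrictMono e) (h0 : 0 < e 0) (k : ℕ) : 0 < perC e k := by
  obtain ⟨m0, m1, m2, m3⟩ := chain_five he
  exact rootInt_pos he k (by linarith) m3 fun s hs => rootPoly_five_pos he hs

theorem perA_one_le {e : Fin 5 → ℝ} (he : StrictMono e) (h0 : 0 < e 0) :
    perA e 1 ≤ e 0 * perA e 0 := rootInt_one_le he h0.le

theorem le_perB_one {e : Fin 5 → ℝ} (he : StrictMono e) : e 1 * perB e 0 ≤ perB e 1 :=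
  mul_rootInt_zero_le he (chain_five he).2.1.le

theorem perB_one_le {e : Fin 5 → ℝ} (he : StrictMono e) : perB e 1 ≤ e 2 * perB e 0 :=
  rootInt_one_le he (chain_five he).2.1.le

theorem le_perC_one {e : Fin 5 → ℝ} (he : StrictMono e) : e 3 * perC e 0 ≤ perC e 1 :=
  mul_rootInt_zero_le he (chain_five he).2.2.2.le

theorem perC_one_le {e : Fin 5 → ℝ} (he : StrictMono e) : perC e 1 ≤ e 4 * perC e 0 :=
  rootInt_one_le he (chain_five he).2.2.2.le

/-- Enlarging `e 0 - s` to `e 1 - s` turns the two nearest roots into `1 / (e 1 - s)`: the period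
diverges logarithmically when `e 0` and `e 1` collide. -/
theorem le_perA_zero {e : Fin 5 → ℝ} (he : StrictMono e) (h0 : 0 < e 0) :
    Real.log (e 1 / (e 1 - e 0)) / √(e 4 ^ 3) ≤ perA e 0 := by
  obtain ⟨m0, m1, m2, m3⟩ := chain_five he
  rw [← integral_inv_const_sub h0.le m0, div_eq_inv_mul, ← intervalIntegral.integral_const_mul]
  refine le_rootInt_zero_of he h0.le ((intervalIntegrable_inv_const_sub h0.le m0).const_mul _)
    fun s hs => ?_
  have h4 : 0 < e 4 := by linarith
  have hx : 0 < e 1 - s := by linarith [hs.2]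
  have e1 : (√(e 4 ^ 3))⁻¹ * (1 / (e 1 - s)) = 1 / ((e 1 - s) * √(e 4 ^ 3)) := by
    field_simp
  rw [e1]
  refine le_one_div_sqrt_of (by positivity)
    (rootPoly_pos_of_lt fun i => hs.2.trans_le (he.monotone (Fin.zero_le i))) ?_
  rw [mul_pow, Real.sq_sqrt (by positivity), rootPoly_five]
  have e2 : (e 1 - s) ^ 2 * e 4 ^ 3 = (e 1 - s) * (e 1 - s) * e 4 * e 4 * e 4 := by ring
  rw [e2]
  have := hs.1; have := hs.2
  gcongr <;> linarith

/-- The same at the other pair: enlarging `s - e 3` to `s - e 2` produces the logarithmic divergence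
when `e 2` and `e 3` collide. -/
theorem le_perC_zero {e : Fin 5 → ℝ} (he : StrictMono e) (h0 : 0 < e 0) :
    Real.log ((e 4 - e 2) / (e 3 - e 2)) / √(e 4 ^ 3) ≤ perC e 0 := by
  obtain ⟨m0, m1, m2, m3⟩ := chain_five he
  rw [← integral_inv_sub_const m2 m3.le, div_eq_inv_mul, ← intervalIntegral.integral_const_mul]
  refine le_rootInt_zero_of he m3.le ((intervalIntegrable_inv_sub_const m2 m3.le).const_mul _)
    fun s hs => ?_
  have h4 : 0 < e 4 := by linarith
  have hx : 0 < s - e 2 := by linarith [hs.1]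
  have e1 : (√(e 4 ^ 3))⁻¹ * (1 / (s - e 2)) = 1 / ((s - e 2) * √(e 4 ^ 3)) := by
    field_simp
  rw [e1]
  refine le_one_div_sqrt_of (by positivity) (rootPoly_five_pos he hs) ?_
  rw [mul_pow, Real.sq_sqrt (by positivity), rootPoly_five]
  have e2 : (s - e 2) ^ 2 * e 4 ^ 3 = (s - e 2) * (s - e 2) * e 4 * e 4 * e 4 := by ring
  have e3 : (e 0 - s) * (e 1 - s) * (e 2 - s) * (e 3 - s) * (e 4 - s) =
    (s - e 2) * (s - e 3) * (s - e 0) * (s - e 1) * (e 4 - s) := by ring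
  rw [e2, e3]
  have := hs.1; have := hs.2
  gcongr <;> linarith

theorem perA_zero_le {e : Fin 5 → ℝ} (he : StrictMono e) (h0 : 0 < e 0) :
    perA e 0 ≤ 2 * √(e 0) / (e 1 - e 0) ^ 2 := by
  obtain ⟨m0, m1, m2, m3⟩ := chain_five he
  rw [← integral_inv_sqrt_sub h0.le, div_eq_inv_mul, ← intervalIntegral.integral_const_mul]
  refine rootInt_zero_le_of he h0.le ((intervalIntegrable_inv_sqrt_sub _).const_mul _)
    fun s hs => ?_
  have hx : 0 < e 0 - s := by linarith [hs.2]
  have hy : 0 < e 1 - e 0 := by linarith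
  have hsq := Real.sqrt_pos.2 hx
  have e1 : ((e 1 - e 0) ^ 2)⁻¹ * (1 / √(e 0 - s)) = 1 / ((e 1 - e 0) ^ 2 * √(e 0 - s)) := by
    field_simp
  rw [e1]
  refine one_div_sqrt_le_of (by positivity) ?_
  rw [mul_pow, Real.sq_sqrt hx.le, rootPoly_five]
  have e2 : ((e 1 - e 0) ^ 2) ^ 2 * (e 0 - s) =
    (e 0 - s) * (e 1 - e 0) * (e 1 - e 0) * (e 1 - e 0) * (e 1 - e 0) := by ring
  have hx1 : 0 < e 1 - s := by linarith
  have hx2 : 0 < e 2 - s := by linarith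
  have hx3 : 0 < e 3 - s := by linarith
  rw [e2]
  have := hs.1; have := hs.2
  gcongr <;> linarith

end Periods

/-! ### The frequencies in terms of the periods -/

/-- The determinant of two vectors of periods. -/
def perDet (u v : ℕ → ℝ) : ℝ := u 0 * v 1 - v 0 * u 1

theorem perDet_BC (e : Fin 5 → ℝ) :
    perDet (perB e) (perC e) = perDet (perM e) (perC e) + perDet (perA e) (perC e) := by
  simp only [perDet, perM]; ring

/-- The determinant is the integral over `(-∞, 0)` of the linear form `C₁ - C₀ s`. As `C₁ ≥ e 3 *
C₀`, this form is at least `e 3 * C₀` there. The other determinant bounds with `perM` use the same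
device. -/
theorem le_perDet_MC {e : Fin 5 → ℝ} (he : StrictMono e) (h0 : 0 < e 0) :
    perC e 0 * (e 3 / √((e 4 + 1) ^ 5)) ≤ perDet (perM e) (perC e) := by
  obtain ⟨m0, m1, m2, m3⟩ := chain_five he
  have hC := perC_pos he h0 0
  have h := le_perM he h0 (α := perC e 1) (β := -perC e 0) (A := perC e 0 * e 3)
    (mul_nonneg hC.le (by linarith)) fun s hs => by nlinarith [le_perC_one he]
  calc _ = perC e 0 * e 3 / √((e 4 + 1) ^ 5) := by ring
    _ ≤ _ := h
    _ = _ := by simp only [perDet]; ring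

theorem perDet_MC_le {e : Fin 5 → ℝ} (he : StrictMono e) (h0 : 0 < e 0) :
    perDet (perM e) (perC e) ≤ perC e 0 * (e 4 / e 0 * (2 / √(e 0))) := by
  have hC := perC_pos he h0 0
  have h := perM_le he h0 (α := perC e 1) (β := -perC e 0) hC.le
    fun s hs => by nlinarith [perC_one_le he]
  calc _ = perC e 1 * perM e 0 + -perC e 0 * perM e 1 := by simp only [perDet]; ring
    _ ≤ _ := h

theorem perDet_MA_le {e : Fin 5 → ℝ} (he : StrictMono e) (h0 : 0 < e 0) :
    perDet (perM e) (perA e) ≤ perA e 0 * (e 4 / e 0 * (2 / √(e 0))) := by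
  obtain ⟨m0, m1, m2, m3⟩ := chain_five he
  have hA := perA_pos he h0 0
  have h := perM_le he h0 (α := perA e 1) (β := -perA e 0) hA.le
    fun s hs => by nlinarith [perA_one_le he h0]
  calc _ = perA e 1 * perM e 0 + -perA e 0 * perM e 1 := by simp only [perDet]; ring
    _ ≤ _ := h

theorem perDet_MA_pos {e : Fin 5 → ℝ} (he : StrictMono e) (h0 : 0 < e 0) :
    0 < perDet (perM e) (perA e) := by
  obtain ⟨m0, m1, m2, m3⟩ := chain_five he
  have hA := perA_pos he h0 0
  have hA1 := perA_pos he h0 1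
  have h := le_perM he h0 (α := perA e 1) (β := -perA e 0) hA1.le
    fun s hs => by nlinarith
  have h4 : 0 < e 4 := by linarith
  calc 0 < perA e 1 / √((e 4 + 1) ^ 5) := by positivity
    _ ≤ _ := h
    _ = _ := by simp only [perDet]; ring

theorem le_perDet_AC {e : Fin 5 → ℝ} (he : StrictMono e) (h0 : 0 < e 0) :
    perC e 0 * ((e 3 - e 0) * perA e 0) ≤ perDet (perA e) (perC e) := by
  have hC := perC_pos he h0 0
  have hA := perA_pos he h0 0
  simp only [perDet]
  nlinarith [mul_le_mul_of_nonneg_left (perA_one_le he h0) hC.le,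
    mul_le_mul_of_nonneg_left (le_perC_one he) hA.le]

theorem perDet_AC_le {e : Fin 5 → ℝ} (he : StrictMono e) (h0 : 0 < e 0) :
    perDet (perA e) (perC e) ≤ perC e 0 * (e 4 * perA e 0) := by
  have hC := perC_pos he h0 0
  have hA := perA_pos he h0 0
  have hA1 := perA_pos he h0 1
  simp only [perDet]
  nlinarith [mul_le_mul_of_nonneg_left (perC_one_le he) hA.le, mul_pos hC hA1]

/-- The frequencies as functions of the five end points. -/
def freqOf (e : Fin 5 → ℝ) : ℝ × ℝ :=
  (perDet (perA e) (perC e) / (2 * perDet (perB e) (perC e)),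
    perDet (perA e) (perB e) / (2 * perDet (perB e) (perC e)))

theorem perDet_MC_pos {e : Fin 5 → ℝ} (he : StrictMono e) (h0 : 0 < e 0) :
    0 < perDet (perM e) (perC e) := by
  obtain ⟨m0, m1, m2, m3⟩ := chain_five he
  have h3 : 0 < e 3 := by linarith
  have h4 : 0 < e 4 := by linarith
  have := perC_pos he h0 0
  exact lt_of_lt_of_le (by positivity) (le_perDet_MC he h0)

theorem perDet_AC_pos {e : Fin 5 → ℝ} (he : StrictMono e) (h0 : 0 < e 0) :
    0 < perDet (perA e) (perC e) := by
  obtain ⟨m0, m1, m2, m3⟩ := chain_five he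
  have h3 : 0 < e 3 - e 0 := by linarith
  have := perC_pos he h0 0
  have := perA_pos he h0 0
  exact lt_of_lt_of_le (by positivity) (le_perDet_AC he h0)

theorem perDet_BC_pos {e : Fin 5 → ℝ} (he : StrictMono e) (h0 : 0 < e 0) :
    0 < perDet (perB e) (perC e) := by
  rw [perDet_BC]; exact add_pos (perDet_MC_pos he h0) (perDet_AC_pos he h0)

theorem one_sub_freqOf_fst {e : Fin 5 → ℝ} (he : StrictMono e) (h0 : 0 < e 0) :
    1 / 2 - (freqOf e).1 =
      perDet (perM e) (perC e) / (2 * perDet (perB e) (perC e)) := by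
  have h := perDet_BC_pos he h0
  simp only [freqOf]
  field_simp
  rw [perDet_BC]; ring

theorem freqOf_fst_sub_snd {e : Fin 5 → ℝ} :
    (freqOf e).1 - (freqOf e).2 =
      perDet (perM e) (perA e) / (2 * perDet (perB e) (perC e)) := by
  simp only [freqOf]
  rw [← sub_div]
  congr 1
  simp only [perDet, perM]
  ring

theorem perDet_AB_pos {e : Fin 5 → ℝ} (he : StrictMono e) (h0 : 0 < e 0) :
    0 < perDet (perA e) (perB e) := by
  obtain ⟨m0, m1, m2, m3⟩ := chain_five he
  have hB := perB_pos he h0 0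
  have hA := perA_pos he h0 0
  simp only [perDet]
  nlinarith [mul_le_mul_of_nonneg_left (perA_one_le he h0) hB.le,
    mul_le_mul_of_nonneg_left (le_perB_one he) hA.le, mul_pos (mul_pos hA hB) (sub_pos.2 m0)]

theorem freqOf_mem_freqSpace {e : Fin 5 → ℝ} (he : StrictMono e) (h0 : 0 < e 0) :
    freqOf e ∈ freqSpace := by
  have h := perDet_BC_pos he h0
  refine ⟨div_pos (perDet_AB_pos he h0) (by positivity), ?_, ?_⟩
  · rw [← sub_pos, freqOf_fst_sub_snd]
    exact div_pos (perDet_MA_pos he h0) (by positivity)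
  · rw [← sub_pos, one_sub_freqOf_fst he h0]
    exact div_pos (perDet_MC_pos he h0) (by positivity)

/-- Numerator and denominator are both bounded by multiples of `perC e 0`, which cancels. The bound
therefore remains useful when `perC` diverges together with `perA`, as at a corner of the parameter
domain. -/
theorem one_sub_freqOf_fst_le {e : Fin 5 → ℝ} (he : StrictMono e) (h0 : 0 < e 0) :
    1 / 2 - (freqOf e).1 ≤ (e 4 / e 0 * (2 / √(e 0))) / (2 * (e 3 - e 0) * perA e 0) := by
  obtain ⟨m0, m1, m2, m3⟩ := chain_five he
  have hC := perC_pos he h0 0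
  have hA := perA_pos he h0 0
  have h30 : 0 < e 3 - e 0 := by linarith
  rw [one_sub_freqOf_fst he h0]
  calc _ ≤ perC e 0 * (e 4 / e 0 * (2 / √(e 0))) / (2 * (perC e 0 * ((e 3 - e 0) * perA e 0))) := by
        refine div_le_div₀ ?_ (perDet_MC_le he h0) (by positivity) ?_
        · exact (perDet_MC_pos he h0).le.trans (perDet_MC_le he h0)
        · have := le_perDet_AC he h0
          have := perDet_MC_pos he h0
          have := perDet_BC e
          linarith
    _ = perC e 0 * (e 4 / e 0 * (2 / √(e 0))) / (perC e 0 * (2 * (e 3 - e 0) * perA e 0)) := by ring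
    _ = _ := mul_div_mul_left _ _ hC.ne'

/-- Here the common factor is `perA e 0`, so a simultaneous divergence of `perA` does no harm. -/
theorem freqOf_fst_sub_snd_le {e : Fin 5 → ℝ} (he : StrictMono e) (h0 : 0 < e 0) :
    (freqOf e).1 - (freqOf e).2 ≤
      (e 4 / e 0 * (2 / √(e 0))) / (2 * (e 3 - e 0) * perC e 0) := by
  obtain ⟨m0, m1, m2, m3⟩ := chain_five he
  have hC := perC_pos he h0 0
  have hA := perA_pos he h0 0
  have h30 : 0 < e 3 - e 0 := by linarith
  rw [freqOf_fst_sub_snd]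
  calc _ ≤ perA e 0 * (e 4 / e 0 * (2 / √(e 0))) / (2 * (perC e 0 * ((e 3 - e 0) * perA e 0))) := by
        refine div_le_div₀ ?_ (perDet_MA_le he h0) (by positivity) ?_
        · exact (perDet_MA_pos he h0).le.trans (perDet_MA_le he h0)
        · have := le_perDet_AC he h0
          have := perDet_MC_pos he h0
          have := perDet_BC e
          linarith
    _ = perA e 0 * (e 4 / e 0 * (2 / √(e 0))) / (perA e 0 * (2 * (e 3 - e 0) * perC e 0)) := by ring
    _ = _ := mul_div_mul_left _ _ hA.ne'

theorem freqOf_fst_le {e : Fin 5 → ℝ} (he : StrictMono e) (h0 : 0 < e 0) :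
    (freqOf e).1 ≤ e 4 * perA e 0 / (2 * (e 3 / √((e 4 + 1) ^ 5))) := by
  obtain ⟨m0, m1, m2, m3⟩ := chain_five he
  have hC := perC_pos he h0 0
  have hA := perA_pos he h0 0
  have h3 : 0 < e 3 := by linarith
  have h4 : 0 < e 4 := by linarith
  calc _ ≤ perC e 0 * (e 4 * perA e 0) / (2 * (perC e 0 * (e 3 / √((e 4 + 1) ^ 5)))) := by
        refine div_le_div₀ (by positivity) (perDet_AC_le he h0) (by positivity) ?_
        have := le_perDet_MC he h0
        have := perDet_AC_pos he h0
        have := perDet_BC e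
        linarith
    _ = perC e 0 * (e 4 * perA e 0) / (perC e 0 * (2 * (e 3 / √((e 4 + 1) ^ 5)))) := by ring
    _ = _ := mul_div_mul_left _ _ hC.ne'

section RotationNumber

/-! ### The rotation number -/

theorem rootPoly_three (x y z s : ℝ) : rootPoly ![x, y, z] s = (x - s) * (y - s) * (z - s) := by
  rw [rootPoly, Fin.prod_univ_three]; rfl

theorem strictMono_three {x y z : ℝ} (hxy : x < y) (hyz : y < z) : StrictMono ![x, y, z] := by
  rw [Fin.strictMono_iff_lt_succ]
  intro i
  fin_cases i
  · exact hxy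
  · exact hyz

/-- The numerator `∫_0^x 1/√((x - s)(y - s)(z - s))` of the rotation number. -/
def rotNum (x y z : ℝ) : ℝ := rootInt ![x, y, z] 0 0 x

/-- Half the denominator `∫_y^z 1/√((x - s)(y - s)(z - s))` of the rotation number. -/
def rotDen (x y z : ℝ) : ℝ := rootInt ![x, y, z] 0 y z

theorem rotationNumber_eq {x y z : ℝ} (hxy : x < y) :
    rotationNumber x y z = rotNum x y z / (2 * rotDen x y z) := by
  rw [rotationNumber, min_eq_right hxy.le, max_eq_left hxy.le, rotNum, rotDen, rootInt, rootInt]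
  simp only [rootPoly_three, pow_zero]

variable {x y z : ℝ}

theorem rotNum_pos (hx : 0 < x) (hxy : x < y) (hyz : y < z) : 0 < rotNum x y z := by
  refine rootInt_pos (strictMono_three hxy hyz) 0 le_rfl hx fun s hs => ?_
  rw [rootPoly_three]
  exact mul_pos (mul_pos (by linarith [hs.2]) (by linarith [hs.2])) (by linarith [hs.2])

theorem rootPoly_three_pos (hxy : x < y) {s : ℝ} (hs : s ∈ Ioo y z) :
    0 < rootPoly ![x, y, z] s := by
  rw [rootPoly_three]
  exact mul_pos (mul_pos_of_neg_of_neg (by linarith [hs.1]) (by linarith [hs.1]))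
    (by linarith [hs.2])

theorem rotDen_pos (hx : 0 < x) (hxy : x < y) (hyz : y < z) : 0 < rotDen x y z :=
  rootInt_pos (strictMono_three hxy hyz) 0 (by linarith) hyz fun _ hs => rootPoly_three_pos hxy hs

theorem tendsto_rotDen_sub_rotNum (hx : 0 < x) (hxy : x < y) (hyz : y < z) :
    Tendsto (fun R : ℝ => rootInt ![x, y, z] 0 (-R) 0) atTop
      (𝓝 (rotDen x y z - rotNum x y z)) :=
  tendsto_rootInt_three (strictMono_three hxy hyz) hx

theorem rotDen_sub_rotNum_le (hx : 0 < x) (hxy : x < y) (hyz : y < z) :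
    rotDen x y z - rotNum x y z ≤ 2 / √x := by
  refine le_of_tendsto (tendsto_rotDen_sub_rotNum hx hxy hyz) ?_
  filter_upwards [eventually_ge_atTop 0] with R hR
  refine (rootInt_zero_le_of (strictMono_three hxy hyz) (by linarith)
    (intervalIntegrable_inv_mul_sqrt hx hR) fun s hs => ?_).trans (integral_inv_mul_sqrt_le hx hR)
  have h0 : 0 < x - s := by linarith [hs.2]
  have h1 : 0 < y - s := by linarith
  refine one_div_sqrt_le_of (mul_pos h0 (Real.sqrt_pos.2 h0)) ?_
  rw [mul_pow, Real.sq_sqrt h0.le, rootPoly_three]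
  have : (x - s) ^ 2 * (x - s) = (x - s) * (x - s) * (x - s) := by ring
  rw [this]
  gcongr
  exact (hxy.trans hyz).le

theorem le_rotDen_sub_rotNum (hx : 0 < x) (hxy : x < y) (hyz : y < z) :
    1 / √((z + 1) ^ 3) ≤ rotDen x y z - rotNum x y z := by
  have he := strictMono_three hxy hyz
  refine ge_of_tendsto (tendsto_rotDen_sub_rotNum hx hxy hyz) ?_
  filter_upwards [eventually_ge_atTop 1] with R hR
  have hI := intervalIntegrable_rootInt he 0
  rw [rootInt, ← intervalIntegral.integral_add_adjacent_intervals (hI (-R) (-1)) (hI (-1) 0)]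
  have p1 : 0 ≤ ∫ s in (-R)..(-1), s ^ 0 / √(rootPoly ![x, y, z] s) :=
    intervalIntegral.integral_nonneg (by linarith) fun s _ => by positivity
  have p2 : ∫ _ in (-1 : ℝ)..0, 1 / √((z + 1) ^ 3) ≤ rootInt ![x, y, z] 0 (-1) 0 := by
    refine le_rootInt_zero_of he (by norm_num) (by simp) fun s hs => ?_
    have h0 : 0 < x - s := by linarith [hs.2]
    have h1 : 0 < y - s := by linarith
    have h2 : 0 < z - s := by linarith
    rw [rootPoly_three]
    refine one_div_le_one_div_of_le (by positivity) (Real.sqrt_le_sqrt ?_)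
    have : (z + 1) ^ 3 = (z + 1) * (z + 1) * (z + 1) := by ring
    rw [this]
    have := hs.1
    have : 0 < z + 1 := by linarith
    gcongr <;> linarith
  simp only [intervalIntegral.integral_const, sub_neg_eq_add, zero_add, one_smul] at p2
  rw [rootInt] at p2
  linarith

theorem rotNum_lt_rotDen (hx : 0 < x) (hxy : x < y) (hyz : y < z) : rotNum x y z < rotDen x y z := by
  have := le_rotDen_sub_rotNum hx hxy hyz
  have hz : 0 < z + 1 := by linarith
  have : 0 < 1 / √((z + 1) ^ 3) := by positivity
  linarith

theorem rotationNumber_pos (hx : 0 < x) (hxy : x < y) (hyz : y < z) : 0 < rotationNumber x y z := by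
  rw [rotationNumber_eq hxy]
  have := rotNum_pos hx hxy hyz
  have := rotDen_pos hx hxy hyz
  positivity

theorem rotationNumber_lt_half (hx : 0 < x) (hxy : x < y) (hyz : y < z) :
    rotationNumber x y z < 1 / 2 := by
  rw [rotationNumber_eq hxy]
  have := rotDen_pos hx hxy hyz
  rw [div_lt_div_iff₀ (by positivity) (by norm_num)]
  linarith [rotNum_lt_rotDen hx hxy hyz]

theorem le_rotNum (hx : 0 < x) (hxy : x < y) (hyz : y < z) :
    Real.log (y / (y - x)) / √z ≤ rotNum x y z := by
  rw [← integral_inv_const_sub hx.le hxy, div_eq_inv_mul, ← intervalIntegral.integral_const_mul]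
  refine le_rootInt_zero_of (strictMono_three hxy hyz) hx.le
    ((intervalIntegrable_inv_const_sub hx.le hxy).const_mul _) fun s hs => ?_
  have h0 : 0 < x - s := by linarith [hs.2]
  have h1 : 0 < y - s := by linarith
  have h2 : 0 < z - s := by linarith
  have hz : 0 < z := by linarith
  have e1 : (√z)⁻¹ * (1 / (y - s)) = 1 / ((y - s) * √z) := by field_simp
  rw [e1, rootPoly_three]
  refine le_one_div_sqrt_of (by positivity) (by positivity) ?_
  rw [mul_pow, Real.sq_sqrt hz.le]
  have e2 : (y - s) ^ 2 * z = (y - s) * (y - s) * z := by ring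
  rw [e2]
  have := hs.1
  gcongr
  linarith

theorem rotNum_le (hx : 0 < x) (hxy : x < y) (hyz : y < z) :
    rotNum x y z ≤ 2 * √x / (y - x) := by
  rw [← integral_inv_sqrt_sub hx.le, div_eq_inv_mul, ← intervalIntegral.integral_const_mul]
  refine rootInt_zero_le_of (strictMono_three hxy hyz) hx.le
    ((intervalIntegrable_inv_sqrt_sub _).const_mul _) fun s hs => ?_
  have h0 : 0 < x - s := by linarith [hs.2]
  have h1 : 0 < y - s := by linarith
  have h2 : 0 < y - x := by linarith
  have hsq := Real.sqrt_pos.2 h0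
  have e1 : (y - x)⁻¹ * (1 / √(x - s)) = 1 / ((y - x) * √(x - s)) := by field_simp
  rw [e1, rootPoly_three]
  refine one_div_sqrt_le_of (by positivity) ?_
  rw [mul_pow, Real.sq_sqrt h0.le]
  have e2 : (y - x) ^ 2 * (x - s) = (x - s) * (y - x) * (y - x) := by ring
  rw [e2]
  have := hs.1; have := hs.2
  gcongr

/-- The substitution `u = x - s` pins the moving singularity at `0`. Afterwards both the integrand
and the interval `(0, x)` grow with `x`. -/
theorem rotNum_mono {x' : ℝ} (hx : 0 < x) (hxx : x < x') (hxy : x' < y) (hyz : y < z) :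
    rotNum x y z ≤ rotNum x' y z := by
  have key : ∀ x, rotNum x y z = ∫ u in (0 : ℝ)..x, 1 / √(u * (y - x + u) * (z - x + u)) := by
    intro x
    rw [rotNum, rootInt]
    have := intervalIntegral.integral_comp_sub_left (a := 0) (b := x)
      (fun u => 1 / √(u * (y - x + u) * (z - x + u))) x
    simp only [sub_self, sub_zero] at this
    rw [← this]
    congr 1; ext s
    rw [rootPoly_three, pow_zero]
    congr 3 <;> ring
  have hi : ∀ x, x < y → IntervalIntegrable (fun u => 1 / √(u * (y - x + u) * (z - x + u)))
      MeasureTheory.volume 0 x := by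
    intro x hxy
    have h := ((intervalIntegrable_rootInt (strictMono_three hxy hyz) 0 0 x)).comp_sub_left x
    simp only [sub_self, sub_zero] at h
    refine h.symm.congr fun u _ => ?_
    simp only [rootPoly_three, pow_zero]
    congr 3 <;> ring
  rw [key, key]
  have hi' := hi x' hxy
  have sub1 : IntervalIntegrable (fun u => 1 / √(u * (y - x' + u) * (z - x' + u)))
      MeasureTheory.volume 0 x :=
    hi'.mono_set (by rw [uIcc_of_le hx.le, uIcc_of_le (by linarith)]; exact Icc_subset_Icc_right hxx.le)
  have sub2 : IntervalIntegrable (fun u => 1 / √(u * (y - x' + u) * (z - x' + u)))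
      MeasureTheory.volume x x' :=
    hi'.mono_set (by rw [uIcc_of_le hxx.le, uIcc_of_le (by linarith)]; exact Icc_subset_Icc_left hx.le)
  rw [← intervalIntegral.integral_add_adjacent_intervals sub1 sub2]
  have p2 : 0 ≤ ∫ u in x..x', 1 / √(u * (y - x' + u) * (z - x' + u)) :=
    intervalIntegral.integral_nonneg hxx.le fun s _ => by positivity
  have p1 : ∫ u in (0 : ℝ)..x, 1 / √(u * (y - x + u) * (z - x + u)) ≤
      ∫ u in (0 : ℝ)..x, 1 / √(u * (y - x' + u) * (z - x' + u)) := by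
    refine intervalIntegral.integral_mono_on_of_le_Ioo hx.le (hi x (by linarith)) sub1
      fun u hu => ?_
    have h0 : 0 < u := hu.1
    have h1 : 0 < y - x' + u := by linarith
    have h2 : 0 < z - x' + u := by linarith
    have h3 : 0 < y - x + u := by linarith
    refine one_div_le_one_div_of_le (by positivity) (Real.sqrt_le_sqrt ?_)
    gcongr
  linarith

/-- The difference is the integral over `(-∞, 0)`, whose integrand decreases in `x`. -/
theorem rotDen_sub_rotNum_anti {x' : ℝ} (hx : 0 < x) (hxx : x < x') (hxy : x' < y) (hyz : y < z) :
    rotDen x' y z - rotNum x' y z ≤ rotDen x y z - rotNum x y z := by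
  refine le_of_tendsto_of_tendsto (tendsto_rotDen_sub_rotNum (hx.trans hxx) hxy hyz)
    (tendsto_rotDen_sub_rotNum hx (hxx.trans hxy) hyz) ?_
  filter_upwards [eventually_ge_atTop 0] with R hR
  refine rootInt_zero_le_of (strictMono_three hxy hyz) (by linarith)
    (intervalIntegrable_rootInt (strictMono_three (hxx.trans hxy) hyz) 0 _ _) fun s hs => ?_
  have h0 : 0 < x - s := by linarith [hs.2]
  have h1 : 0 < y - s := by linarith
  have h2 : 0 < z - s := by linarith
  rw [rootPoly_three, rootPoly_three, pow_zero]
  refine one_div_le_one_div_of_le (by positivity) (Real.sqrt_le_sqrt ?_)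
  gcongr

/-- The rotation number is monotone in the caustic parameter. -/
theorem rotationNumber_mono {x' : ℝ} (hx : 0 < x) (hxx : x < x') (hxy : x' < y) (hyz : y < z) :
    rotationNumber x y z ≤ rotationNumber x' y z := by
  have h1 := rotNum_mono hx hxx hxy hyz
  have h2 := rotDen_sub_rotNum_anti hx hxx hxy hyz
  have n1 := rotNum_pos hx (hxx.trans hxy) hyz
  have n2 := rotNum_pos (hx.trans hxx) hxy hyz
  have d1 := rotNum_lt_rotDen hx (hxx.trans hxy) hyz
  have d2 := rotNum_lt_rotDen (hx.trans hxx) hxy hyz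
  rw [rotationNumber_eq (hxx.trans hxy), rotationNumber_eq hxy,
    div_le_div_iff₀ (by linarith) (by linarith)]
  -- With `D = N + (D - N)`, the cross-multiplied inequality reduces to `N (D' - N') ≤ N' (D - N)`.
  have d3 := mul_le_mul h1 h2 (by linarith) (by linarith)
  nlinarith

theorem tendsto_rotationNumber_zero (hy : 0 < y) (hyz : y < z) :
    Tendsto (fun x => rotationNumber x y z) (𝓝[>] 0) (𝓝 0) := by
  have hz : 0 < z + 1 := by linarith
  have hlim : Tendsto (fun x : ℝ => 2 * √x / (y - x) / (2 * (1 / √((z + 1) ^ 3)))) (𝓝[>] 0) (𝓝 0) := by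
    have : ContinuousAt (fun x : ℝ => 2 * √x / (y - x) / (2 * (1 / √((z + 1) ^ 3)))) 0 := by
      refine ContinuousAt.div_const (ContinuousAt.div (by fun_prop) (by fun_prop) ?_) _
      simpa using hy.ne'
    have h := this.tendsto
    simp only [Real.sqrt_zero, mul_zero, zero_div] at h
    exact h.mono_left nhdsWithin_le_nhds
  refine tendsto_of_tendsto_of_tendsto_of_le_of_le' tendsto_const_nhds hlim ?_ ?_
  · filter_upwards [Ioo_mem_nhdsGT hy] with x hx
    exact (rotationNumber_pos hx.1 hx.2 hyz).le
  · filter_upwards [Ioo_mem_nhdsGT hy] with x hx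
    rw [rotationNumber_eq hx.2]
    have h1 := le_rotDen_sub_rotNum hx.1 hx.2 hyz
    have h2 := rotNum_pos hx.1 hx.2 hyz
    refine div_le_div₀ (h2.le.trans (rotNum_le hx.1 hx.2 hyz)) (rotNum_le hx.1 hx.2 hyz)
      (by positivity) (by linarith)

theorem tendsto_log_div_sub_atTop {ι : Type*} {l : Filter ι} {f g : ι → ℝ} {A : ℝ} (hA : 0 < A)
    (hf : Tendsto f l (𝓝 A)) (hg : Tendsto g l (𝓝 0)) (hpos : ∀ᶠ i in l, 0 < g i) :
    Tendsto (fun i => Real.log (f i / g i)) l atTop := by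
  refine Real.tendsto_log_atTop.comp ?_
  have : Tendsto g l (𝓝[>] 0) := tendsto_nhdsWithin_iff.2 ⟨hg, hpos⟩
  have h := hf.pos_mul_atTop hA this.inv_tendsto_nhdsGT_zero
  exact h

/-- `1/2 - ρ = (D - N) / (2 D)`, where `D - N ≤ 2 / √x` stays bounded while `D > N` grows at least
logarithmically as `x → y`. -/
theorem tendsto_rotationNumber_half (hy : 0 < y) (hyz : y < z) :
    Tendsto (fun x => rotationNumber x y z) (𝓝[<] y) (𝓝 (1 / 2)) := by
  have hz : 0 < z := by linarith
  have hlog : Tendsto (fun x => Real.log (y / (y - x)) / √z) (𝓝[<] y) atTop := by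
    refine Tendsto.atTop_div_const (Real.sqrt_pos.2 hz) ?_
    refine tendsto_log_div_sub_atTop hy tendsto_const_nhds ?_ ?_
    · have : Tendsto (fun x => y - x) (𝓝 y) (𝓝 (y - y)) := by
        exact (continuous_const.sub continuous_id).tendsto y
      rw [sub_self] at this
      exact this.mono_left nhdsWithin_le_nhds
    · filter_upwards [self_mem_nhdsWithin] with x hx
      exact sub_pos.2 hx
  have hM : Tendsto (fun x => 2 / √x) (𝓝[<] y) (𝓝 (2 / √y)) := by
    have : ContinuousAt (fun x => 2 / √x) y :=
      ContinuousAt.div (by fun_prop) (by fun_prop) (Real.sqrt_pos.2 hy).ne'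
    exact this.tendsto.mono_left nhdsWithin_le_nhds
  have hlow : Tendsto (fun x => 1 / 2 - (2 / √x) / (2 * (Real.log (y / (y - x)) / √z))) (𝓝[<] y)
      (𝓝 (1 / 2)) := by
    have := (hM.div_atTop (hlog.const_mul_atTop (by norm_num : (0 : ℝ) < 2))).const_sub (1 / 2)
    simpa using this
  refine tendsto_of_tendsto_of_tendsto_of_le_of_le' hlow tendsto_const_nhds ?_ ?_
  · filter_upwards [Ioo_mem_nhdsLT hy, hlog.eventually_gt_atTop 0] with x hx hL
    have h1 := rotDen_sub_rotNum_le hx.1 hx.2 hyz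
    have h2 := le_rotNum hx.1 hx.2 hyz
    have h3 := rotNum_lt_rotDen hx.1 hx.2 hyz
    have hx0 := hx.1
    rw [rotationNumber_eq hx.2]
    have hD := rotDen_pos hx.1 hx.2 hyz
    have e1 : rotNum x y z / (2 * rotDen x y z) =
        1 / 2 - (rotDen x y z - rotNum x y z) / (2 * rotDen x y z) := by field_simp; ring
    rw [e1]
    refine sub_le_sub_left (div_le_div₀ (by positivity) h1 (by positivity) (by linarith)) _
  · filter_upwards [Ioo_mem_nhdsLT hy] with x hx
    exact (rotationNumber_lt_half hx.1 hx.2 hyz).le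

/-! ### Comparison of the second frequency with a rotation number -/

theorem div_sqrt_mul_le {x t q r : ℝ} (ht : 0 < t) (hq : 0 < q) (h : x ≤ r * √q) :
    x / √(t * q) ≤ r / √t := by
  have h1 := Real.sqrt_pos.2 ht
  have h2 := Real.sqrt_pos.2 hq
  rw [Real.sqrt_mul ht.le, div_le_div_iff₀ (by positivity) h1]
  nlinarith

theorem le_div_sqrt_mul {x t q r : ℝ} (ht : 0 < t) (hq : 0 < q) (h : r * √q ≤ x) :
    r / √t ≤ x / √(t * q) := by
  have h1 := Real.sqrt_pos.2 ht
  have h2 := Real.sqrt_pos.2 hq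
  rw [Real.sqrt_mul ht.le, div_le_div_iff₀ h1 (by positivity)]
  nlinarith

/-- If `0 < p ≤ q ≤ κ² p`, then `q ≤ κ √(p q)` and `√(p q) / κ ≤ p`. -/
theorem le_mul_sqrt_mul {p q κ : ℝ} (hp : 0 < p) (hpq : p ≤ q) (hκ : 0 < κ) (h : q ≤ κ ^ 2 * p) :
    q ≤ κ * √(p * q) ∧ κ⁻¹ * √(p * q) ≤ p := by
  have hq : 0 < q := hp.trans_le hpq
  constructor
  · rw [← div_le_iff₀' hκ]
    refine Real.le_sqrt_of_sq_le ?_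
    rw [div_pow, div_le_iff₀ (by positivity)]
    nlinarith
  · rw [inv_mul_le_iff₀ hκ]
    refine Real.sqrt_le_iff.2 ⟨by positivity, ?_⟩
    nlinarith

/-- The distortion factor in the comparison of `ω₂` with a rotation number. -/
def distortion (e : Fin 5 → ℝ) : ℝ := √((e 2 - e 0) / (e 1 - e 0)) * √((e 3 - e 1) / (e 3 - e 2))

theorem rootPoly_five_eq (e : Fin 5 → ℝ) (s : ℝ) :
    rootPoly e s = rootPoly ![e 0, e 3, e 4] s * ((e 1 - s) * (e 2 - s)) := by
  rw [rootPoly_five, rootPoly_three]; ring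

/-- Both determinants in `ω₂` are integrals of `± B₀ (B₁/B₀ - s) / √T`, with `B₁/B₀` in `[e 1, e
2]`. Off that interval, `|B₁/B₀ - s|` is comparable to `√((e 1 - s) * (e 2 - s))`, which cancels the
two middle factors of `T` and leaves the genus one integrals. The factor `B₀` drops out of the
quotient, and the comparison constants tend to `1` when `e 1` and `e 2` merge away from `e 0` and `e
3`. -/
theorem freqOf_snd_bounds {e : Fin 5 → ℝ} (he : StrictMono e) (h0 : 0 < e 0) :
    (distortion e)⁻¹ * rotationNumber (e 0) (e 3) (e 4) ≤ (freqOf e).2 ∧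
      (freqOf e).2 ≤ distortion e * rotationNumber (e 0) (e 3) (e 4) := by
  obtain ⟨m0, m1, m2, m3⟩ := chain_five he
  have m03 : e 0 < e 3 := by linarith
  have he3 := strictMono_three m03 m3
  have hB := perB_pos he h0 0
  have hN := rotNum_pos h0 m03 m3
  have hD := rotDen_pos h0 m03 m3
  have hdet := perDet_BC_pos he h0
  have hB1 := le_perB_one he
  have hB2 := perB_one_le he
  set κ := √((e 2 - e 0) / (e 1 - e 0)) with hκ
  set μ := √((e 3 - e 1) / (e 3 - e 2)) with hμ
  have hκ0 : 0 < κ := Real.sqrt_pos.2 (div_pos (by linarith) (by linarith))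
  have hμ0 : 0 < μ := Real.sqrt_pos.2 (div_pos (by linarith) (by linarith))
  have hκ2 : κ ^ 2 = (e 2 - e 0) / (e 1 - e 0) :=
    Real.sq_sqrt (div_pos (by linarith) (by linarith)).le
  have hμ2 : μ ^ 2 = (e 3 - e 1) / (e 3 - e 2) :=
    Real.sq_sqrt (div_pos (by linarith) (by linarith)).le
  have detA : ∫ s in (0 : ℝ)..(e 0), (perB e 1 + -perB e 0 * s) / √(rootPoly e s) =
      perDet (perA e) (perB e) := by
    rw [integral_linear_rootInt he]; simp only [perDet, perA]; ring
  have detC : ∫ s in (e 3)..(e 4), (-perB e 1 + perB e 0 * s) / √(rootPoly e s) =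
      perDet (perB e) (perC e) := by
    rw [integral_linear_rootInt he]; simp only [perDet, perC]; ring
  have intN : ∀ r : ℝ, ∫ s in (0 : ℝ)..(e 0), r / √(rootPoly ![e 0, e 3, e 4] s) =
      r * rotNum (e 0) (e 3) (e 4) := by
    intro r
    rw [rotNum, rootInt, ← intervalIntegral.integral_const_mul]
    congr 1; ext s; ring
  have intD : ∀ r : ℝ, ∫ s in (e 3)..(e 4), r / √(rootPoly ![e 0, e 3, e 4] s) =
      r * rotDen (e 0) (e 3) (e 4) := by
    intro r
    rw [rotDen, rootInt, ← intervalIntegral.integral_const_mul]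
    congr 1; ext s; ring
  have hi3 : ∀ r u v : ℝ, IntervalIntegrable (fun s => r / √(rootPoly ![e 0, e 3, e 4] s))
      MeasureTheory.volume u v := by
    intro r u v
    refine ((intervalIntegrable_rootInt he3 0 u v).const_mul r).congr fun s _ => ?_
    ring
  have hi5 := intervalIntegrable_linear_rootInt he
  -- `κ²` is the value at `s = e 0` of `(e 2 - s) / (e 1 - s)`, which increases on `(0, e 0)`.
  have ptA : ∀ s ∈ Ioo 0 (e 0), e 2 - s ≤ κ * √((e 1 - s) * (e 2 - s)) ∧
      κ⁻¹ * √((e 1 - s) * (e 2 - s)) ≤ e 1 - s := by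
    intro s hs
    refine le_mul_sqrt_mul (by linarith [hs.2]) (by linarith) hκ0 ?_
    rw [hκ2, div_mul_eq_mul_div, le_div_iff₀ (by linarith)]
    nlinarith [hs.2]
  -- `μ²` is the value at `s = e 3` of `(s - e 1) / (s - e 2)`, which decreases on `(e 3, e 4)`.
  have ptC : ∀ s ∈ Ioo (e 3) (e 4), s - e 1 ≤ μ * √((e 1 - s) * (e 2 - s)) ∧
      μ⁻¹ * √((e 1 - s) * (e 2 - s)) ≤ s - e 2 := by
    intro s hs
    have : (e 1 - s) * (e 2 - s) = (s - e 2) * (s - e 1) := by ring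
    rw [this]
    refine le_mul_sqrt_mul (by linarith [hs.1]) (by linarith) hμ0 ?_
    rw [hμ2, div_mul_eq_mul_div, le_div_iff₀ (by linarith)]
    nlinarith [hs.1]
  have posA : ∀ s ∈ Ioo 0 (e 0), 0 < rootPoly ![e 0, e 3, e 4] s ∧ 0 < (e 1 - s) * (e 2 - s) := by
    intro s hs
    rw [rootPoly_three]
    have := hs.2
    exact ⟨mul_pos (mul_pos (by linarith) (by linarith)) (by linarith),
      mul_pos (by linarith) (by linarith)⟩
  have posC : ∀ s ∈ Ioo (e 3) (e 4), 0 < rootPoly ![e 0, e 3, e 4] s ∧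
      0 < (e 1 - s) * (e 2 - s) := fun s hs =>
    ⟨rootPoly_three_pos m03 hs, mul_pos_of_neg_of_neg (by linarith [hs.1]) (by linarith [hs.1])⟩
  have uA : perDet (perA e) (perB e) ≤ perB e 0 * κ * rotNum (e 0) (e 3) (e 4) := by
    rw [← detA, ← intN]
    refine intervalIntegral.integral_mono_on_of_le_Ioo h0.le (hi5 _ _ _ _) (hi3 _ _ _) fun s hs => ?_
    rw [rootPoly_five_eq]
    refine div_sqrt_mul_le (posA s hs).1 (posA s hs).2 ?_
    nlinarith [(ptA s hs).1]
  have lA : perB e 0 * κ⁻¹ * rotNum (e 0) (e 3) (e 4) ≤ perDet (perA e) (perB e) := by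
    rw [← detA, ← intN]
    refine intervalIntegral.integral_mono_on_of_le_Ioo h0.le (hi3 _ _ _) (hi5 _ _ _ _) fun s hs => ?_
    rw [rootPoly_five_eq]
    refine le_div_sqrt_mul (posA s hs).1 (posA s hs).2 ?_
    nlinarith [(ptA s hs).2]
  have uC : perDet (perB e) (perC e) ≤ perB e 0 * μ * rotDen (e 0) (e 3) (e 4) := by
    rw [← detC, ← intD]
    refine intervalIntegral.integral_mono_on_of_le_Ioo m3.le (hi5 _ _ _ _) (hi3 _ _ _) fun s hs => ?_
    rw [rootPoly_five_eq]
    refine div_sqrt_mul_le (posC s hs).1 (posC s hs).2 ?_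
    nlinarith [(ptC s hs).1]
  have lC : perB e 0 * μ⁻¹ * rotDen (e 0) (e 3) (e 4) ≤ perDet (perB e) (perC e) := by
    rw [← detC, ← intD]
    refine intervalIntegral.integral_mono_on_of_le_Ioo m3.le (hi3 _ _ _) (hi5 _ _ _ _) fun s hs => ?_
    rw [rootPoly_five_eq]
    refine le_div_sqrt_mul (posC s hs).1 (posC s hs).2 ?_
    nlinarith [(ptC s hs).2]
  rw [rotationNumber_eq m03]
  simp only [freqOf, distortion, ← hκ, ← hμ]
  constructor
  · calc _ = (perB e 0 * κ⁻¹ * rotNum (e 0) (e 3) (e 4)) /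
          (2 * (perB e 0 * μ * rotDen (e 0) (e 3) (e 4))) := by field_simp
      _ ≤ _ := div_le_div₀ ((by positivity : (0 : ℝ) ≤ _).trans lA) lA (by positivity) (by linarith)
  · calc _ ≤ (perB e 0 * κ * rotNum (e 0) (e 3) (e 4)) /
          (2 * (perB e 0 * μ⁻¹ * rotDen (e 0) (e 3) (e 4))) :=
            div_le_div₀ (by positivity) uA (by positivity) (by linarith)
      _ = _ := by field_simp

end RotationNumber

/-! ### Smoothness of the frequency map -/

/-- The integral is the value at `0` of the convolution of the indicator of `(0, r]` with `x ↦ χ x *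
g (p, -x)`, where the cutoff `χ` equals `1` on `[-r, r]`. Smoothness in `p` is then that of
convolutions with a compactly supported smooth kernel. -/
theorem contDiffOn_integral_param {P : Type*} [NormedAddCommGroup P] [NormedSpace ℝ P]
    {S : Set P} (hS : IsOpen S) {r : ℝ} (hr : 0 < r)
    {g : P × ℝ → ℝ} (hg : ContDiffOn ℝ (⊤ : ℕ∞) g (S ×ˢ univ)) :
    ContDiffOn ℝ (⊤ : ℕ∞) (fun p => ∫ t in (0 : ℝ)..r, g (p, t)) S := by
  let χ : ContDiffBump (0 : ℝ) := ⟨r, r + 1, hr, by linarith⟩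
  let f : ℝ → ℝ := indicator (Ioc 0 r) fun _ => 1
  have hf : MeasureTheory.LocallyIntegrable f :=
    ((MeasureTheory.integrable_indicator_iff measurableSet_Ioc).2 (by simp)).locallyIntegrable
  have h := MeasureTheory.contDiffOn_convolution_right_with_param_comp (n := ⊤) (μ := MeasureTheory.volume)
    (ContinuousLinearMap.mul ℝ ℝ) (s := S) (v := fun _ => (0 : ℝ)) contDiffOn_const
    (f := f) (g := fun p x => χ x * g (p, -x)) (k := Metric.closedBall 0 (r + 1)) hS
    (isCompact_closedBall _ _) ?_ hf ?_
  · refine h.congr fun p _ => ?_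
    rw [MeasureTheory.convolution_def, intervalIntegral.integral_of_le hr.le,
      ← MeasureTheory.integral_indicator measurableSet_Ioc]
    congr 1
    ext t
    by_cases ht : t ∈ Ioc 0 r
    · have : χ (-t) = 1 := χ.one_of_mem_closedBall (by
        rw [Metric.mem_closedBall, dist_zero_right, norm_neg, Real.norm_eq_abs, abs_of_pos ht.1]
        exact ht.2)
      simp [f, ht, this]
    · simp [f, ht]
  · intro p x _ hx
    have : χ x = 0 := χ.zero_of_le_dist (by
      rw [Metric.mem_closedBall, not_le] at hx
      exact hx.le)
    simp [this]
  · have h1 : ContDiff ℝ (⊤ : ℕ∞) (fun q : P × ℝ => χ q.2) := χ.contDiff.comp contDiff_snd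
    have h2 : ContDiffOn ℝ (⊤ : ℕ∞) (fun q : P × ℝ => g (q.1, -q.2)) (S ×ˢ univ) :=
      hg.comp (contDiff_fst.prodMk contDiff_snd.neg).contDiffOn fun q hq => ⟨hq.1, mem_univ _⟩
    exact h1.contDiffOn.mul h2

theorem integral_eq_integral_sin_sq {u v : ℝ} (huv : u < v) (F : ℝ → ℝ) :
    ∫ s in u..v, F s = ∫ t in (0 : ℝ)..(Real.pi / 2),
      2 * (v - u) * Real.sin t * Real.cos t * F (u + (v - u) * Real.sin t ^ 2) := by
  have hpi := Real.pi_pos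
  have hd : ∀ t ∈ Ioo 0 (Real.pi / 2), HasDerivWithinAt (fun t => u + (v - u) * Real.sin t ^ 2)
      (2 * (v - u) * Real.sin t * Real.cos t) (Ioo 0 (Real.pi / 2)) t := by
    intro t _
    refine HasDerivAt.hasDerivWithinAt ?_
    refine ((((Real.hasDerivAt_sin t).pow 2).const_mul (v - u)).const_add u).congr_deriv ?_
    simp only [Nat.cast_ofNat, Nat.add_one_sub_one, pow_one]
    ring
  have hsin : ∀ t ∈ Ioo 0 (Real.pi / 2), 0 < Real.sin t ∧ Real.sin t < 1 ∧ 0 < Real.cos t := by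
    intro t ht
    have h1 := Real.sin_pos_of_pos_of_lt_pi ht.1 (by linarith [ht.2])
    have h2 := Real.cos_pos_of_mem_Ioo ⟨by linarith [ht.1], ht.2⟩
    refine ⟨h1, ?_, h2⟩
    nlinarith [Real.sin_sq_add_cos_sq t]
  have hinj : InjOn (fun t => u + (v - u) * Real.sin t ^ 2) (Ioo 0 (Real.pi / 2)) := by
    intro t ht t' ht' h
    simp only [add_right_inj] at h
    have h1 := mul_left_cancel₀ (sub_pos.2 huv).ne' h
    rw [pow_left_inj₀ (hsin t ht).1.le (hsin t' ht').1.le two_ne_zero] at h1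
    exact Real.injOn_sin ⟨by linarith [ht.1], ht.2.le⟩ ⟨by linarith [ht'.1], ht'.2.le⟩ h1
  have himg : (fun t => u + (v - u) * Real.sin t ^ 2) '' Ioo 0 (Real.pi / 2) = Ioo u v := by
    ext s
    constructor
    · rintro ⟨t, ht, rfl⟩
      obtain ⟨h1, h2, -⟩ := hsin t ht
      have h3 : Real.sin t ^ 2 < 1 := by nlinarith
      have h4 : 0 < Real.sin t ^ 2 := by positivity
      constructor <;> simp only <;> nlinarith
    · rintro ⟨h1, h2⟩
      have hvu : 0 < v - u := by linarith
      have q0 : 0 < (s - u) / (v - u) := div_pos (by linarith) hvu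
      have q1 : (s - u) / (v - u) < 1 := by rw [div_lt_one hvu]; linarith
      have r0 : 0 < √((s - u) / (v - u)) := Real.sqrt_pos.2 q0
      have r1 : √((s - u) / (v - u)) < 1 := by
        rw [Real.sqrt_lt' one_pos]; simpa using q1
      refine ⟨Real.arcsin √((s - u) / (v - u)), ⟨Real.arcsin_pos.2 r0,
        Real.arcsin_lt_pi_div_two.2 r1⟩, ?_⟩
      simp only
      rw [Real.sin_arcsin (by linarith) r1.le, Real.sq_sqrt q0.le]
      field_simp
      ring
  rw [intervalIntegral.integral_of_le huv.le, intervalIntegral.integral_of_le (by positivity),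
    MeasureTheory.integral_Ioc_eq_integral_Ioo, MeasureTheory.integral_Ioc_eq_integral_Ioo, ← himg,
    MeasureTheory.integral_image_eq_integral_abs_deriv_smul measurableSet_Ioo hd hinj F]
  refine MeasureTheory.setIntegral_congr_fun measurableSet_Ioo fun t ht => ?_
  obtain ⟨h1, h2, h3⟩ := hsin t ht
  have hvu : 0 < v - u := by linarith
  simp only [smul_eq_mul]
  rw [abs_of_nonneg (by positivity)]

/-- Under `s = u + (v - u) sin² t` the root of `(s - u)(v - s)` is `(v - u) sin t cos t`, half the
Jacobian. Both end point singularities disappear and the domain of integration no longer depends on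
`u`, `v`. -/
theorem integral_div_sqrt_eq_sin_sq {u v : ℝ} (huv : u < v) (k : ℕ) (G : ℝ → ℝ) :
    ∫ s in u..v, s ^ k / √((s - u) * (v - s) * G s) = ∫ t in (0 : ℝ)..(Real.pi / 2),
      2 * (u + (v - u) * Real.sin t ^ 2) ^ k / √(G (u + (v - u) * Real.sin t ^ 2)) := by
  rw [integral_eq_integral_sin_sq huv]
  refine intervalIntegral.integral_congr_Ioo_of_le (by positivity) fun t ht => ?_
  have h1 := Real.sin_pos_of_pos_of_lt_pi ht.1 (by linarith [ht.2, Real.pi_pos])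
  have h2 := Real.cos_pos_of_mem_Ioo ⟨by linarith [ht.1, Real.pi_pos], ht.2⟩
  have hvu : 0 < v - u := by linarith
  have e1 : (u + (v - u) * Real.sin t ^ 2 - u) * (v - (u + (v - u) * Real.sin t ^ 2)) =
      ((v - u) * Real.sin t * Real.cos t) ^ 2 := by
    rw [mul_pow _ (Real.cos t), Real.cos_sq']; ring
  rw [e1, Real.sqrt_mul (by positivity), Real.sqrt_sq (by positivity)]
  field_simp

theorem integral_div_sqrt_sub_eq_sin_sq {v : ℝ} (hv : 0 < v) (k : ℕ) (G : ℝ → ℝ) :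
    ∫ s in (0 : ℝ)..v, s ^ k / √((v - s) * G s) = ∫ t in (0 : ℝ)..(Real.pi / 2),
      2 * √v * Real.sin t * (v * Real.sin t ^ 2) ^ k / √(G (v * Real.sin t ^ 2)) := by
  rw [integral_eq_integral_sin_sq hv]
  refine intervalIntegral.integral_congr_Ioo_of_le (by positivity) fun t ht => ?_
  have h1 := Real.sin_pos_of_pos_of_lt_pi ht.1 (by linarith [ht.2, Real.pi_pos])
  have h2 := Real.cos_pos_of_mem_Ioo ⟨by linarith [ht.1, Real.pi_pos], ht.2⟩
  have e1 : v - v * Real.sin t ^ 2 = v * Real.cos t ^ 2 := by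
    rw [Real.cos_sq']; ring
  have hsv : 0 < √v := Real.sqrt_pos.2 hv
  simp only [zero_add, sub_zero]
  rw [e1, Real.sqrt_mul (by positivity), Real.sqrt_mul hv.le, Real.sqrt_sq h2.le]
  have e2 : 2 * v * Real.sin t * Real.cos t = 2 * (√v * √v) * Real.sin t * Real.cos t := by
    rw [Real.mul_self_sqrt hv.le]
  rw [e2]
  field_simp

/-- The open set of admissible end points. -/
def admissible : Set (Fin 5 → ℝ) := {e | StrictMono e ∧ 0 < e 0}

theorem isOpen_admissible : IsOpen admissible := by
  have : admissible = {e : Fin 5 → ℝ | 0 < e 0} ∩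
      ⋂ i : Fin 4, {e : Fin 5 → ℝ | e i.castSucc < e i.succ} := by
    ext e
    simp only [admissible, mem_ofPred_eq, Fin.strictMono_iff_lt_succ, mem_inter_iff, mem_iInter]
    tauto
  rw [this]
  refine IsOpen.inter (isOpen_lt (by fun_prop) (by fun_prop)) (isOpen_iInter_of_finite fun i => ?_)
  exact isOpen_lt (by fun_prop) (by fun_prop)

/-- After the trigonometric substitution the radicand is positive for every real `t`, because `sin²
t ≤ 1`, so the integrand is jointly smooth. The other two periods are treated alike. -/
theorem contDiffOn_perA (k : ℕ) : ContDiffOn ℝ (⊤ : ℕ∞) (fun e : Fin 5 → ℝ => perA e k) admissible := by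
  have h := contDiffOn_integral_param isOpen_admissible (r := Real.pi / 2) Real.pi_div_two_pos
    (g := fun q => 2 * √(q.1 0) * Real.sin q.2 * (q.1 0 * Real.sin q.2 ^ 2) ^ k /
      √((q.1 1 - q.1 0 * Real.sin q.2 ^ 2) * (q.1 2 - q.1 0 * Real.sin q.2 ^ 2) *
        (q.1 3 - q.1 0 * Real.sin q.2 ^ 2) * (q.1 4 - q.1 0 * Real.sin q.2 ^ 2))) ?_
  · refine h.congr fun e he => ?_
    rw [← integral_div_sqrt_sub_eq_sin_sq he.2 k
      (fun s => (e 1 - s) * (e 2 - s) * (e 3 - s) * (e 4 - s)), perA, rootInt]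
    congr 1; ext s
    rw [rootPoly_five]; congr 2; ring
  · have hpos : ∀ q ∈ admissible ×ˢ (univ : Set ℝ), 0 < q.1 0 ∧
        0 < (q.1 1 - q.1 0 * Real.sin q.2 ^ 2) * (q.1 2 - q.1 0 * Real.sin q.2 ^ 2) *
        (q.1 3 - q.1 0 * Real.sin q.2 ^ 2) * (q.1 4 - q.1 0 * Real.sin q.2 ^ 2) := by
      rintro ⟨e, t⟩ ⟨he, -⟩
      obtain ⟨m0, m1, m2, m3⟩ := chain_five he.1
      have h0 := he.2
      have h1 : e 0 * Real.sin t ^ 2 ≤ e 0 := mul_le_of_le_one_right h0.le (Real.sin_sq_le_one t)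
      exact ⟨h0, mul_pos (mul_pos (mul_pos (by linarith) (by linarith)) (by linarith)) (by linarith)⟩
    refine ContDiffOn.div (n := (⊤ : ℕ∞)) ?_ (ContDiffOn.sqrt ?_ fun q hq => (hpos q hq).2.ne')
      fun q hq => (Real.sqrt_pos.2 (hpos q hq).2).ne'
    · refine ContDiffOn.mul (ContDiffOn.mul (ContDiffOn.mul contDiffOn_const
        (ContDiffOn.sqrt ?_ fun q hq => (hpos q hq).1.ne')) ?_) ?_ <;> fun_prop
    · fun_prop

theorem contDiffOn_perB (k : ℕ) : ContDiffOn ℝ (⊤ : ℕ∞) (fun e : Fin 5 → ℝ => perB e k) admissible := by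
  have h := contDiffOn_integral_param isOpen_admissible (r := Real.pi / 2) Real.pi_div_two_pos
    (g := fun q => 2 * (q.1 1 + (q.1 2 - q.1 1) * Real.sin q.2 ^ 2) ^ k /
      √((q.1 1 + (q.1 2 - q.1 1) * Real.sin q.2 ^ 2 - q.1 0) *
        (q.1 3 - (q.1 1 + (q.1 2 - q.1 1) * Real.sin q.2 ^ 2)) *
        (q.1 4 - (q.1 1 + (q.1 2 - q.1 1) * Real.sin q.2 ^ 2)))) ?_
  · refine h.congr fun e he => ?_
    obtain ⟨m0, m1, m2, m3⟩ := chain_five he.1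
    rw [← integral_div_sqrt_eq_sin_sq m1 k
      (fun s => (s - e 0) * (e 3 - s) * (e 4 - s)), perB, rootInt]
    congr 1; ext s
    rw [rootPoly_five]; congr 2; ring
  · have hpos : ∀ q ∈ admissible ×ˢ (univ : Set ℝ),
        0 < (q.1 1 + (q.1 2 - q.1 1) * Real.sin q.2 ^ 2 - q.1 0) *
        (q.1 3 - (q.1 1 + (q.1 2 - q.1 1) * Real.sin q.2 ^ 2)) *
        (q.1 4 - (q.1 1 + (q.1 2 - q.1 1) * Real.sin q.2 ^ 2)) := by
      rintro ⟨e, t⟩ ⟨he, -⟩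
      obtain ⟨m0, m1, m2, m3⟩ := chain_five he.1
      have h1 : (e 2 - e 1) * Real.sin t ^ 2 ≤ e 2 - e 1 :=
        mul_le_of_le_one_right (by linarith) (Real.sin_sq_le_one t)
      have h2 : 0 ≤ (e 2 - e 1) * Real.sin t ^ 2 := mul_nonneg (by linarith) (sq_nonneg _)
      exact mul_pos (mul_pos (by linarith) (by linarith)) (by linarith)
    refine ContDiffOn.div (n := (⊤ : ℕ∞)) ?_ (ContDiffOn.sqrt ?_ fun q hq => (hpos q hq).ne')
      fun q hq => (Real.sqrt_pos.2 (hpos q hq)).ne'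
    · fun_prop
    · fun_prop

theorem contDiffOn_perC (k : ℕ) : ContDiffOn ℝ (⊤ : ℕ∞) (fun e : Fin 5 → ℝ => perC e k) admissible := by
  have h := contDiffOn_integral_param isOpen_admissible (r := Real.pi / 2) Real.pi_div_two_pos
    (g := fun q => 2 * (q.1 3 + (q.1 4 - q.1 3) * Real.sin q.2 ^ 2) ^ k /
      √((q.1 3 + (q.1 4 - q.1 3) * Real.sin q.2 ^ 2 - q.1 0) *
        (q.1 3 + (q.1 4 - q.1 3) * Real.sin q.2 ^ 2 - q.1 1) *
        (q.1 3 + (q.1 4 - q.1 3) * Real.sin q.2 ^ 2 - q.1 2))) ?_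
  · refine h.congr fun e he => ?_
    obtain ⟨m0, m1, m2, m3⟩ := chain_five he.1
    rw [← integral_div_sqrt_eq_sin_sq m3 k
      (fun s => (s - e 0) * (s - e 1) * (s - e 2)), perC, rootInt]
    congr 1; ext s
    rw [rootPoly_five]; congr 2; ring
  · have hpos : ∀ q ∈ admissible ×ˢ (univ : Set ℝ),
        0 < (q.1 3 + (q.1 4 - q.1 3) * Real.sin q.2 ^ 2 - q.1 0) *
        (q.1 3 + (q.1 4 - q.1 3) * Real.sin q.2 ^ 2 - q.1 1) *
        (q.1 3 + (q.1 4 - q.1 3) * Real.sin q.2 ^ 2 - q.1 2) := by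
      rintro ⟨e, t⟩ ⟨he, -⟩
      obtain ⟨m0, m1, m2, m3⟩ := chain_five he.1
      have h2 : 0 ≤ (e 4 - e 3) * Real.sin t ^ 2 := mul_nonneg (by linarith) (sq_nonneg _)
      exact mul_pos (mul_pos (by linarith) (by linarith)) (by linarith)
    refine ContDiffOn.div (n := (⊤ : ℕ∞)) ?_ (ContDiffOn.sqrt ?_ fun q hq => (hpos q hq).ne')
      fun q hq => (Real.sqrt_pos.2 (hpos q hq)).ne'
    · fun_prop
    · fun_prop

theorem contDiffOn_freqOf : ContDiffOn ℝ (⊤ : ℕ∞) freqOf admissible := by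
  have hdet : ∀ e ∈ admissible, 2 * perDet (perB e) (perC e) ≠ 0 := fun e he =>
    mul_ne_zero two_ne_zero (perDet_BC_pos he.1 he.2).ne'
  have hBC : ContDiffOn ℝ (⊤ : ℕ∞) (fun e => 2 * perDet (perB e) (perC e)) admissible :=
    contDiffOn_const.mul (((contDiffOn_perB 0).mul (contDiffOn_perC 1)).sub
      ((contDiffOn_perC 0).mul (contDiffOn_perB 1)))
  refine ContDiffOn.prodMk (ContDiffOn.div ?_ hBC hdet) (ContDiffOn.div ?_ hBC hdet)
  · exact ((contDiffOn_perA 0).mul (contDiffOn_perC 1)).sub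
      ((contDiffOn_perC 0).mul (contDiffOn_perA 1))
  · exact ((contDiffOn_perA 0).mul (contDiffOn_perB 1)).sub
      ((contDiffOn_perB 0).mul (contDiffOn_perA 1))

/-! ### Proper local homeomorphisms of planar domains -/

section Topology

variable {X Y : Type*} [TopologicalSpace X] [TopologicalSpace Y] [T2Space Y]
  {f : X → Y} {U : Set X} {V : Set Y}

/-- If no value in `V` is a cluster value of `f` at the boundary of the relatively compact set `U`,
then `f` restricts to a proper map over `V`. -/
theorem isProperMap_restrict (hU : IsCompact (closure U)) (hf : ContinuousOn f U)
    (hbd : ∀ p ∈ closure U \ U, ∀ v ∈ V, Disjoint (𝓝 v) (map f (𝓝[U] p))) :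
    IsProperMap (MapsTo.restrict f (U ∩ f ⁻¹' V) V fun _ hx => hx.2) := by
  rw [isProperMap_iff_ultrafilter]
  refine ⟨(hf.mono inter_subset_left).mapsToRestrict _, fun 𝒰 y h => ?_⟩
  have hUmem : U ∈ 𝒰.map Subtype.val :=
    Ultrafilter.mem_map.2 (Eventually.of_forall fun x => x.2.1)
  obtain ⟨p, hp, hle⟩ := hU.ultrafilter_le_nhds (𝒰.map Subtype.val)
    (le_principal_iff.2 (mem_of_superset hUmem subset_closure))
  have hleU : (𝒰.map Subtype.val : Filter X) ≤ 𝓝[U] p := le_inf hle (le_principal_iff.2 hUmem)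
  have hfy : map f (𝒰.map Subtype.val : Filter X) ≤ 𝓝 (y : Y) := by
    have := (continuous_subtype_val.tendsto y).comp h
    rw [Ultrafilter.coe_map, map_map]
    exact this
  by_cases hpU : p ∈ U
  · have h1 : map f (𝒰.map Subtype.val : Filter X) ≤ 𝓝 (f p) := (map_mono hleU).trans (hf p hpU)
    have h2 : f p = y := tendsto_nhds_unique (f := f) h1 hfy
    refine ⟨⟨p, hpU, by simp [h2]⟩, Subtype.ext h2, ?_⟩
    rw [nhds_subtype]
    exact map_le_iff_le_comap.1 hle
  -- A limit `p` of the ultrafilter outside `U` would make `y` a cluster value of `f` at the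
  -- boundary.
  · have h1 := (hbd p ⟨hp, hpU⟩ y y.2).mono_right (map_mono hleU)
    exact absurd (h1.eq_bot_of_ge hfy) (NeBot.ne (Filter.map_neBot))

/-- The trace of the image on `V` is open by assumption and closed because proper maps are closed;
`V` is connected. -/
theorem subset_image_or_disjoint (hU : IsCompact (closure U)) (hf : ContinuousOn f U)
    (hopen : IsOpen (f '' U)) (hV : IsPreconnected V)
    (hbd : ∀ p ∈ closure U \ U, ∀ v ∈ V, Disjoint (𝓝 v) (map f (𝓝[U] p))) :
    V ⊆ f '' U ∨ Disjoint V (f '' U) := by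
  have hprop := isProperMap_restrict hU hf hbd
  have : PreconnectedSpace V := isPreconnected_iff_preconnectedSpace.1 hV
  have hr : range (MapsTo.restrict f (U ∩ f ⁻¹' V) V fun _ hx => hx.2) =
      Subtype.val ⁻¹' (f '' U) := by
    ext v
    constructor
    · rintro ⟨x, rfl⟩; exact ⟨x, x.2.1, rfl⟩
    · rintro ⟨x, hx, hxv⟩
      exact ⟨⟨x, hx, by simp [hxv]⟩, Subtype.ext hxv⟩
  have hclopen : IsClopen (Subtype.val ⁻¹' (f '' U) : Set V) :=
    ⟨hr ▸ hprop.isClosedMap.isClosed_range, hopen.preimage continuous_subtype_val⟩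
  rcases isClopen_iff.1 hclopen with h | h
  · right
    rw [disjoint_left]
    intro v hv hv'
    have : (⟨v, hv⟩ : V) ∈ (Subtype.val ⁻¹' (f '' U) : Set V) := hv'
    rw [h] at this
    exact this
  · left
    intro v hv
    have : (⟨v, hv⟩ : V) ∈ (Subtype.val ⁻¹' (f '' U) : Set V) := h ▸ mem_univ _
    exact this

/-- A proper local homeomorphism from a connected space onto a simply connected one is injective. -/
theorem injective_of_isProperMap {X Y : Type*} [TopologicalSpace X] [TopologicalSpace Y] [T2Space X]
    [T2Space Y] [PreconnectedSpace X] [SimplyConnectedSpace Y] [LocallyPathConnectedSpace Y]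
    {g : X → Y} (hg : IsProperMap g) (hl : IsLocalHomeomorph g) : Function.Injective g := by
  have hfin : ∀ y, (g ⁻¹' {y}).Finite := fun y =>
    (hg.isCompact_preimage isCompact_singleton).finite
      (IsDiscrete.of_openPartialHomeomorph g subset_rfl fun e _ => by
        obtain ⟨φ, hφ, h⟩ := hl e
        exact ⟨φ, hφ, h.symm⟩)
  -- The fibres are compact and discrete, hence finite, and a closed local homeomorphism with finite
  -- fibres is a covering.
  have hcov : IsCoveringMap g := by
    rw [isCoveringMap_iff_isCoveringMapOn_univ]
    refine hg.isClosedMap.isCoveringMapOn_of_isLocalHomeomorphOn (fun y _ => hfin y) ?_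
    rw [preimage_univ]
    exact isLocalHomeomorph_iff_isLocalHomeomorphOn_univ.1 hl
  intro x x' hxx
  -- Simple connectedness gives a section `F` through `x`. Both `F ∘ g` and the identity lift `g`
  -- and agree at `x`, so they coincide on the connected space `X`, and `F` is a left inverse of
  -- `g`.
  obtain ⟨F, ⟨hF0, hF⟩, -⟩ := hcov.existsUnique_continuousMap_lifts (ContinuousMap.id Y) (g x) x rfl
  have h1 : (fun z => F (g z)) = id := by
    refine hcov.eq_of_comp_eq (F.continuous.comp hg.continuous) continuous_id ?_ x hF0
    ext z
    exact congrFun hF (g z)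
  have h2 := congrFun h1 x
  have h3 := congrFun h1 x'
  simp only [id] at h2 h3
  rw [← h2, ← h3, hxx]

theorem injOn_of_isProperMap [T2Space X] (hUo : IsOpen U) (hUc : IsPreconnected U)
    (hU : IsCompact (closure U)) (hf : IsLocalHomeomorphOn f U) (hm : MapsTo f U V)
    (hVo : IsOpen V) [SimplyConnectedSpace V] [LocallyPathConnectedSpace V]
    (hbd : ∀ p ∈ closure U \ U, ∀ v ∈ V, Disjoint (𝓝 v) (map f (𝓝[U] p))) : InjOn f U := by
  have hW : U ∩ f ⁻¹' V = U := inter_eq_left.2 hm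
  have hprop := isProperMap_restrict hU hf.continuousOn hbd
  have hprop' : IsProperMap (MapsTo.restrict f U V hm) :=
    hprop.comp (Homeomorph.setCongr hW.symm).isProperMap
  have hl : IsLocalHomeomorph (MapsTo.restrict f U V hm) := by
    refine IsLocalHomeomorph.of_comp (g := (Subtype.val : V → Y)) ?_
      hVo.isOpenEmbedding_subtypeVal.isLocalHomeomorph hprop'.continuous
    rw [isLocalHomeomorph_iff_isLocalHomeomorphOn_univ]
    exact hf.comp (isLocalHomeomorph_iff_isLocalHomeomorphOn_univ.1
      hUo.isOpenEmbedding_subtypeVal.isLocalHomeomorph) fun x _ => x.2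
  have : PreconnectedSpace U := isPreconnected_iff_preconnectedSpace.1 hUc
  have hinj := injective_of_isProperMap hprop' hl
  intro x hx x' hx' h
  exact congrArg Subtype.val (@hinj ⟨x, hx⟩ ⟨x', hx'⟩ (Subtype.ext h))

end Topology

/-! ### Consequences of the inverse function theorem in the plane -/

theorem isLocalHomeomorphOn_of_det_ne_zero {f : ℝ × ℝ → ℝ × ℝ} {U : Set (ℝ × ℝ)}
    (hf : ∀ p ∈ U, ContDiffAt ℝ (⊤ : ℕ∞) f p) (hdet : ∀ p ∈ U, (fderiv ℝ f p).det ≠ 0) :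
    IsLocalHomeomorphOn f U := by
  intro p hp
  have hd : HasFDerivAt f (((fderiv ℝ f p).toContinuousLinearEquivOfDetNeZero (hdet p hp) :
      (ℝ × ℝ) ≃L[ℝ] (ℝ × ℝ)) : (ℝ × ℝ) →L[ℝ] (ℝ × ℝ)) p := by
    rw [ContinuousLinearMap.coe_toContinuousLinearEquivOfDetNeZero]
    exact ((hf p hp).differentiableAt (by simp)).hasFDerivAt
  exact ⟨(hf p hp).toOpenPartialHomeomorph f hd (by simp),
    (hf p hp).mem_toOpenPartialHomeomorph_source hd (by simp), rfl⟩

theorem isDiffeoOnto_of_bijOn {f : ℝ × ℝ → ℝ × ℝ} {U V : Set (ℝ × ℝ)} (hU : IsOpen U)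
    (hV : IsOpen V) (hf : ∀ p ∈ U, ContDiffAt ℝ (⊤ : ℕ∞) f p)
    (hdet : ∀ p ∈ U, (fderiv ℝ f p).det ≠ 0) (hbij : BijOn f U V) : IsDiffeoOnto f U V := by
  refine ⟨hU, hV, hbij, fun p hp => (hf p hp).contDiffWithinAt, Function.invFunOn f U,
    hbij.invOn_invFunOn, ?_⟩
  intro y hy
  obtain ⟨p, hp, rfl⟩ := hbij.surjOn hy
  have hd : HasFDerivAt f (((fderiv ℝ f p).toContinuousLinearEquivOfDetNeZero (hdet p hp) :
      (ℝ × ℝ) ≃L[ℝ] (ℝ × ℝ)) : (ℝ × ℝ) →L[ℝ] (ℝ × ℝ)) p := by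
    rw [ContinuousLinearMap.coe_toContinuousLinearEquivOfDetNeZero]
    exact ((hf p hp).differentiableAt (by simp)).hasFDerivAt
  have hloc := (hf p hp).to_localInverse hd (by simp)
  -- Near `f p` the local inverse takes values in `U`, so by injectivity the global inverse agrees
  -- with it and inherits its smoothness.
  refine (hloc.congr_of_eventuallyEq ?_).contDiffWithinAt
  have hst := (hf p hp).hasStrictFDerivAt' hd (by simp)
  have h1 : ∀ᶠ y in 𝓝 (f p), f ((hf p hp).localInverse hd (by simp) y) = y :=
    hst.eventually_right_inverse
  have h2 : ∀ᶠ y in 𝓝 (f p), (hf p hp).localInverse hd (by simp) y ∈ U := by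
    refine hloc.continuousAt.eventually_mem ?_
    rw [(hf p hp).localInverse_apply_image hd (by simp)]
    exact hU.mem_nhds hp
  filter_upwards [h1, h2, hV.mem_nhds (hbij.mapsTo hp)] with y e1 e2 e3
  refine hbij.injOn (hbij.surjOn.mapsTo_invFunOn e3) e2 ?_
  rw [e1, hbij.invOn_invFunOn.2 e3]

/-! ### The triangle -/

/-- The open triangle cut out by `r < w₂ < w₁ < 1/2`. -/
def wedge (r : ℝ) : Set (ℝ × ℝ) := {w | r < w.2 ∧ w.2 < w.1 ∧ w.1 < 1 / 2}

theorem isOpen_wedge (r : ℝ) : IsOpen (wedge r) :=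
  (isOpen_lt continuous_const continuous_snd).inter
    ((isOpen_lt continuous_snd continuous_fst).inter (isOpen_lt continuous_fst continuous_const))

theorem convex_wedge (r : ℝ) : Convex ℝ (wedge r) := by
  have h1 : Convex ℝ {w : ℝ × ℝ | r < w.2} := convex_halfSpace_gt (LinearMap.snd ℝ ℝ ℝ).isLinear r
  have h2 : Convex ℝ {w : ℝ × ℝ | w.1 < 1 / 2} :=
    convex_halfSpace_lt (LinearMap.fst ℝ ℝ ℝ).isLinear _
  have h3 : Convex ℝ {w : ℝ × ℝ | 0 < w.1 - w.2} :=
    convex_halfSpace_gt (LinearMap.fst ℝ ℝ ℝ - LinearMap.snd ℝ ℝ ℝ).isLinear _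
  simp only [sub_pos] at h3
  exact h1.inter (h3.inter h2)

theorem convexHull_triangle {r : ℝ} (hr : r < 1 / 2) :
    convexHull ℝ {((1 / 2, 1 / 2) : ℝ × ℝ), (1 / 2, r), (r, r)} =
      {w | r ≤ w.2 ∧ w.2 ≤ w.1 ∧ w.1 ≤ 1 / 2} := by
  apply subset_antisymm
  · refine convexHull_min ?_ ?_
    · rintro w (rfl | rfl | rfl) <;> simp <;> linarith
    · have h1 : Convex ℝ {w : ℝ × ℝ | r ≤ w.2} :=
        convex_halfSpace_ge (LinearMap.snd ℝ ℝ ℝ).isLinear r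
      have h2 : Convex ℝ {w : ℝ × ℝ | w.1 ≤ 1 / 2} :=
        convex_halfSpace_le (LinearMap.fst ℝ ℝ ℝ).isLinear _
      have h3 : Convex ℝ {w : ℝ × ℝ | 0 ≤ w.1 - w.2} :=
        convex_halfSpace_ge (LinearMap.fst ℝ ℝ ℝ - LinearMap.snd ℝ ℝ ℝ).isLinear _
      simp only [sub_nonneg] at h3
      exact h1.inter (h3.inter h2)
  · rintro ⟨x, y⟩ ⟨h1, h2, h3⟩
    simp only at h1 h2 h3
    have hd : 0 < 1 / 2 - r := by linarith
    have hd2 : 1 - 2 * r ≠ 0 := by linarith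
    have hd3 : 1 - r * 2 ≠ 0 := by linarith
    have hc := convex_convexHull ℝ {((1 / 2, 1 / 2) : ℝ × ℝ), (1 / 2, r), (r, r)}
    have hs := subset_convexHull ℝ {((1 / 2, 1 / 2) : ℝ × ℝ), (1 / 2, r), (r, r)}
    -- The weights are the barycentric coordinates of `(x, y)`, one for the distance to each side.
    have := hc.sum_mem (t := Finset.univ)
      (w := ![(y - r) / (1 / 2 - r), (x - y) / (1 / 2 - r), (1 / 2 - x) / (1 / 2 - r)])
      (z := ![((1 / 2, 1 / 2) : ℝ × ℝ), (1 / 2, r), (r, r)]) ?_ ?_ ?_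
    · rw [Fin.sum_univ_three] at this
      convert this using 1
      ext
      · simp
        field_simp
        ring
      · simp
        field_simp
        ring
    · intro i _
      fin_cases i
      · exact div_nonneg (by linarith) hd.le
      · exact div_nonneg (by linarith) hd.le
      · exact div_nonneg (by linarith) hd.le
    · rw [Fin.sum_univ_three]
      simp only [Matrix.cons_val]
      field_simp
      ring
    · intro i _
      fin_cases i
      · exact hs (by simp)
      · exact hs (by simp)
      · exact hs (by simp)

theorem interior_triangle (r : ℝ) :
    interior {w : ℝ × ℝ | r ≤ w.2 ∧ w.2 ≤ w.1 ∧ w.1 ≤ 1 / 2} = wedge r := by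
  have h1 : interior {w : ℝ × ℝ | r ≤ w.2} = {w : ℝ × ℝ | r < w.2} := by
    have := isOpenMap_snd.preimage_interior_eq_interior_preimage (X := ℝ × ℝ) continuous_snd (Ici r)
    rw [interior_Ici] at this
    exact this.symm
  have h2 : interior {w : ℝ × ℝ | w.1 ≤ 1 / 2} = {w : ℝ × ℝ | w.1 < 1 / 2} := by
    have := isOpenMap_fst.preimage_interior_eq_interior_preimage (X := ℝ × ℝ) continuous_fst
      (Iic (1 / 2))
    rw [interior_Iic] at this
    exact this.symm
  have h3 : interior {w : ℝ × ℝ | w.2 ≤ w.1} = {w : ℝ × ℝ | w.2 < w.1} := by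
    let φ : (ℝ × ℝ) →L[ℝ] ℝ := ContinuousLinearMap.fst ℝ ℝ ℝ - ContinuousLinearMap.snd ℝ ℝ ℝ
    have hφ : Function.Surjective φ := fun t => ⟨(t, 0), by simp [φ]⟩
    have := (φ.isOpenMap hφ).preimage_interior_eq_interior_preimage φ.continuous (Ici 0)
    rw [interior_Ici] at this
    have e1 : φ ⁻¹' Ici 0 = {w : ℝ × ℝ | w.2 ≤ w.1} := by ext w; simp [φ]
    have e2 : φ ⁻¹' Ioi 0 = {w : ℝ × ℝ | w.2 < w.1} := by ext w; simp [φ]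
    rw [e1, e2] at this
    exact this.symm
  have e : {w : ℝ × ℝ | r ≤ w.2 ∧ w.2 ≤ w.1 ∧ w.1 ≤ 1 / 2} =
    {w : ℝ × ℝ | r ≤ w.2} ∩ ({w : ℝ × ℝ | w.2 ≤ w.1} ∩ {w : ℝ × ℝ | w.1 ≤ 1 / 2}) := rfl
  rw [e, interior_inter, interior_inter, h1, h2, h3]
  rfl

theorem triangleAB1C1_eq {a b c : ℝ} (hc : 0 < c) (hcb : c < b) (hba : b < a) :
    triangleAB1C1 a b c = wedge (rotationNumber c b a) := by
  have := rotationNumber_lt_half hc hcb hba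
  rw [triangleAB1C1, openTriangle, ptA, ptB1, ptC1, rhoStar, convexHull_triangle this,
    interior_triangle]

/-! ### Limits of the triangles -/

theorem setTendsto_of_eventually {F : ℝ → Set (ℝ × ℝ)} {l : Filter ℝ} [l.NeBot] {S : Set (ℝ × ℝ)}
    (h1 : ∀ w ∈ S, ∀ᶠ c in l, w ∈ F c) (h2 : ∀ w ∉ S, ∀ᶠ c in l, w ∉ F c) : SetTendsto F l S := by
  constructor
  · ext w
    rw [mem_liminf_iff_eventually_mem]
    refine ⟨fun h => ?_, h1 w⟩
    by_contra hw
    obtain ⟨c, hc, hc'⟩ := (h.and (h2 w hw)).exists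
    exact hc' hc
  · ext w
    rw [mem_limsup_iff_frequently_mem]
    refine ⟨fun h => ?_, fun h => (h1 w h).frequently⟩
    by_contra hw
    exact h (h2 w hw)

theorem setTendsto_triangle_zero {a b : ℝ} (hb : 0 < b) (hba : b < a) :
    SetTendsto (fun c => triangleAB1C1 a b c) (𝓝[>] 0) freqSpace := by
  refine setTendsto_of_eventually (fun w hw => ?_) (fun w hw => ?_)
  · filter_upwards [Ioo_mem_nhdsGT hb,
      (tendsto_rotationNumber_zero hb hba).eventually_lt_const hw.1] with c hc h
    rw [triangleAB1C1_eq hc.1 hc.2 hba]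
    exact ⟨h, hw.2⟩
  · filter_upwards [Ioo_mem_nhdsGT hb] with c hc h
    rw [triangleAB1C1_eq hc.1 hc.2 hba] at h
    exact hw ⟨(rotationNumber_pos hc.1 hc.2 hba).trans h.1, h.2⟩

theorem setTendsto_triangle_empty {a b : ℝ} (hb : 0 < b) (hba : b < a) :
    SetTendsto (fun c => triangleAB1C1 a b c) (𝓝[<] b) ∅ := by
  refine setTendsto_of_eventually (fun w hw => hw.elim) (fun w _ => ?_)
  by_cases hw : w.2 < 1 / 2
  · filter_upwards [Ioo_mem_nhdsLT hb,
      (tendsto_rotationNumber_half hb hba).eventually_const_lt hw] with c hc h h'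
    rw [triangleAB1C1_eq hc.1 hc.2 hba] at h'
    exact lt_asymm h h'.1
  · filter_upwards [Ioo_mem_nhdsLT hb] with c hc h'
    rw [triangleAB1C1_eq hc.1 hc.2 hba] at h'
    exact hw (h'.2.1.trans h'.2.2)

/-! ### Limits of the frequencies at the boundary -/

section Limits

variable {ι : Type*} {l : Filter ι} {e : ι → Fin 5 → ℝ} {ε : Fin 5 → ℝ}

/-- `perA` diverges. Only `ε 0 < ε 3` is asked of the remaining end points, so `ε 2` may coincide
with `ε 1` or `ε 3` and the corners of the domain are covered. -/
theorem tendsto_freqOf_fst_half (hadm : ∀ᶠ i in l, e i ∈ admissible) (he : Tendsto e l (𝓝 ε))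
    (h0 : 0 < ε 0) (h01 : ε 0 = ε 1) (h03 : ε 0 < ε 3) (h4 : 0 < ε 4) :
    Tendsto (fun i => (freqOf (e i)).1) l (𝓝 (1 / 2)) := by
  have t := tendsto_pi_nhds.1 he
  have hlog : Tendsto (fun i => Real.log (e i 1 / (e i 1 - e i 0))) l atTop := by
    refine tendsto_log_div_sub_atTop (h01 ▸ h0) (t 1) ?_ ?_
    · simpa [h01] using (t 1).sub (t 0)
    · filter_upwards [hadm] with i hi
      linarith [(chain_five hi.1).1]
  have hA : Tendsto (fun i => perA (e i) 0) l atTop := by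
    have h1 : Tendsto (fun i => (√(e i 4 ^ 3))⁻¹) l (𝓝 (√(ε 4 ^ 3))⁻¹) :=
      ((t 4).pow 3).sqrt.inv₀ (by positivity)
    refine tendsto_atTop_mono' l ?_ (hlog.atTop_mul_pos (by positivity) h1)
    filter_upwards [hadm] with i hi
    exact le_perA_zero hi.1 hi.2
  have hnum : Tendsto (fun i => e i 4 / e i 0 * (2 / √(e i 0))) l
      (𝓝 (ε 4 / ε 0 * (2 / √(ε 0)))) :=
    ((t 4).div (t 0) h0.ne').mul (tendsto_const_nhds.div (t 0).sqrt (Real.sqrt_pos.2 h0).ne')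
  have hden : Tendsto (fun i => 2 * (e i 3 - e i 0) * perA (e i) 0) l atTop :=
    (((t 3).sub (t 0)).const_mul 2).pos_mul_atTop (by linarith) hA
  have hz := hnum.div_atTop hden
  have hlim : Tendsto (fun i => 1 / 2 - (freqOf (e i)).1) l (𝓝 0) := by
    refine squeeze_zero' ?_ ?_ hz
    · filter_upwards [hadm] with i hi
      linarith [(freqOf_mem_freqSpace hi.1 hi.2).2.2]
    · filter_upwards [hadm] with i hi
      exact one_sub_freqOf_fst_le hi.1 hi.2
  have := hlim.const_sub (1 / 2)
  rw [sub_zero] at this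
  exact this.congr fun i => by ring

theorem tendsto_freqOf_fst_sub_snd (hadm : ∀ᶠ i in l, e i ∈ admissible) (he : Tendsto e l (𝓝 ε))
    (h0 : 0 < ε 0) (h03 : ε 0 < ε 3) (h23 : ε 2 = ε 3) (h34 : ε 3 < ε 4) :
    Tendsto (fun i => (freqOf (e i)).1 - (freqOf (e i)).2) l (𝓝 0) := by
  have t := tendsto_pi_nhds.1 he
  have hlog : Tendsto (fun i => Real.log ((e i 4 - e i 2) / (e i 3 - e i 2))) l atTop := by
    refine tendsto_log_div_sub_atTop (A := ε 4 - ε 2) (by linarith) ((t 4).sub (t 2)) ?_ ?_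
    · simpa [h23] using (t 3).sub (t 2)
    · filter_upwards [hadm] with i hi
      linarith [(chain_five hi.1).2.2.1]
  have h4 : 0 < ε 4 := by linarith
  have hC : Tendsto (fun i => perC (e i) 0) l atTop := by
    have h1 : Tendsto (fun i => (√(e i 4 ^ 3))⁻¹) l (𝓝 (√(ε 4 ^ 3))⁻¹) :=
      ((t 4).pow 3).sqrt.inv₀ (by positivity)
    refine tendsto_atTop_mono' l ?_ (hlog.atTop_mul_pos (by positivity) h1)
    filter_upwards [hadm] with i hi
    exact le_perC_zero hi.1 hi.2
  have hnum : Tendsto (fun i => e i 4 / e i 0 * (2 / √(e i 0))) l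
      (𝓝 (ε 4 / ε 0 * (2 / √(ε 0)))) :=
    ((t 4).div (t 0) h0.ne').mul (tendsto_const_nhds.div (t 0).sqrt (Real.sqrt_pos.2 h0).ne')
  have hden : Tendsto (fun i => 2 * (e i 3 - e i 0) * perC (e i) 0) l atTop :=
    (((t 3).sub (t 0)).const_mul 2).pos_mul_atTop (by linarith) hC
  refine squeeze_zero' ?_ ?_ (hnum.div_atTop hden)
  · filter_upwards [hadm] with i hi
    linarith [(freqOf_mem_freqSpace hi.1 hi.2).2.1]
  · filter_upwards [hadm] with i hi
    exact freqOf_fst_sub_snd_le hi.1 hi.2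

theorem tendsto_freqOf_fst_zero (hadm : ∀ᶠ i in l, e i ∈ admissible) (he : Tendsto e l (𝓝 ε))
    (h0 : ε 0 = 0) (h1 : 0 < ε 1) (h3 : 0 < ε 3) (h4 : 0 < ε 4) :
    Tendsto (fun i => (freqOf (e i)).1) l (𝓝 0) := by
  have t := tendsto_pi_nhds.1 he
  have hA : Tendsto (fun i => perA (e i) 0) l (𝓝 0) := by
    have hb : Tendsto (fun i => 2 * √(e i 0) / (e i 1 - e i 0) ^ 2) l
        (𝓝 (2 * √(ε 0) / (ε 1 - ε 0) ^ 2)) :=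
      ((t 0).sqrt.const_mul 2).div (((t 1).sub (t 0)).pow 2) (by rw [h0, sub_zero]; positivity)
    rw [h0, Real.sqrt_zero, mul_zero, zero_div] at hb
    refine squeeze_zero' ?_ ?_ hb
    · filter_upwards [hadm] with i hi
      exact (perA_pos hi.1 hi.2 0).le
    · filter_upwards [hadm] with i hi
      exact perA_zero_le hi.1 hi.2
  have hden : Tendsto (fun i => 2 * (e i 3 / √((e i 4 + 1) ^ 5))) l
      (𝓝 (2 * (ε 3 / √((ε 4 + 1) ^ 5)))) :=
    ((t 3).div (((t 4).add_const 1).pow 5).sqrt (by positivity)).const_mul 2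
  have hb := ((t 4).mul hA).div hden (by positivity)
  rw [mul_zero, zero_div] at hb
  refine squeeze_zero' ?_ ?_ hb
  · filter_upwards [hadm] with i hi
    have := freqOf_mem_freqSpace hi.1 hi.2
    exact (this.1.trans this.2.1).le
  · filter_upwards [hadm] with i hi
    exact freqOf_fst_le hi.1 hi.2

theorem tendsto_distortion (he : Tendsto e l (𝓝 ε)) (h01 : ε 0 < ε 1) (h12 : ε 1 = ε 2)
    (h23 : ε 2 < ε 3) : Tendsto (fun i => distortion (e i)) l (𝓝 1) := by
  have t := tendsto_pi_nhds.1 he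
  have h := ((((t 2).sub (t 0)).div ((t 1).sub (t 0)) (by linarith)).sqrt).mul
    ((((t 3).sub (t 1)).div ((t 3).sub (t 2)) (by linarith)).sqrt)
  rw [h12, div_self (by linarith), div_self (by linarith), Real.sqrt_one, one_mul] at h
  exact h

end Limits

/-- At the boundary only one scalar function `φ` of the frequencies need converge; a value is
excluded as soon as that function separates it from the limit. -/
theorem disjoint_nhds_map_of_tendsto {X Y Z : Type*} [TopologicalSpace Y] [TopologicalSpace Z]
    [T2Space Z] {l : Filter X} {f : X → Y} {φ : Y → Z} (hφ : Continuous φ) {v : Y} {z : Z}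
    (h : Tendsto (fun x => φ (f x)) l (𝓝 z)) (hv : φ v ≠ z) : Disjoint (𝓝 v) (map f l) :=
  Tendsto.disjoint (hφ.tendsto v) (disjoint_nhds_nhds.2 hv) (tendsto_map'_iff.2 h)

section Components

/-! ### The frequency map on the components `H₁ ⊗ H₁` and `E × H₁` -/

/-- The end points `c₁, …, c₅`. -/
def ends (a b c : ℝ) (p : ℝ × ℝ) : Fin 5 → ℝ := fun i => endpt a b c p i.succ

theorem freq_eq_freqOf (a b c : ℝ) (p : ℝ × ℝ) : freq a b c p = freqOf (ends a b c p) := by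
  have hT : T a b c p = rootPoly (ends a b c p) := by
    ext s
    rw [endpt_prod, rootPoly_five]
    rfl
  simp only [freq, freqDet, K0, K1, K2, hyperInt, hT, freqOf, perDet, perA, perB, perC, rootInt]
  rfl

variable {a b c : ℝ}

theorem ends_mem_admissible (hc : 0 < c) (hcb : c < b) (hba : b < a) {p : ℝ × ℝ}
    (hp : p ∈ causticSpace a b c) : ends a b c p ∈ admissible := by
  refine ⟨Fin.strictMono_iff_lt_succ.2 fun i => ?_, endpt_lt_succ hc hcb hba hp 0⟩
  exact endpt_lt_succ hc hcb hba hp i.succ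

theorem H1H1_subset : H1H1 b c ⊆ causticSpace a b c := fun _ hp => Or.inl (Or.inl (Or.inr hp))

theorem EH1_subset : E c ×ˢ H1 b c ⊆ causticSpace a b c :=
  fun _ hp => Or.inl (Or.inl (Or.inl hp))

theorem ends_of_mem_H1H1 {p : ℝ × ℝ} (hp : p ∈ H1H1 b c) :
    ends a b c p = ![c, p.1, p.2, b, a] := by
  have h1 : c ≤ p.1 := hp.1.1.1.le
  have h2 : p.2 ≤ b := hp.1.2.2.le
  ext i
  fin_cases i <;> simp [ends, endpt, h1, h2]

theorem ends_of_mem_EH1 {p : ℝ × ℝ} (hp : p ∈ E c ×ˢ H1 b c) :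
    ends a b c p = ![p.1, c, p.2, b, a] := by
  have h1 : p.1 ≤ c := hp.1.2.le
  have h2 : p.2 ≤ b := hp.2.2.le
  ext i
  fin_cases i <;> simp [ends, endpt, h1, h2]

theorem isOpen_H1H1 : IsOpen (H1H1 b c) :=
  (isOpen_Ioo.prod isOpen_Ioo).inter (isOpen_lt continuous_fst continuous_snd)

theorem isOpen_EH1 : IsOpen (E c ×ˢ H1 b c) := isOpen_Ioo.prod isOpen_Ioo

/-- On a single component the minima and maxima in `endpt` resolve to fixed choices, so the end
points depend smoothly on the parameter. -/
theorem contDiffAt_freq_of_eqOn {U : Set (ℝ × ℝ)} (hU : IsOpen U) {g : ℝ × ℝ → Fin 5 → ℝ}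
    (hg : ContDiff ℝ (⊤ : ℕ∞) g) (hgU : ∀ p ∈ U, ends a b c p = g p ∧ ends a b c p ∈ admissible)
    {p : ℝ × ℝ} (hp : p ∈ U) : ContDiffAt ℝ (⊤ : ℕ∞) (freq a b c) p := by
  have h1 : ContDiffAt ℝ (⊤ : ℕ∞) freqOf (g p) :=
    contDiffOn_freqOf.contDiffAt (isOpen_admissible.mem_nhds ((hgU p hp).1 ▸ (hgU p hp).2))
  refine (h1.comp p hg.contDiffAt).congr_of_eventuallyEq ?_
  filter_upwards [hU.mem_nhds hp] with q hq
  rw [freq_eq_freqOf, (hgU q hq).1]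
  rfl

theorem contDiff_ends_H1H1 : ContDiff ℝ (⊤ : ℕ∞) fun p : ℝ × ℝ => ![c, p.1, p.2, b, a] := by
  rw [contDiff_pi]
  intro i
  fin_cases i
  · exact contDiff_const
  · exact contDiff_fst
  · exact contDiff_snd
  · exact contDiff_const
  · exact contDiff_const

theorem contDiff_ends_EH1 : ContDiff ℝ (⊤ : ℕ∞) fun p : ℝ × ℝ => ![p.1, c, p.2, b, a] := by
  rw [contDiff_pi]
  intro i
  fin_cases i
  · exact contDiff_fst
  · exact contDiff_const
  · exact contDiff_snd
  · exact contDiff_const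
  · exact contDiff_const

theorem contDiffAt_freq_H1H1 (hc : 0 < c) (hcb : c < b) (hba : b < a) {p : ℝ × ℝ}
    (hp : p ∈ H1H1 b c) : ContDiffAt ℝ (⊤ : ℕ∞) (freq a b c) p :=
  contDiffAt_freq_of_eqOn isOpen_H1H1 contDiff_ends_H1H1
    (fun _ hq => ⟨ends_of_mem_H1H1 hq, ends_mem_admissible hc hcb hba (H1H1_subset hq)⟩) hp

theorem contDiffAt_freq_EH1 (hc : 0 < c) (hcb : c < b) (hba : b < a) {p : ℝ × ℝ}
    (hp : p ∈ E c ×ˢ H1 b c) : ContDiffAt ℝ (⊤ : ℕ∞) (freq a b c) p :=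
  contDiffAt_freq_of_eqOn isOpen_EH1 contDiff_ends_EH1
    (fun _ hq => ⟨ends_of_mem_EH1 hq, ends_mem_admissible hc hcb hba (EH1_subset hq)⟩) hp

theorem freq_mem_freqSpace (hc : 0 < c) (hcb : c < b) (hba : b < a) {p : ℝ × ℝ}
    (hp : p ∈ causticSpace a b c) : freq a b c p ∈ freqSpace := by
  have h := ends_mem_admissible hc hcb hba hp
  rw [freq_eq_freqOf]
  exact freqOf_mem_freqSpace h.1 h.2

theorem isLocalHomeomorphOn_freq_H1H1 (hc : 0 < c) (hcb : c < b) (hba : b < a)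
    (hnd : FreqNondegenerate a b c) : IsLocalHomeomorphOn (freq a b c) (H1H1 b c) :=
  isLocalHomeomorphOn_of_det_ne_zero (fun _ hp => contDiffAt_freq_H1H1 hc hcb hba hp)
    fun p hp => hnd p (H1H1_subset hp)

theorem isLocalHomeomorphOn_freq_EH1 (hc : 0 < c) (hcb : c < b) (hba : b < a)
    (hnd : FreqNondegenerate a b c) : IsLocalHomeomorphOn (freq a b c) (E c ×ˢ H1 b c) :=
  isLocalHomeomorphOn_of_det_ne_zero (fun _ hp => contDiffAt_freq_EH1 hc hcb hba hp)
    fun p hp => hnd p (EH1_subset hp)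

theorem isOpen_image_of_isLocalHomeomorphOn {X Y : Type*} [TopologicalSpace X] [TopologicalSpace Y]
    {f : X → Y} {U : Set X} (hU : IsOpen U) (hf : IsLocalHomeomorphOn f U) : IsOpen (f '' U) := by
  rw [isOpen_iff_mem_nhds]
  rintro _ ⟨p, hp, rfl⟩
  rw [← hf.map_nhds_eq hp]
  exact image_mem_map (hU.mem_nhds hp)

/-- The admissible end points along `𝓝[U] p`, for a component `U` of the caustic space. -/
theorem eventually_admissible_H1H1 (hc : 0 < c) (hcb : c < b) (hba : b < a) (p : ℝ × ℝ) :
    ∀ᶠ q : ℝ × ℝ in 𝓝[H1H1 b c] p, ![c, q.1, q.2, b, a] ∈ admissible := by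
  filter_upwards [self_mem_nhdsWithin] with q hq
  rw [← ends_of_mem_H1H1 hq]
  exact ends_mem_admissible hc hcb hba (H1H1_subset hq)

theorem eventually_admissible_EH1 (hc : 0 < c) (hcb : c < b) (hba : b < a) (p : ℝ × ℝ) :
    ∀ᶠ q : ℝ × ℝ in 𝓝[E c ×ˢ H1 b c] p, ![q.1, c, q.2, b, a] ∈ admissible := by
  filter_upwards [self_mem_nhdsWithin] with q hq
  rw [← ends_of_mem_EH1 hq]
  exact ends_mem_admissible hc hcb hba (EH1_subset hq)

theorem eventuallyEq_freq_H1H1 (a b c : ℝ) (p : ℝ × ℝ) :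
    (fun q : ℝ × ℝ => freqOf ![c, q.1, q.2, b, a]) =ᶠ[𝓝[H1H1 b c] p] freq a b c := by
  filter_upwards [self_mem_nhdsWithin] with q hq
  rw [freq_eq_freqOf, ends_of_mem_H1H1 hq]

theorem eventuallyEq_freq_EH1 (a b c : ℝ) (p : ℝ × ℝ) :
    (fun q : ℝ × ℝ => freqOf ![q.1, c, q.2, b, a]) =ᶠ[𝓝[E c ×ˢ H1 b c] p] freq a b c := by
  filter_upwards [self_mem_nhdsWithin] with q hq
  rw [freq_eq_freqOf, ends_of_mem_EH1 hq]

theorem tendsto_ends_H1H1 (p : ℝ × ℝ) (U : Set (ℝ × ℝ)) :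
    Tendsto (fun q : ℝ × ℝ => ![c, q.1, q.2, b, a]) (𝓝[U] p) (𝓝 ![c, p.1, p.2, b, a]) :=
  (contDiff_ends_H1H1.continuous.tendsto p).mono_left nhdsWithin_le_nhds

theorem tendsto_ends_EH1 (p : ℝ × ℝ) (U : Set (ℝ × ℝ)) :
    Tendsto (fun q : ℝ × ℝ => ![q.1, c, q.2, b, a]) (𝓝[U] p) (𝓝 ![p.1, c, p.2, b, a]) :=
  (contDiff_ends_EH1.continuous.tendsto p).mono_left nhdsWithin_le_nhds

theorem closure_H1H1_subset :
    closure (H1H1 b c) ⊆ (Icc c b ×ˢ Icc c b) ∩ {p | p.1 ≤ p.2} := by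
  refine closure_minimal (fun p hp => ⟨⟨Ioo_subset_Icc_self hp.1.1, Ioo_subset_Icc_self hp.1.2⟩,
    hp.2.le⟩) ?_
  exact (isClosed_Icc.prod isClosed_Icc).inter (isClosed_le continuous_fst continuous_snd)

theorem isCompact_closure_H1H1 : IsCompact (closure (H1H1 b c)) :=
  (isCompact_Icc.prod isCompact_Icc).of_isClosed_subset isClosed_closure
    (closure_H1H1_subset.trans inter_subset_left)

theorem closure_EH1_subset : closure (E c ×ˢ H1 b c) ⊆ Icc 0 c ×ˢ Icc c b :=
  closure_minimal (prod_mono Ioo_subset_Icc_self Ioo_subset_Icc_self)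
    (isClosed_Icc.prod isClosed_Icc)

theorem isCompact_closure_EH1 : IsCompact (closure (E c ×ˢ H1 b c)) :=
  (isCompact_Icc.prod isCompact_Icc).of_isClosed_subset isClosed_closure closure_EH1_subset

theorem isPreconnected_H1H1 : IsPreconnected (H1H1 b c) := by
  have h3 : Convex ℝ {w : ℝ × ℝ | w.1 - w.2 < 0} :=
    convex_halfSpace_lt (LinearMap.fst ℝ ℝ ℝ - LinearMap.snd ℝ ℝ ℝ).isLinear _
  simp only [sub_neg] at h3
  exact (((convex_Ioo c b).prod (convex_Ioo c b)).inter h3).isPreconnected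

/-- The cluster values of the frequency map at the boundary of `H₁ ⊗ H₁` lie on the three lines
bounding the triangle. -/
theorem disjoint_nhds_map_freq_H1H1 (hc : 0 < c) (hcb : c < b) (hba : b < a) {p : ℝ × ℝ}
    (hp : p ∈ closure (H1H1 b c) \ H1H1 b c) {v : ℝ × ℝ} (h1 : v.1 ≠ 1 / 2) (h2 : v.1 ≠ v.2)
    (h3 : v.2 ≠ rotationNumber c b a) :
    Disjoint (𝓝 v) (map (freq a b c) (𝓝[H1H1 b c] p)) := by
  obtain ⟨x, y⟩ := p
  obtain ⟨hcl, hU⟩ := hp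
  obtain ⟨⟨⟨hx1, hx2⟩, ⟨hy1, hy2⟩⟩, hxy⟩ := closure_H1H1_subset hcl
  simp only [mem_ofPred_eq] at hx1 hx2 hy1 hy2 hxy
  have hadm := eventually_admissible_H1H1 hc hcb hba (x, y)
  have hev := eventuallyEq_freq_H1H1 a b c (x, y)
  have ht := tendsto_ends_H1H1 (a := a) (b := b) (c := c) (x, y) (H1H1 b c)
  rw [← map_congr hev]
  -- The edge `λ₁ = c`, including its corners, is a collision of `e₀` and `e₁`.
  rcases hx1.eq_or_lt with rfl | hx1
  · refine disjoint_nhds_map_of_tendsto continuous_fst (z := 1 / 2) ?_ h1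
    exact tendsto_freqOf_fst_half hadm ht hc rfl hcb (by simp; linarith)
  -- The edge `λ₂ = b` is a collision of `e₂` and `e₃`.
  rcases hy2.eq_or_lt with rfl | hy2
  · refine disjoint_nhds_map_of_tendsto (φ := fun w : ℝ × ℝ => w.1 - w.2) (by fun_prop) (z := 0) ?_
      (sub_ne_zero.2 h2)
    exact tendsto_freqOf_fst_sub_snd hadm ht hc hcb rfl hba
  -- What remains is the diagonal, where `e₁` and `e₂` merge strictly between `c` and `b`, so the
  -- distortion tends to `1`.
  have hxy' : x = y := by
    refine hxy.eq_or_lt.resolve_right fun h => hU ?_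
    exact ⟨⟨⟨hx1, by linarith⟩, ⟨by linarith, hy2⟩⟩, h⟩
  subst hxy'
  refine disjoint_nhds_map_of_tendsto continuous_snd (z := rotationNumber c b a) ?_ h3
  have hd := tendsto_distortion ht hx1 rfl hy2
  have hl := (hd.inv₀ one_ne_zero).mul_const (rotationNumber c b a)
  have hr := hd.mul_const (rotationNumber c b a)
  rw [inv_one, one_mul] at hl
  rw [one_mul] at hr
  refine tendsto_of_tendsto_of_tendsto_of_le_of_le' hl hr ?_ ?_
  · filter_upwards [hadm] with q hq using (freqOf_snd_bounds hq.1 hq.2).1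
  · filter_upwards [hadm] with q hq using (freqOf_snd_bounds hq.1 hq.2).2

theorem disjoint_nhds_map_freq_EH1 (hc : 0 < c) (hcb : c < b) (hba : b < a) {p : ℝ × ℝ}
    (hp : p ∈ closure (E c ×ˢ H1 b c) \ (E c ×ˢ H1 b c)) {v : ℝ × ℝ}
    (hv : v ∈ wedge (rotationNumber c b a)) :
    Disjoint (𝓝 v) (map (freq a b c) (𝓝[E c ×ˢ H1 b c] p)) := by
  obtain ⟨x, y⟩ := p
  obtain ⟨hcl, hU⟩ := hp
  obtain ⟨⟨hx1, hx2⟩, ⟨hy1, hy2⟩⟩ := closure_EH1_subset hcl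
  simp only at hx1 hx2 hy1 hy2
  have hρ := rotationNumber_pos hc hcb hba
  have hadm := eventually_admissible_EH1 hc hcb hba (x, y)
  have hev := eventuallyEq_freq_EH1 a b c (x, y)
  have ht := tendsto_ends_EH1 (a := a) (b := b) (c := c) (x, y) (E c ×ˢ H1 b c)
  rw [← map_congr hev]
  rcases hx1.eq_or_lt with rfl | hx1
  · refine disjoint_nhds_map_of_tendsto continuous_fst (z := 0) ?_
      (by linarith [hv.1, hv.2.1] : 0 < v.1).ne'
    exact tendsto_freqOf_fst_zero hadm ht rfl hc (hc.trans hcb) (hc.trans (hcb.trans hba))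
  rcases hx2.eq_or_lt with rfl | hx2
  · refine disjoint_nhds_map_of_tendsto continuous_fst (z := 1 / 2) ?_ hv.2.2.ne
    exact tendsto_freqOf_fst_half hadm ht hx1 rfl hcb (hx1.trans (hcb.trans hba))
  rcases hy2.eq_or_lt with rfl | hy2
  · refine disjoint_nhds_map_of_tendsto (φ := fun w : ℝ × ℝ => w.1 - w.2) (by fun_prop) (z := 0) ?_
      (sub_ne_zero.2 hv.2.1.ne')
    exact tendsto_freqOf_fst_sub_snd hadm ht hx1 (hx2.trans hcb) rfl hba
  have hcy : c = y := by
    refine hy1.eq_or_lt.resolve_right fun h => hU ?_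
    exact ⟨⟨hx1, hx2⟩, ⟨h, hy2⟩⟩
  subst hcy
  -- On the edge `λ₂ = c`, `ω₂` is close to `ρ(λ₁; b, a)`, which by monotonicity is at most `ϱ_*`. A
  -- level `m` between `ϱ_*` and `v.2` thus separates `v` from all nearby values.
  obtain ⟨m, hm1, hm2⟩ := exists_between hv.1
  have hd := (tendsto_distortion ht hx2 rfl hcb).mul_const (rotationNumber c b a)
  rw [one_mul] at hd
  have hE : {w : ℝ × ℝ | w.2 < m} ∈
      map (fun q : ℝ × ℝ => freqOf ![q.1, c, q.2, b, a]) (𝓝[E c ×ˢ H1 b c] (x, c)) := by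
    rw [mem_map]
    filter_upwards [hadm, hd.eventually_lt_const hm1, self_mem_nhdsWithin] with q hq hlt hqU
    refine lt_of_le_of_lt ((freqOf_snd_bounds hq.1 hq.2).2.trans ?_) hlt
    exact mul_le_mul_of_nonneg_left (rotationNumber_mono hqU.1.1 hqU.1.2 hcb hba)
      (mul_nonneg (Real.sqrt_nonneg _) (Real.sqrt_nonneg _))
  refine Filter.disjoint_iff.2 ⟨{w | m < w.2},
    (isOpen_lt continuous_const continuous_snd).mem_nhds hm2, _, hE, ?_⟩
  rw [disjoint_left]
  intro w (hw : m < w.2) (hw' : w.2 < m)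
  exact lt_asymm hw hw'

theorem image_freq_H1H1 (hc : 0 < c) (hcb : c < b) (hba : b < a) (hnd : FreqNondegenerate a b c) :
    freq a b c '' H1H1 b c = wedge (rotationNumber c b a) := by
  have hl := isLocalHomeomorphOn_freq_H1H1 hc hcb hba hnd
  have hopen := isOpen_image_of_isLocalHomeomorphOn isOpen_H1H1 hl
  have hρ := rotationNumber_pos hc hcb hba
  have hΩ : ∀ w ∈ freq a b c '' H1H1 b c, w ∈ freqSpace := by
    rintro _ ⟨p, hp, rfl⟩
    exact freq_mem_freqSpace hc hcb hba (H1H1_subset hp)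
  have hconv : Convex ℝ {w : ℝ × ℝ | w.2 < rotationNumber c b a ∧ w.2 < w.1 ∧ w.1 < 1 / 2} := by
    have h1 : Convex ℝ {w : ℝ × ℝ | w.2 < rotationNumber c b a} :=
      convex_halfSpace_lt (LinearMap.snd ℝ ℝ ℝ).isLinear _
    have h2 : Convex ℝ {w : ℝ × ℝ | w.1 < 1 / 2} :=
      convex_halfSpace_lt (LinearMap.fst ℝ ℝ ℝ).isLinear _
    have h3 : Convex ℝ {w : ℝ × ℝ | 0 < w.1 - w.2} :=
      convex_halfSpace_gt (LinearMap.fst ℝ ℝ ℝ - LinearMap.snd ℝ ℝ ℝ).isLinear _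
    simp only [sub_pos] at h3
    exact h1.inter (h3.inter h2)
  have hlow : Disjoint {w : ℝ × ℝ | w.2 < rotationNumber c b a ∧ w.2 < w.1 ∧ w.1 < 1 / 2}
      (freq a b c '' H1H1 b c) := by
    refine (subset_image_or_disjoint isCompact_closure_H1H1 hl.continuousOn hopen
      hconv.isPreconnected fun p hp v hv => disjoint_nhds_map_freq_H1H1 hc hcb hba hp hv.2.2.ne
        hv.2.1.ne' hv.1.ne).resolve_left fun h => ?_
    -- The lower region has no bound `0 < w.2`, precisely so that it contains a point outside `Ω`
    -- and cannot be covered.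
    have : ((0, -1) : ℝ × ℝ) ∈ freqSpace := hΩ _ (h ⟨by simp only; linarith, by norm_num, by norm_num⟩)
    have := this.1
    simp only at this
    linarith
  have hsub : freq a b c '' H1H1 b c ⊆ wedge (rotationNumber c b a) := by
    intro w hw
    have hwΩ := hΩ w hw
    refine ⟨?_, hwΩ.2⟩
    by_contra hle
    rw [not_lt] at hle
    -- The line `w.2 = ϱ_*` itself is excluded because the image is open: a slight downward shift of
    -- `w` would be an image point in the lower region.
    have hcont : Tendsto (fun t : ℝ => ((w.1, w.2 - t) : ℝ × ℝ)) (𝓝[>] 0) (𝓝 w) := by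
      have : Continuous (fun t : ℝ => ((w.1, w.2 - t) : ℝ × ℝ)) := by fun_prop
      have := this.tendsto 0
      rw [sub_zero] at this
      exact this.mono_left nhdsWithin_le_nhds
    obtain ⟨t, ht1, ht2⟩ := ((hcont.eventually_mem (hopen.mem_nhds hw)).and
      self_mem_nhdsWithin).exists
    have ht : 0 < t := ht2
    refine disjoint_left.1 hlow ⟨?_, ?_, ?_⟩ ht1
    · simp only; linarith
    · simp only; linarith [hwΩ.2.1]
    · exact hwΩ.2.2
  refine hsub.antisymm ?_
  refine (subset_image_or_disjoint isCompact_closure_H1H1 hl.continuousOn hopen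
    (convex_wedge _).isPreconnected fun p hp v hv => disjoint_nhds_map_freq_H1H1 hc hcb hba hp
      hv.2.2.ne hv.2.1.ne' hv.1.ne').resolve_right fun h => ?_
  have hp : (((2 * c + b) / 3, (c + 2 * b) / 3) : ℝ × ℝ) ∈ H1H1 b c := by
    refine ⟨⟨⟨?_, ?_⟩, ⟨?_, ?_⟩⟩, ?_⟩ <;> simp only <;> linarith
  have hmem := mem_image_of_mem (freq a b c) hp
  exact disjoint_left.1 h (hsub hmem) hmem

theorem isDiffeoOnto_freq_H1H1 (hc : 0 < c) (hcb : c < b) (hba : b < a)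
    (hnd : FreqNondegenerate a b c) :
    IsDiffeoOnto (freq a b c) (H1H1 b c) (wedge (rotationNumber c b a)) := by
  have himg := image_freq_H1H1 hc hcb hba hnd
  have hl := isLocalHomeomorphOn_freq_H1H1 hc hcb hba hnd
  have hm : MapsTo (freq a b c) (H1H1 b c) (wedge (rotationNumber c b a)) :=
    fun p hp => himg ▸ mem_image_of_mem _ hp
  have hne : (wedge (rotationNumber c b a)).Nonempty := by
    have := rotationNumber_lt_half hc hcb hba
    -- The centroid of the triangle.
    refine ⟨((rotationNumber c b a + 1) / 3, (4 * rotationNumber c b a + 1) / 6), ?_, ?_, ?_⟩ <;>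
      simp only <;> linarith
  have : ContractibleSpace (wedge (rotationNumber c b a)) := (convex_wedge _).contractibleSpace hne
  have : LocallyPathConnectedSpace (wedge (rotationNumber c b a)) :=
    (isOpen_wedge _).locallyPathConnectedSpace
  have hinj : InjOn (freq a b c) (H1H1 b c) :=
    injOn_of_isProperMap isOpen_H1H1 isPreconnected_H1H1 isCompact_closure_H1H1 hl hm
      (isOpen_wedge _) fun p hp v hv => disjoint_nhds_map_freq_H1H1 hc hcb hba hp
        hv.2.2.ne hv.2.1.ne' hv.1.ne'
  exact isDiffeoOnto_of_bijOn isOpen_H1H1 (isOpen_wedge _)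
    (fun p hp => contDiffAt_freq_H1H1 hc hcb hba hp) (fun p hp => hnd p (H1H1_subset hp))
    ⟨hm, hinj, himg.superset⟩

theorem mem_closure_EH1 (hc : 0 < c) (hcb : c < b) {p : ℝ × ℝ} (hp : p ∈ Icc 0 c ×ˢ Icc c b) :
    p ∈ closure (E c ×ˢ H1 b c) := by
  rw [closure_prod_eq, E, H1, closure_Ioo hc.ne, closure_Ioo hcb.ne]
  exact hp

theorem wedge_ssubset_image_freq_EH1 (hc : 0 < c) (hcb : c < b) (hba : b < a)
    (hnd : FreqNondegenerate a b c) :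
    wedge (rotationNumber c b a) ⊂ freq a b c '' (E c ×ˢ H1 b c) := by
  have hl := isLocalHomeomorphOn_freq_EH1 hc hcb hba hnd
  have hopen := isOpen_image_of_isLocalHomeomorphOn isOpen_EH1 hl
  have hρ := rotationNumber_pos hc hcb hba
  have hρ2 := rotationNumber_lt_half hc hcb hba
  have ha : 0 < a := by linarith
  refine ssubset_iff_subset_not_subset.2 ⟨?_, fun h => ?_⟩
  · refine (subset_image_or_disjoint isCompact_closure_EH1 hl.continuousOn hopen
      (convex_wedge _).isPreconnected fun p hp v hv =>
        disjoint_nhds_map_freq_EH1 hc hcb hba hp hv).resolve_right fun h => ?_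
    -- At the corner `(c, b)` both collisions occur, so `ω` tends to the vertex `A` and enters the
    -- triangle; the disjoint alternative is impossible.
    have hne : (𝓝[E c ×ˢ H1 b c] (c, b)).NeBot := mem_closure_iff_nhdsWithin_neBot.1
      (mem_closure_EH1 hc hcb ⟨⟨hc.le, le_rfl⟩, ⟨hcb.le, le_rfl⟩⟩)
    have hadm := eventually_admissible_EH1 hc hcb hba (c, b)
    have ht := tendsto_ends_EH1 (a := a) (b := b) (c := c) (c, b) (E c ×ˢ H1 b c)
    have t1 := tendsto_freqOf_fst_half hadm ht hc rfl hcb ha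
    have t2 := tendsto_freqOf_fst_sub_snd hadm ht hc hcb rfl hba
    have t3 := t1.sub t2
    rw [sub_zero] at t3
    obtain ⟨q, hq1, hq2, hq3⟩ := ((t3.eventually_const_lt hρ2).and
      ((eventuallyEq_freq_EH1 a b c (c, b)).and self_mem_nhdsWithin)).exists
    replace hq2 : freqOf ![q.1, c, q.2, b, a] = freq a b c q := hq2
    rw [sub_sub_cancel, hq2] at hq1
    exact disjoint_left.1 h ⟨hq1, (freq_mem_freqSpace hc hcb hba (EH1_subset hq3)).2⟩
      (mem_image_of_mem _ hq3)
  -- Near `λ₁ = 0`, `ω₁` falls below `ϱ_*`, whereas every point of the triangle has `w.1 > ϱ_*`.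
  · have hne : (𝓝[E c ×ˢ H1 b c] (0, b)).NeBot := mem_closure_iff_nhdsWithin_neBot.1
      (mem_closure_EH1 hc hcb ⟨⟨le_rfl, hc.le⟩, ⟨hcb.le, le_rfl⟩⟩)
    have hadm := eventually_admissible_EH1 hc hcb hba (0, b)
    have ht := tendsto_ends_EH1 (a := a) (b := b) (c := c) (0, b) (E c ×ˢ H1 b c)
    have t1 := tendsto_freqOf_fst_zero hadm ht rfl hc (hc.trans hcb) ha
    obtain ⟨q, hq1, hq2, hq3⟩ := ((t1.eventually_lt_const hρ).and
      ((eventuallyEq_freq_EH1 a b c (0, b)).and self_mem_nhdsWithin)).exists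
    replace hq2 : freqOf ![q.1, c, q.2, b, a] = freq a b c q := hq2
    rw [hq2] at hq1
    have hw := h (mem_image_of_mem _ hq3)
    exact lt_asymm hq1 (hw.1.trans hw.2.1)

end Components

end TriaxialBilliard

end

open TriaxialBilliard in
theorem proposition5p3 (a b : ℝ) (hb : 0 < b) (hba : b < a) :
    (∀ c : ℝ, 0 < c → c < b → FreqNondegenerate a b c →
      freq a b c '' H1H1 b c = triangleAB1C1 a b c ∧
      triangleAB1C1 a b c ⊂ freq a b c '' (E c ×ˢ H1 b c) ∧
      IsDiffeoOnto (freq a b c) (H1H1 b c) (triangleAB1C1 a b c) ∧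
      ∀ w ∈ freqSpace, w ∈ freq a b c '' H1H1 b c ↔ rotationNumber c b a < w.2) ∧
    SetTendsto (fun c => triangleAB1C1 a b c) (𝓝[>] 0) freqSpace ∧
    SetTendsto (fun c => triangleAB1C1 a b c) (𝓝[<] b) ∅ := by
  refine ⟨fun c hc hcb hnd => ?_, setTendsto_triangle_zero hb hba, setTendsto_triangle_empty hb hba⟩
  rw [triangleAB1C1_eq hc hcb hba, image_freq_H1H1 hc hcb hba hnd]
  exact ⟨rfl, wedge_ssubset_image_freq_EH1 hc hcb hba hnd, isDiffeoOnto_freq_H1H1 hc hcb hba hnd,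
    fun w hw => ⟨fun h => h.1, fun h => ⟨h, hw.2⟩⟩⟩
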